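/- **Setting.** Let $\mathcal L_0\subseteq\mathcal L$ be first-order languages (possibly many-sorted, with the same sorts). For a theory $S$ let $S^\forall$ be the set of its universal consequences; theories are identified with their deductive closures. Let $T_0$ be a complete and model complete $\mathcal L_0$-theory and $\mathcal U_0\models T_0$ a monster model: it is $\kappa$-saturated and strongly $\kappa$-homogeneous, where $\kappa$ is a limit cardinal of cofinality greater than $2^{|\mathcal L|}$ (for instance, $\kappa>|\mathcal L|$ strongly inaccessible). *Small* means of cardinality $<\kappa$. Let $⫝^0$ be an $\operatorname{Aut}(\mathcal U_0)$-invariant ternary relation on small subsets of $\mathcal U_0$, and $\operatorname{acl}_0$ the algebraic closure in $\mathcal U_0$. Let $T$ be an $\mathcal L$-theory with $T_0^\forall\subseteq T$. Assume that $T$ is *derivation-like* with respect to $(T_0,⫝^0)$: whenever $A,B,C\models T^\forall$ are small, $C$ is a common $\mathcal L$-substructure of $A$ and $B$, $A,B\le_{\mathcal L_0}\mathcal U_0$, $\operatorname{acl}_0(C)\cap A=\operatorname{acl}_0(C)\cap B=C$ and $A⫝^0_C B$, then (i) there is $M\models T$ with $M\le_{\mathcal L_0}\mathcal U_0$ and $A,B\le_{\mathcal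 L}M$; and (ii) for every such $M$ and every $\mathcal L_0$-structure $D$ with $\langle A,B\rangle_{\mathcal L_0}\le_{\mathcal L_0}D\le_{\mathcal L_0}\operatorname{acl}_0(A,B)\cap M$ we have $D\le_{\mathcal L}M$, and this is the only $\mathcal L$-structure on $D$ that expands its $\mathcal L_0$-structure, is a model of $T^\forall$ and extends the $\mathcal L$-structures of $A$ and $B$. Let $T_+\supseteq T$ be the model companion of $T$, and let $\mathcal U_+$ be a monster model (with the same $\kappa$) of a completion of $T_+$ with $\mathcal U_+\le_{\mathcal L_0}\mathcal U_0$; let $\operatorname{acl}_+$ be the algebraic closure in $\mathcal U_+$ in the language $\mathcal L$. Assume that $T_0\subseteq T_+$ or $T_0$ has quantifier elimination. For small subsets of $\mathcal U_+$ define $$A⫝^+_C B\iff \operatorname{acl}_+(AC)\;⫝^0_{\operatorname{acl}_+(C)}\;\operatorname{acl}_+(BC).$$ **Properties.** For a ternary relation $⫝$ on the small subsets of a monster model (all sets small; $A'\equiv_C A$ means that an automorphism fixing $C$ pointwise takes $A$ to $A'$): - *normality:* $A⫝_CB\Rightarrow A⫝_CBC$; - *monotonicity:* $A⫝_CBD\Rightarrow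 A⫝_CB$; - *left monotonicity:* $AD⫝_CB\Rightarrow A⫝_CB$ (it follows from monotonicity and symmetry); - *base monotonicity:* $A⫝_CBD\Rightarrow A⫝_{CD}B$; - *transitivity:* $A⫝_CB$ and $A⫝_BD$ imply $A⫝_CD$ for $C\subseteq B\subseteq D$; - *symmetry:* $A⫝_CB\Rightarrow B⫝_CA$; - *full existence:* for all $A,B,C$ there is $A'\equiv_CA$ with $A'⫝_CB$; - *finite character:* if $A_0⫝_CB$ for all finite $A_0\subseteq A$, then $A⫝_CB$; - *local character:* for every $A$ there is a small cardinal $\mu$ such that for every $B$ there is $C\subseteq B$ with $|C|<\mu$ and $A⫝_CB$; - *extension:* if $A⫝_CB$, then for every $D$ there is $A'\equiv_{BC}A$ with $A'⫝_CBD$. A property holds *over models* if it holds whenever $C$ (for transitivity: both $C$ and $B$) is a small model of the theory in question ($T_0$ for $⫝^0$, $T_+$ for $⫝^+$). **Theorem.** 1. $⫝^+$ is invariant under $\operatorname{Aut}(\mathcal U_+)$ and normal. 2. If $⫝^0$ satisfies any of monotonicity, left monotonicity, symmetry, then so does $⫝^+$. If $⫝^0$ satisfies finite character and left monotonicity, then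 $⫝^+$ satisfies finite character. 3. If $⫝^0$ is transitive and left monotone, then $⫝^+$ is transitive. 4. If $⫝^0$ satisfies base monotonicity, finite character and local character, then $⫝^+$ has local character. 5. If $⫝^0$ satisfies normality, monotonicity, base monotonicity, transitivity, symmetry and full existence, then $⫝^+$ satisfies base monotonicity. 6. Suppose that $T_0\subseteq T$ or $T_0$ has quantifier elimination. If $⫝^0$ satisfies monotonicity, symmetry and full existence, then $⫝^+$ satisfies full existence. 7. Suppose that $T_0\subseteq T$ or $T_0$ has quantifier elimination. If $⫝^0$ satisfies monotonicity and extension, and $T_+$ has quantifier elimination (if $T_0\subseteq T$, it is enough that $T_+$ has quantifier elimination after Morleyisation of $\mathcal L_0$, that is, after adding a relation symbol for each $\mathcal L_0$-formula), then $⫝^+$ satisfies extension. In addition, if $T_0\subseteq T_+$, then (2), (3) and (7) also hold for the corresponding properties stated over models. -/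

import Mathlib

universe u

namespace MultiSorted

/-! Many-sorted first-order logic. `S` is the set of sorts; contexts and arities are lists of
sorts. The one-sorted case is the case where `S` is a singleton. Sorts may be empty. -/

/-- A many-sorted first-order language with set of sorts `S`. -/
structure Lang (S : Type u) where
  /-- function symbols of given argument sorts and value sort (constants have no arguments) -/
  Fn : List S → S → Type u
  /-- relation symbols of given argument sorts -/
  Rel : List S → Type u

variable {S : Type u} {L₀ L : Lang S} {M N U : S → Type u}

/-- The cardinality of a language: number of sorts and symbols, and at least `ℵ₀`. -/
noncomputable def Lang.card (L : Lang S) : Cardinal.{u} :=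
  max Cardinal.aleph0 (Cardinal.mk
    (S ⊕ (Σ p : List S × S, L.Fn p.1 p.2) ⊕ (Σ Γ : List S, L.Rel Γ)))

/-- `L₀ ⊆ L`, two languages with the same sorts. -/
structure Incl (L₀ L : Lang S) where
  onFn : ∀ {Γ : List S} {s : S}, L₀.Fn Γ s → L.Fn Γ s
  onRel : ∀ {Γ : List S}, L₀.Rel Γ → L.Rel Γ
  onFn_injective : ∀ (Γ : List S) (s : S),
    Function.Injective (onFn : L₀.Fn Γ s → L.Fn Γ s)
  onRel_injective : ∀ Γ : List S, Function.Injective (onRel : L₀.Rel Γ → L.Rel Γ)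

/-- Tuples of elements of `M` of sorts `Γ`. -/
abbrev Env (M : S → Type u) (Γ : List S) : Type u := ∀ j : Fin Γ.length, M (Γ.get j)

/-- The tuple `x, v`. -/
def Env.cons {Γ : List S} {s : S} (x : M s) (v : Env M Γ) : Env M (s :: Γ) :=
  Fin.cons (α := fun j : Fin (Γ.length + 1) => M ((s :: Γ).get j)) x v

/-- The empty tuple. -/
def Env.nil : Env M ([] : List S) := fun j => j.elim0

/-- An `L`-structure on the family of sets `M`. -/
@[ext] structure Str (L : Lang S) (M : S → Type u) where
  fn : ∀ {Γ : List S} {s : S}, L.Fn Γ s → Env M Γ → M s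
  rel : ∀ {Γ : List S}, L.Rel Γ → Env M Γ → Prop

/-- The reduct of an `L`-structure to `L₀ ⊆ L`. -/
def Str.reduct (𝔐 : Str L M) (i : Incl L₀ L) : Str L₀ M where
  fn f := 𝔐.fn (i.onFn f)
  rel r := 𝔐.rel (i.onRel r)

/-- Terms in context `Γ`. -/
inductive Term (L : Lang S) (Γ : List S) : S → Type u
  | var (j : Fin Γ.length) : Term L Γ (Γ.get j)
  | app {Δ : List S} {s : S} (f : L.Fn Δ s)
      (t : ∀ j : Fin Δ.length, Term L Γ (Δ.get j)) : Term L Γ s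

/-- First-order formulas with free variables in the context `Γ`; in `all φ` the quantified
variable is the first one of `φ`. -/
inductive Formula (L : Lang S) : List S → Type u
  | falsum {Γ : List S} : Formula L Γ
  | eq {Γ : List S} {s : S} (t₁ t₂ : Term L Γ s) : Formula L Γ
  | rel {Γ Δ : List S} (r : L.Rel Δ) (t : ∀ j : Fin Δ.length, Term L Γ (Δ.get j)) : Formula L Γ
  | imp {Γ : List S} (φ ψ : Formula L Γ) : Formula L Γ
  | all {Γ : List S} {s : S} (φ : Formula L (s :: Γ)) : Formula L Γ

/-- The value of a term under an assignment. -/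
def Term.val (𝔐 : Str L M) {Γ : List S} (v : Env M Γ) : ∀ {s : S}, Term L Γ s → M s
  | _, .var j => v j
  | _, .app f t => 𝔐.fn f (fun j => (t j).val 𝔐 v)

/-- Truth of a formula under an assignment. -/
def Formula.Holds (𝔐 : Str L M) : ∀ {Γ : List S}, Formula L Γ → Env M Γ → Prop
  | _, .falsum, _ => False
  | _, .eq t₁ t₂, v => t₁.val 𝔐 v = t₂.val 𝔐 v
  | _, .rel r t, v => 𝔐.rel r (fun j => (t j).val 𝔐 v)
  | _, .imp φ ψ, v => φ.Holds 𝔐 v → ψ.Holds 𝔐 v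
  | _, .all (s := s) φ, v => ∀ x : M s, φ.Holds 𝔐 (Env.cons x v)

/-- Quantifier-free formulas. -/
inductive Formula.IsQF : ∀ {Γ : List S}, Formula L Γ → Prop
  | falsum {Γ : List S} : IsQF (.falsum : Formula L Γ)
  | eq {Γ : List S} {s : S} (t₁ t₂ : Term L Γ s) : IsQF (.eq t₁ t₂)
  | rel {Γ Δ : List S} (r : L.Rel Δ) (t : ∀ j : Fin Δ.length, Term L Γ (Δ.get j)) :
      IsQF (.rel r t)
  | imp {Γ : List S} {φ ψ : Formula L Γ} (hφ : IsQF φ) (hψ : IsQF ψ) : IsQF (.imp φ ψ)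

/-- Universal formulas: a block of universal quantifiers followed by a quantifier-free formula. -/
inductive Formula.IsUniversal : ∀ {Γ : List S}, Formula L Γ → Prop
  | of_qf {Γ : List S} {φ : Formula L Γ} (h : φ.IsQF) : IsUniversal φ
  | all {Γ : List S} {s : S} {φ : Formula L (s :: Γ)} (h : IsUniversal φ) :
      IsUniversal (.all φ)

/-- A theory: a set of sentences. -/
abbrev Theory (L : Lang S) : Type u := Set (Formula L [])

/-- `𝔐 ⊨ T`. -/
def Str.Models (𝔐 : Str L M) (T : Theory L) : Prop := ∀ φ ∈ T, φ.Holds 𝔐 Env.nil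

/-- `T ⊨ φ`. -/
def Theory.Entails (T : Theory L) (φ : Formula L []) : Prop :=
  ∀ (M : S → Type u) (𝔐 : Str L M), 𝔐.Models T → φ.Holds 𝔐 Env.nil

/-- `T^∀`, the set of universal consequences of `T`. -/
def Theory.universal (T : Theory L) : Theory L := {φ | φ.IsUniversal ∧ T.Entails φ}

/-- `T ⊆ T'` for the deductive closures of `T` and `T'`. -/
def Theory.Contained (T T' : Theory L) : Prop := ∀ φ ∈ T, T'.Entails φ

/-- `T₀ ⊆ T` for the deductive closures of an `L₀`-theory `T₀` and an `L`-theory `T`, where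
`L₀ ⊆ L`: every model of `T` is (after taking the reduct) a model of `T₀`. -/
def Theory.ContainedVia (i : Incl L₀ L) (T₀ : Theory L₀) (T : Theory L) : Prop :=
  ∀ (M : S → Type u) (𝔐 : Str L M), 𝔐.Models T → (𝔐.reduct i).Models T₀

/-- `T` is consistent and decides every sentence. -/
def Theory.IsComplete (T : Theory L) : Prop :=
  (∃ (M : S → Type u) (𝔐 : Str L M), 𝔐.Models T) ∧
    ∀ φ : Formula L [], T.Entails φ ∨ T.Entails (.imp φ .falsum)

/-- `h` is an embedding of `L`-structures. -/
structure IsEmb (𝔐 : Str L M) (𝔑 : Str L N) (h : ∀ s, M s → N s) : Prop where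
  injective : ∀ s, Function.Injective (h s)
  map_fn : ∀ {Γ : List S} {s : S} (f : L.Fn Γ s) (v : Env M Γ),
    h s (𝔐.fn f v) = 𝔑.fn f (fun j => h _ (v j))
  map_rel : ∀ {Γ : List S} (r : L.Rel Γ) (v : Env M Γ),
    𝔐.rel r v ↔ 𝔑.rel r (fun j => h _ (v j))

/-- `h` is an elementary embedding. -/
def IsElementary (𝔐 : Str L M) (𝔑 : Str L N) (h : ∀ s, M s → N s) : Prop :=
  ∀ (Γ : List S) (φ : Formula L Γ) (v : Env M Γ),
    φ.Holds 𝔐 v ↔ φ.Holds 𝔑 (fun j => h _ (v j))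

/-- `h` is an automorphism of `𝔐`. -/
def IsAut (𝔐 : Str L M) (h : ∀ s, M s ≃ M s) : Prop := IsEmb 𝔐 𝔐 (fun s => h s)

/-- Every embedding between models of `T` is elementary. -/
def Theory.IsModelComplete (T : Theory L) : Prop :=
  ∀ (M N : S → Type u) (𝔐 : Str L M) (𝔑 : Str L N) (h : ∀ s, M s → N s),
    𝔐.Models T → 𝔑.Models T → IsEmb 𝔐 𝔑 h → IsElementary 𝔐 𝔑 h

/-- Every model of `T` embeds in a model of `T'`. -/
def Theory.EmbedsIn (T T' : Theory L) : Prop :=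
  ∀ (M : S → Type u) (𝔐 : Str L M), 𝔐.Models T →
    ∃ (N : S → Type u) (𝔑 : Str L N) (h : ∀ s, M s → N s), 𝔑.Models T' ∧ IsEmb 𝔐 𝔑 h

/-- `T'` is the model companion of `T`. -/
def Theory.IsModelCompanion (T' T : Theory L) : Prop :=
  T'.IsModelComplete ∧ T.EmbedsIn T' ∧ T'.EmbedsIn T

/-- `T` has quantifier elimination. -/
def Theory.HasQE (T : Theory L) : Prop :=
  ∀ (Γ : List S) (φ : Formula L Γ), ∃ ψ : Formula L Γ, ψ.IsQF ∧
    ∀ (M : S → Type u) (𝔐 : Str L M), 𝔐.Models T → ∀ v : Env M Γ, φ.Holds 𝔐 v ↔ ψ.Holds 𝔐 v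

/-- The language `L` together with a new relation symbol for every `L₀`-formula. -/
def Lang.morley (L₀ L : Lang S) : Lang S where
  Fn := L.Fn
  Rel Γ := L.Rel Γ ⊕ Formula L₀ Γ

/-- The definitional expansion of an `L`-structure in which the symbol of an `L₀`-formula is
interpreted by the set that the formula defines. -/
def Str.morley (i : Incl L₀ L) (𝔐 : Str L M) : Str (Lang.morley L₀ L) M where
  fn f := 𝔐.fn (Γ := _) f
  rel r v := Sum.elim (fun r' => 𝔐.rel r' v) (fun φ => φ.Holds (𝔐.reduct i) v) r

/-- `T` has quantifier elimination after Morleyisation of the sublanguage `L₀`. -/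
def Theory.HasQEOver (i : Incl L₀ L) (T : Theory L) : Prop :=
  ∀ (Γ : List S) (φ : Formula L Γ), ∃ ψ : Formula (Lang.morley L₀ L) Γ, ψ.IsQF ∧
    ∀ (M : S → Type u) (𝔐 : Str L M), 𝔐.Models T →
      ∀ v : Env M Γ, φ.Holds 𝔐 v ↔ ψ.Holds (𝔐.morley i) v

/-! Subsets, algebraic closure, monster models. -/

/-- The elements of `M`, of all sorts. -/
abbrev El (M : S → Type u) : Type u := Σ s, M s

/-- All entries of the tuple `v` lie in `A`. -/
def Env.In {Γ : List S} (v : Env M Γ) (A : Set (El M)) : Prop := ∀ j, (⟨_, v j⟩ : El M) ∈ A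

/-- Model-theoretic algebraic closure of `A` in `𝔐`. -/
def acl (𝔐 : Str L M) (A : Set (El M)) : Set (El M) :=
  {a | ∃ (Γ : List S) (φ : Formula L (a.1 :: Γ)) (v : Env M Γ), v.In A ∧
    φ.Holds 𝔐 (Env.cons a.2 v) ∧ {x : M a.1 | φ.Holds 𝔐 (Env.cons x v)}.Finite}

/-- `A` has fewer than `κ` elements. -/
def Small (κ : Cardinal.{u}) (A : Set (El M)) : Prop := Cardinal.mk A < κ

/-- `κ`-saturation: every finitely satisfiable set of formulas in one variable with parameters
from a set of size less than `κ` is realised. -/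
def IsSaturated (κ : Cardinal.{u}) (𝔐 : Str L M) : Prop :=
  ∀ A : Set (El M), Small κ A → ∀ (s : S) (p : Set (Σ Γ : List S, Formula L (s :: Γ) × Env M Γ)),
    (∀ q ∈ p, q.2.2.In A) →
    (∀ F ⊆ p, F.Finite → ∃ x : M s, ∀ q ∈ F, q.2.1.Holds 𝔐 (Env.cons x q.2.2)) →
    ∃ x : M s, ∀ q ∈ p, q.2.1.Holds 𝔐 (Env.cons x q.2.2)

/-- Strong `κ`-homogeneity: every partial elementary map (here `f` restricted to `A`) with domain
of size less than `κ` extends to an automorphism. -/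
def IsStronglyHomogeneous (κ : Cardinal.{u}) (𝔐 : Str L M) : Prop :=
  ∀ A : Set (El M), Small κ A → ∀ f : ∀ s, M s → M s,
    (∀ (Γ : List S) (φ : Formula L Γ) (v : Env M Γ), v.In A →
      (φ.Holds 𝔐 v ↔ φ.Holds 𝔐 (fun j => f _ (v j)))) →
    ∃ σ : ∀ s, M s ≃ M s, IsAut 𝔐 σ ∧ ∀ a ∈ A, σ a.1 a.2 = f a.1 a.2

/-- `𝔐` is a monster model of its complete theory; small means of size less than `κ`. -/
def IsMonster (κ : Cardinal.{u}) (𝔐 : Str L M) : Prop :=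
  IsSaturated κ 𝔐 ∧ IsStronglyHomogeneous κ 𝔐

/-- The image of a set of elements under a sort-preserving map. -/
def image (h : ∀ s, M s → N s) (A : Set (El M)) : Set (El N) :=
  (fun a : El M => (⟨a.1, h a.1 a.2⟩ : El N)) '' A

/-- The family of sets (one for each sort) given by a set of elements. -/
def Fam (X : Set (El U)) (s : S) : Type u := {x : U s // (⟨s, x⟩ : El U) ∈ X}

/-- The inclusion of `X` in `U`. -/
def Fam.incl (X : Set (El U)) (s : S) (x : Fam X s) : U s := x.1

/-- The set `X` is the universe of a substructure of `𝔘`. -/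
def IsClosed (𝔘 : Str L U) (X : Set (El U)) : Prop :=
  ∀ (Γ : List S) (s : S) (f : L.Fn Γ s) (v : Env U Γ), v.In X → (⟨s, 𝔘.fn f v⟩ : El U) ∈ X

/-- The set `X` is the universe of a substructure of `𝔘` that is a model of `T`. -/
def IsModelIn (𝔘 : Str L U) (T : Theory L) (X : Set (El U)) : Prop :=
  ∃ 𝔛 : Str L (Fam X), IsEmb 𝔛 𝔘 (Fam.incl X) ∧ 𝔛.Models T

/-- An `L`-structure `A` with `A ≤_{L₀} 𝔘`, where `𝔘` is an `L₀`-structure: a subset of `𝔘` with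
an `L`-structure whose `L₀`-reduct is a substructure of `𝔘`. -/
structure Sub (i : Incl L₀ L) (𝔘 : Str L₀ U) where
  carrier : Set (El U)
  str : Str L (Fam carrier)
  isEmb : IsEmb (str.reduct i) 𝔘 (Fam.incl carrier)

/-- `A ≤_L B`. -/
def Sub.LE {i : Incl L₀ L} {𝔘 : Str L₀ U} (A B : Sub i 𝔘) : Prop :=
  ∃ h : A.carrier ⊆ B.carrier, IsEmb A.str B.str (fun _ x => ⟨x.1, h x.2⟩)

/-! Ternary relations on the small subsets of a monster model. We write `R A C B` for
`A ⫝_C B`. All properties only concern small sets. Where a property is also considered over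
models, `base` is the class of sets over which it is required. -/

/-- A ternary relation `A ⫝_C B`, written `R A C B`. -/
abbrev IndRel (M : S → Type u) : Type u := Set (El M) → Set (El M) → Set (El M) → Prop

/-- `A' ≡_C A`: some automorphism of the monster model fixes `C` pointwise and takes `A` to
`A'`. -/
def Conj (𝔐 : Str L M) (C A A' : Set (El M)) : Prop :=
  ∃ σ : ∀ s, M s ≃ M s, IsAut 𝔐 σ ∧ (∀ c ∈ C, σ c.1 c.2 = c.2) ∧ image (fun s => σ s) A = A'

/-- No restriction on the base set. -/
def anyBase (_ : Set (El M)) : Prop := True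

section Properties

variable (κ : Cardinal.{u}) (𝔐 : Str L M) (base : Set (El M) → Prop) (R : IndRel M)

def Invariance : Prop := ∀ σ : ∀ s, M s ≃ M s, IsAut 𝔐 σ →
  ∀ A B C : Set (El M), Small κ A → Small κ B → Small κ C → R A C B →
    R (image (fun s => σ s) A) (image (fun s => σ s) C) (image (fun s => σ s) B)

def Normality : Prop := ∀ A B C : Set (El M), Small κ A → Small κ B → Small κ C →
  R A C B → R A C (B ∪ C)

def Monotonicity : Prop := ∀ A B C D : Set (El M),
  Small κ A → Small κ B → Small κ C → Small κ D → base C → R A C (B ∪ D) → R A C B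

/-- Monotonicity on the left; it follows from monotonicity and symmetry. -/
def LeftMonotonicity : Prop := ∀ A B C D : Set (El M),
  Small κ A → Small κ B → Small κ C → Small κ D → base C → R (A ∪ D) C B → R A C B

def BaseMonotonicity : Prop := ∀ A B C D : Set (El M),
  Small κ A → Small κ B → Small κ C → Small κ D → R A C (B ∪ D) → R A (C ∪ D) B

def Transitivity : Prop := ∀ A B C D : Set (El M),
  Small κ A → Small κ B → Small κ C → Small κ D → base C → base B → C ⊆ B → B ⊆ D →
    R A C B → R A B D → R A C D

def Symmetry : Prop := ∀ A B C : Set (El M), Small κ A → Small κ B → Small κ C →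
  base C → R A C B → R B C A

def FullExistence : Prop := ∀ A B C : Set (El M), Small κ A → Small κ B → Small κ C →
  ∃ A' : Set (El M), Conj 𝔐 C A A' ∧ R A' C B

def FiniteCharacter : Prop := ∀ A B C : Set (El M), Small κ A → Small κ B → Small κ C →
  base C → (∀ A₀ ⊆ A, A₀.Finite → R A₀ C B) → R A C B

def LocalCharacter : Prop := ∀ A : Set (El M), Small κ A → ∃ μ : Cardinal.{u}, μ < κ ∧
  ∀ B : Set (El M), Small κ B → ∃ C ⊆ B, Cardinal.mk C < μ ∧ R A C B

def Extension : Prop := ∀ A B C : Set (El M), Small κ A → Small κ B → Small κ C →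
  base C → R A C B → ∀ D : Set (El M), Small κ D →
    ∃ A' : Set (El M), Conj 𝔐 (B ∪ C) A A' ∧ R A' C (B ∪ D)

end Properties

/-- `T` is derivation-like with respect to `(T₀, R)`, where `𝔘` is the monster model of `T₀`.
In (ii), `X` runs through the universes of the `L₀`-structures `D` with
`⟨A, B⟩ ≤ D ≤ acl₀(A, B) ∩ M`. -/
def DerivationLike (i : Incl L₀ L) (κ : Cardinal.{u}) (𝔘 : Str L₀ U) (R : IndRel U)
    (T : Theory L) : Prop :=
  ∀ A B C : Sub i 𝔘, Small κ A.carrier → Small κ B.carrier →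
    A.str.Models T.universal → B.str.Models T.universal → C.str.Models T.universal →
    C.LE A → C.LE B →
    acl 𝔘 C.carrier ∩ A.carrier = C.carrier → acl 𝔘 C.carrier ∩ B.carrier = C.carrier →
    R A.carrier C.carrier B.carrier →
    -- (i)
    (∃ M : Sub i 𝔘, M.str.Models T ∧ A.LE M ∧ B.LE M) ∧
    -- (ii)
    (∀ M : Sub i 𝔘, M.str.Models T → A.LE M → B.LE M →
      ∀ X : Set (El U), IsClosed 𝔘 X → A.carrier ∪ B.carrier ⊆ X →
        X ⊆ acl 𝔘 (A.carrier ∪ B.carrier) ∩ M.carrier →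
        ∃ D : Sub i 𝔘, D.carrier = X ∧ D.LE M ∧
          ∀ D' : Sub i 𝔘, D'.carrier = X → D'.str.Models T.universal → A.LE D' → B.LE D' →
            D' = D)

/-- The relation `A ⫝⁺_C B`, i.e. `acl₊(AC) ⫝⁰_{acl₊(C)} acl₊(BC)`, on the subsets of a structure
`V ≤_{L₀} 𝔘`; `acl₊` is computed in the `L`-structure `V`. -/
def indPlus {i : Incl L₀ L} {𝔘 : Str L₀ U} (V : Sub i 𝔘) (R : IndRel U) :
    IndRel (Fam V.carrier) := fun A C B =>
  R (image (Fam.incl V.carrier) (acl V.str (A ∪ C))) (image (Fam.incl V.carrier) (acl V.str C))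
    (image (Fam.incl V.carrier) (acl V.str (B ∪ C)))

end MultiSorted

open MultiSorted

/-!
The relation `⫝⁺` compares the `acl₊`-closures of its arguments by means of `⫝⁰`. Hence normality
and the properties of parts (1)–(3) pass from `⫝⁰` to `⫝⁺` once two facts are known: `acl₊` is an
invariant closure operator of finite character, and the conjugacies of `U₊` are restrictions of
automorphisms of `U₀`. The second fact (`Setting.exists_aut_base`) holds because `L`-elementary
relations in `U₊` are `L₀`-elementary in `U₀`: if `T₀ ⊆ T₊`, then `U₊` is an elementary
`L₀`-substructure of `U₀` by model completeness, and otherwise quantifier elimination applies.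
Sorts may be empty, so partial elementary maps are treated as relations (`IsPartialElem`); they are
extended into saturated structures by Zorn's lemma (`IsPartialElem.exists_extend_set`). For the
properties over models, a model `C` of `T₊` in `U₊` is `acl₊`-closed, and a model of `T₀` in `U₀` if
`T₀ ⊆ T₊` (`Setting.isModelIn_base`).

Local character (part 4): a type over the empty set determines the cardinal that local character
assigns to a finite set, and there are at most `2 ^ |L|` types, so the cofinality of `κ` yields one
bound for all finite sets (`Setting.exists_localCharacter_finite`). Closing off in countably many
steps then gives a base for an arbitrary set.

Base monotonicity (part 5) rests on `Setting.acl_eq_of_isClosed`: a small `L`-substructure `E` of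
`U₊` that is relatively `acl₀`-closed in `U₊` is `acl₊`-closed. Suppose that a finite set defined
over `E` has an element outside `E`. Move a small model `E'` containing it by some `σ` fixing `E`
so that the finite set is moved, and take a third copy independent from `E' ∪ σE'` over `E`.
Amalgamating the third copy with `E'` and with `σE'` shows that the finite set has the same image
under both copies, a contradiction. With (ii) it follows that `acl₊` of a union of independent
closed sets is the relative `acl₀`-closure, which reduces base monotonicity to that of `⫝⁰`.

Full existence (part 6) takes small elementary substructures around the two sets, makes one of them
independent from the other by an automorphism of `U₀`, and amalgamates by (i). Model completeness of
`T₊` makes both embeddings into the amalgam elementary, and saturation of `U₊` brings the conjugate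
back into `U₊` (`Setting.exists_realization`). For extension (part 7) the conjugate must in addition
have the same type over `B`. Here the uniqueness in (ii) shows that the automorphism of `U₀` induces
an `L`-isomorphism between the substructures generated by `A` and `B` and by the moved copy of `A`
and `B` (`Setting.exists_sub_embedding`), and quantifier elimination makes it elementary.
-/

namespace MultiSorted

variable {S : Type u} {L₀ L : Lang S} {M N U : S → Type u}

/-! ### Formulas: connectives, substitution, reducts -/

theorem Env.map_cons {Γ : List S} {s : S} (h : ∀ s, M s → N s) (x : M s) (v : Env M Γ) :
    (fun j => h _ (Env.cons x v j)) = Env.cons (h s x) (fun j => h _ (v j)) := by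
  funext j
  refine Fin.cases ?_ (fun k => ?_) j <;> rfl

theorem Env.eq_nil (v : Env M ([] : List S)) : v = Env.nil := funext fun j => j.elim0

/-- The concatenation of two tuples. -/
def Env.append : ∀ {Γ Δ : List S}, Env M Γ → Env M Δ → Env M (Γ ++ Δ)
  | [], _, _, w => w
  | _ :: Γ, _, v, w => Env.cons (v (0 : Fin (Γ.length + 1)))
      (Env.append (fun j : Fin Γ.length => v j.succ) w)

theorem Env.forall_append {P : ∀ s, M s → N s → Prop} : ∀ {Γ Δ : List S} {v : Env M Γ}
    {v' : Env N Γ} {w : Env M Δ} {w' : Env N Δ}, (∀ j, P _ (v j) (v' j)) →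
    (∀ j, P _ (w j) (w' j)) → ∀ j, P _ (Env.append v w j) (Env.append v' w' j)
  | [], _, _, _, _, _, _, hw => hw
  | _ :: Γ, _, _, _, _, _, hv, hw => fun j => by
    refine Fin.cases ?_ (fun k => ?_) j
    · exact hv (0 : Fin (Γ.length + 1))
    · exact Env.forall_append (fun k => hv k.succ) hw k

/-- Negation. -/
def Formula.neg {Γ : List S} (φ : Formula L Γ) : Formula L Γ := .imp φ .falsum

/-- Conjunction. -/
def Formula.conj {Γ : List S} (φ ψ : Formula L Γ) : Formula L Γ := (Formula.imp φ ψ.neg).neg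

/-- Existential quantification over the first variable. -/
def Formula.ex {Γ : List S} {s : S} (φ : Formula L (s :: Γ)) : Formula L Γ := (φ.neg.all).neg

theorem Formula.holds_neg {𝔐 : Str L M} {Γ : List S} {φ : Formula L Γ} {v : Env M Γ} :
    φ.neg.Holds 𝔐 v ↔ ¬ φ.Holds 𝔐 v := by
  simp [Formula.neg, Formula.Holds]

theorem Formula.holds_conj {𝔐 : Str L M} {Γ : List S} {φ ψ : Formula L Γ} {v : Env M Γ} :
    (φ.conj ψ).Holds 𝔐 v ↔ φ.Holds 𝔐 v ∧ ψ.Holds 𝔐 v := by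
  simp [Formula.conj, Formula.neg, Formula.Holds]

theorem Formula.holds_ex {𝔐 : Str L M} {Γ : List S} {s : S} {φ : Formula L (s :: Γ)}
    {v : Env M Γ} : φ.ex.Holds 𝔐 v ↔ ∃ x, φ.Holds 𝔐 (Env.cons x v) := by
  simp [Formula.ex, Formula.neg, Formula.Holds]

/-- Substitution of terms for the variables of a term. -/
def Term.subst {Γ Δ : List S} (t : ∀ j : Fin Γ.length, Term L Δ (Γ.get j)) :
    ∀ {s : S}, Term L Γ s → Term L Δ s
  | _, .var j => t j
  | _, .app f u => .app f (fun j => (u j).subst t)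

/-- A term of the context `Γ` as a term of the context `s :: Γ`. -/
def Term.shift {Γ : List S} {s s' : S} (t : Term L Γ s') : Term L (s :: Γ) s' :=
  t.subst (fun j => .var (Γ := s :: Γ) j.succ)

/-- The first variable of a context. -/
def Term.first {Γ : List S} {s : S} : Term L (s :: Γ) s :=
  .var (Γ := s :: Γ) (0 : Fin (Γ.length + 1))

/-- The substitution on `s :: Γ` that fixes the first variable and is given by `t` on `Γ`. -/
def Term.lift {Γ Δ : List S} (t : ∀ j : Fin Γ.length, Term L Δ (Γ.get j)) (s : S) :
    ∀ j : Fin (s :: Γ).length, Term L (s :: Δ) ((s :: Γ).get j) :=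
  Fin.cons (α := fun j : Fin (Γ.length + 1) => Term L (s :: Δ) ((s :: Γ).get j))
    Term.first (fun j => (t j).shift)

/-- Substitution of terms for the free variables of a formula. -/
def Formula.subst : ∀ {Γ Δ : List S}, Formula L Γ →
    (∀ j : Fin Γ.length, Term L Δ (Γ.get j)) → Formula L Δ
  | _, _, .falsum, _ => .falsum
  | _, _, .eq t₁ t₂, t => .eq (t₁.subst t) (t₂.subst t)
  | _, _, .rel r u, t => .rel r (fun j => (u j).subst t)
  | _, _, .imp φ ψ, t => .imp (φ.subst t) (ψ.subst t)
  | _, _, .all (s := s) φ, t => .all (φ.subst (Term.lift t s))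

theorem Term.val_subst (𝔐 : Str L M) {Γ Δ : List S}
    (t : ∀ j : Fin Γ.length, Term L Δ (Γ.get j)) (v : Env M Δ) {s : S} (u : Term L Γ s) :
    (u.subst t).val 𝔐 v = u.val 𝔐 (fun j => (t j).val 𝔐 v) := by
  induction u with
  | var j => rfl
  | app f u ih => simp only [Term.subst, Term.val, ih]

theorem Term.val_shift (𝔐 : Str L M) {Γ : List S} {s s' : S} (t : Term L Γ s') (x : M s)
    (v : Env M Γ) : (t.shift (s := s)).val 𝔐 (Env.cons x v) = t.val 𝔐 v := by
  rw [Term.shift, Term.val_subst]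
  rfl

theorem Term.val_lift (𝔐 : Str L M) {Γ Δ : List S}
    (t : ∀ j : Fin Γ.length, Term L Δ (Γ.get j)) {s : S} (x : M s) (v : Env M Δ) :
    (fun j => (Term.lift t s j).val 𝔐 (Env.cons x v))
      = Env.cons x (fun j => (t j).val 𝔐 v) := by
  funext j
  refine Fin.cases ?_ (fun k => ?_) j
  · rfl
  · exact Term.val_shift 𝔐 _ _ _

theorem Formula.holds_subst (𝔐 : Str L M) {Γ : List S} (φ : Formula L Γ) :
    ∀ {Δ : List S} (t : ∀ j : Fin Γ.length, Term L Δ (Γ.get j)) (v : Env M Δ),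
    (φ.subst t).Holds 𝔐 v ↔ φ.Holds 𝔐 (fun j => (t j).val 𝔐 v) := by
  induction φ with
  | falsum => intros; rfl
  | eq t₁ t₂ => intros; simp only [Formula.subst, Formula.Holds, Term.val_subst]
  | rel r u => intros; simp only [Formula.subst, Formula.Holds, Term.val_subst]
  | imp φ ψ ih₁ ih₂ => intros; simp only [Formula.subst, Formula.Holds, ih₁, ih₂]
  | all φ ih => intros; simp only [Formula.subst, Formula.Holds, ih, Term.val_lift]

/-- The variables of `Γ` as terms of the context `Γ ++ Δ`. -/
def Term.inl : ∀ (Γ Δ : List S) (j : Fin Γ.length), Term L (Γ ++ Δ) (Γ.get j)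
  | [], _ => fun j => j.elim0
  | s :: Γ, Δ => Fin.cons
      (α := fun j : Fin (Γ.length + 1) => Term L (s :: (Γ ++ Δ)) ((s :: Γ).get j))
      Term.first (fun j => (Term.inl Γ Δ j).shift)

/-- The variables of `Δ` as terms of the context `Γ ++ Δ`. -/
def Term.inr : ∀ (Γ Δ : List S) (j : Fin Δ.length), Term L (Γ ++ Δ) (Δ.get j)
  | [], _ => fun j => .var j
  | _ :: Γ, Δ => fun j => (Term.inr Γ Δ j).shift

theorem Term.val_inl (𝔐 : Str L M) : ∀ (Γ Δ : List S) (v : Env M Γ) (w : Env M Δ)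
    (j : Fin Γ.length), (Term.inl Γ Δ j).val 𝔐 (Env.append v w) = v j
  | [], _, _, _, j => j.elim0
  | _ :: Γ, Δ, _, w, j => by
    refine Fin.cases ?_ (fun k => ?_) j
    · rfl
    · exact (Term.val_shift 𝔐 _ _ _).trans (Term.val_inl 𝔐 Γ Δ _ w k)

theorem Term.val_inr (𝔐 : Str L M) : ∀ (Γ Δ : List S) (v : Env M Γ) (w : Env M Δ)
    (j : Fin Δ.length), (Term.inr Γ Δ j).val 𝔐 (Env.append v w) = w j
  | [], _, _, _, _ => rfl
  | _ :: Γ, Δ, _, w, j =>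
    (Term.val_shift 𝔐 _ _ _).trans (Term.val_inr 𝔐 Γ Δ _ w j)

/-- The `L₀`-term `t` as an `L`-term. -/
def Term.map (i : Incl L₀ L) {Γ : List S} : ∀ {s : S}, Term L₀ Γ s → Term L Γ s
  | _, .var j => .var j
  | _, .app f u => .app (i.onFn f) (fun j => (u j).map i)

/-- The `L₀`-formula `φ` as an `L`-formula. -/
def Formula.map (i : Incl L₀ L) : ∀ {Γ : List S}, Formula L₀ Γ → Formula L Γ
  | _, .falsum => .falsum
  | _, .eq t₁ t₂ => .eq (t₁.map i) (t₂.map i)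
  | _, .rel r u => .rel (i.onRel r) (fun j => (u j).map i)
  | _, .imp φ ψ => .imp (φ.map i) (ψ.map i)
  | _, .all φ => .all (φ.map i)

theorem Term.val_map (i : Incl L₀ L) (𝔐 : Str L M) {Γ : List S} (v : Env M Γ) {s : S}
    (t : Term L₀ Γ s) : (t.map i).val 𝔐 v = t.val (𝔐.reduct i) v := by
  induction t with
  | var j => rfl
  | app f u ih => simp only [Term.map, Term.val, ih, Str.reduct]

theorem Formula.holds_map (i : Incl L₀ L) (𝔐 : Str L M) {Γ : List S} (φ : Formula L₀ Γ) :
    ∀ v : Env M Γ, (φ.map i).Holds 𝔐 v ↔ φ.Holds (𝔐.reduct i) v := by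
  induction φ with
  | falsum => intro; rfl
  | eq t₁ t₂ => intro; simp only [Formula.map, Formula.Holds, Term.val_map]
  | rel r u => intro; simp only [Formula.map, Formula.Holds, Term.val_map, Str.reduct]
  | imp φ ψ ih₁ ih₂ => intro; simp only [Formula.map, Formula.Holds, ih₁, ih₂]
  | all φ ih => intro; simp only [Formula.map, Formula.Holds, ih]

/-! ### Embeddings and elementary embeddings -/

theorem IsEmb.val {𝔐 : Str L M} {𝔑 : Str L N} {h : ∀ s, M s → N s} (hh : IsEmb 𝔐 𝔑 h)
    {Γ : List S} (v : Env M Γ) {s : S} (t : Term L Γ s) :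
    h s (t.val 𝔐 v) = t.val 𝔑 (fun j => h _ (v j)) := by
  induction t with
  | var j => rfl
  | app f u ih => simp only [Term.val, hh.map_fn, ih]

theorem IsEmb.holds_of_isQF {𝔐 : Str L M} {𝔑 : Str L N} {h : ∀ s, M s → N s}
    (hh : IsEmb 𝔐 𝔑 h) {Γ : List S} {φ : Formula L Γ} (hφ : φ.IsQF) (v : Env M Γ) :
    φ.Holds 𝔐 v ↔ φ.Holds 𝔑 (fun j => h _ (v j)) := by
  induction hφ with
  | falsum => rfl
  | eq t₁ t₂ =>
    simp only [Formula.Holds, ← hh.val]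
    exact (hh.injective _).eq_iff.symm
  | rel r t => simp only [Formula.Holds, ← hh.val]; exact hh.map_rel r _
  | imp _ _ ih₁ ih₂ => simp only [Formula.Holds, ih₁, ih₂]

/-- Universal formulas pass to substructures. -/
theorem IsEmb.holds_of_isUniversal {𝔐 : Str L M} {𝔑 : Str L N} {h : ∀ s, M s → N s}
    (hh : IsEmb 𝔐 𝔑 h) {Γ : List S} {φ : Formula L Γ} (hφ : φ.IsUniversal) (v : Env M Γ)
    (H : φ.Holds 𝔑 (fun j => h _ (v j))) : φ.Holds 𝔐 v := by
  induction hφ with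
  | of_qf hφ => exact (hh.holds_of_isQF hφ v).2 H
  | all _ ih =>
    intro x
    apply ih
    rw [Env.map_cons]
    exact H _

/-- An isomorphism is an elementary embedding. -/
theorem IsEmb.isElementary_of_surjective {𝔐 : Str L M} {𝔑 : Str L N} {h : ∀ s, M s → N s}
    (hh : IsEmb 𝔐 𝔑 h) (hs : ∀ s, Function.Surjective (h s)) : IsElementary 𝔐 𝔑 h := by
  intro Γ φ
  induction φ with
  | falsum => intro; rfl
  | eq t₁ t₂ => intro v; exact hh.holds_of_isQF (.eq t₁ t₂) v
  | rel r t => intro v; exact hh.holds_of_isQF (.rel r t) v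
  | imp φ ψ ih₁ ih₂ => intro v; simp only [Formula.Holds, ih₁, ih₂]
  | all φ ih =>
    intro v
    simp only [Formula.Holds]
    constructor
    · intro H y
      obtain ⟨x, rfl⟩ := hs _ y
      rw [← Env.map_cons, ← ih]
      exact H x
    · intro H x
      rw [ih, Env.map_cons]
      exact H _

theorem IsEmb.comp {M₁ M₂ M₃ : S → Type u} {𝔐₁ : Str L M₁} {𝔐₂ : Str L M₂} {𝔐₃ : Str L M₃}
    {g : ∀ s, M₂ s → M₃ s} {h : ∀ s, M₁ s → M₂ s} (hg : IsEmb 𝔐₂ 𝔐₃ g) (hh : IsEmb 𝔐₁ 𝔐₂ h) :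
    IsEmb 𝔐₁ 𝔐₃ (fun s x => g s (h s x)) where
  injective s := (hg.injective s).comp (hh.injective s)
  map_fn f v := by rw [hh.map_fn, hg.map_fn]
  map_rel r v := by rw [hh.map_rel, hg.map_rel]

/-- If `g ∘ h` and `g` are embeddings, then so is `h`. -/
theorem IsEmb.of_comp {M₁ M₂ M₃ : S → Type u} {𝔐₁ : Str L M₁} {𝔐₂ : Str L M₂} {𝔐₃ : Str L M₃}
    {g : ∀ s, M₂ s → M₃ s} {h : ∀ s, M₁ s → M₂ s} (hg : IsEmb 𝔐₂ 𝔐₃ g)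
    (hgh : IsEmb 𝔐₁ 𝔐₃ (fun s x => g s (h s x))) : IsEmb 𝔐₁ 𝔐₂ h where
  injective s := (hgh.injective s).of_comp (f := g s)
  map_fn f v := hg.injective _ (by rw [hg.map_fn]; exact hgh.map_fn f v)
  map_rel r v := (hgh.map_rel r v).trans (hg.map_rel r _).symm

theorem IsEmb.reduct {𝔐 : Str L M} {𝔑 : Str L N} {h : ∀ s, M s → N s} (hh : IsEmb 𝔐 𝔑 h)
    (i : Incl L₀ L) : IsEmb (𝔐.reduct i) (𝔑.reduct i) h where
  injective := hh.injective
  map_fn f := hh.map_fn (i.onFn f)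
  map_rel r := hh.map_rel (i.onRel r)

theorem IsEmb.id (𝔐 : Str L M) : IsEmb 𝔐 𝔐 (fun _ x => x) :=
  ⟨fun _ _ _ h => h, fun _ _ => rfl, fun _ _ => Iff.rfl⟩

theorem IsAut.isElementary {𝔐 : Str L M} {σ : ∀ s, M s ≃ M s} (hσ : IsAut 𝔐 σ) :
    IsElementary 𝔐 𝔐 (fun s => σ s) :=
  IsEmb.isElementary_of_surjective hσ fun s => (σ s).surjective

theorem IsAut.symm {𝔐 : Str L M} {σ : ∀ s, M s ≃ M s} (hσ : IsAut 𝔐 σ) :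
    IsAut 𝔐 (fun s => (σ s).symm) := by
  refine IsEmb.of_comp hσ ?_
  simpa using IsEmb.id 𝔐

theorem IsAut.refl (𝔐 : Str L M) : IsAut 𝔐 (fun s => Equiv.refl (M s)) := IsEmb.id 𝔐

theorem IsElementary.holds_cons {𝔐 : Str L M} {𝔑 : Str L N} {h : ∀ s, M s → N s}
    (hh : IsElementary 𝔐 𝔑 h) {Γ : List S} {s : S} (φ : Formula L (s :: Γ)) (x : M s)
    (v : Env M Γ) :
    φ.Holds 𝔐 (Env.cons x v) ↔ φ.Holds 𝔑 (Env.cons (h s x) (fun j => h _ (v j))) := by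
  rw [hh, Env.map_cons]

theorem IsAut.holds_cons {𝔐 : Str L M} {σ : ∀ s, M s ≃ M s} (hσ : IsAut 𝔐 σ) {Γ : List S}
    {s : S} (φ : Formula L (s :: Γ)) (x : M s) (v : Env M Γ) :
    φ.Holds 𝔐 (Env.cons x v) ↔ φ.Holds 𝔐 (Env.cons (σ s x) (fun j => σ _ (v j))) :=
  hσ.isElementary.holds_cons φ x v

theorem IsAut.holds_cons_symm {𝔐 : Str L M} {σ : ∀ s, M s ≃ M s} (hσ : IsAut 𝔐 σ) {Γ : List S}
    {s : S} (φ : Formula L (s :: Γ)) (x : M s) (v : Env M Γ) :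
    φ.Holds 𝔐 (Env.cons ((σ s).symm x) v) ↔ φ.Holds 𝔐 (Env.cons x (fun j => σ _ (v j))) := by
  rw [hσ.holds_cons, Equiv.apply_symm_apply]

/-! ### Partial elementary relations -/

/-- `G` is a partial elementary map from `𝔐` to `𝔑`, given by its graph. A graph is used instead
of a function because sorts may be empty. -/
def IsPartialElem (𝔐 : Str L M) (𝔑 : Str L N) (G : ∀ s, M s → N s → Prop) : Prop :=
  ∀ (Γ : List S) (φ : Formula L Γ) (v : Env M Γ) (w : Env N Γ), (∀ j, G _ (v j) (w j)) →
    (φ.Holds 𝔐 v ↔ φ.Holds 𝔑 w)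

theorem IsPartialElem.mono {𝔐 : Str L M} {𝔑 : Str L N} {G H : ∀ s, M s → N s → Prop}
    (hG : IsPartialElem 𝔐 𝔑 G) (h : ∀ s m n, H s m n → G s m n) : IsPartialElem 𝔐 𝔑 H :=
  fun Γ φ v w hvw => hG Γ φ v w fun j => h _ _ _ (hvw j)

theorem IsPartialElem.symm {𝔐 : Str L M} {𝔑 : Str L N} {G : ∀ s, M s → N s → Prop}
    (hG : IsPartialElem 𝔐 𝔑 G) : IsPartialElem 𝔑 𝔐 (fun s n m => G s m n) :=
  fun Γ φ v w hvw => (hG Γ φ w v hvw).symm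

theorem IsPartialElem.comp {M₁ M₂ M₃ : S → Type u} {𝔐₁ : Str L M₁} {𝔐₂ : Str L M₂}
    {𝔐₃ : Str L M₃} {G : ∀ s, M₁ s → M₂ s → Prop} {H : ∀ s, M₂ s → M₃ s → Prop}
    (hG : IsPartialElem 𝔐₁ 𝔐₂ G) (hH : IsPartialElem 𝔐₂ 𝔐₃ H) :
    IsPartialElem 𝔐₁ 𝔐₃ (fun s x z => ∃ y, G s x y ∧ H s y z) := by
  intro Γ φ v w hvw
  choose y h₁ h₂ using hvw
  exact (hG Γ φ v y h₁).trans (hH Γ φ y w h₂)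

theorem IsElementary.isPartialElem {𝔐 : Str L M} {𝔑 : Str L N} {h : ∀ s, M s → N s}
    (hh : IsElementary 𝔐 𝔑 h) : IsPartialElem 𝔐 𝔑 (fun s m n => h s m = n) := by
  intro Γ φ v w hvw
  obtain rfl : (fun j => h _ (v j)) = w := funext hvw
  exact hh Γ φ v

/-- The formula saying that the first two variables are equal. -/
def Formula.firstEq (s : S) : Formula L [s, s] := .eq Term.first Term.first.shift

theorem Formula.holds_firstEq {𝔐 : Str L M} {s : S} {x y : M s} :
    (Formula.firstEq s).Holds 𝔐 (Env.cons x (Env.cons y Env.nil)) ↔ x = y := by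
  rw [Formula.firstEq, Formula.Holds, Term.val_shift]
  rfl

theorem IsPartialElem.eq_iff {𝔐 : Str L M} {𝔑 : Str L N} {G : ∀ s, M s → N s → Prop}
    (hG : IsPartialElem 𝔐 𝔑 G) {s : S} {m m' : M s} {n n' : N s} (h : G s m n)
    (h' : G s m' n') : m = m' ↔ n = n' := by
  have := hG [s, s] (.firstEq s) (Env.cons m (Env.cons m' Env.nil))
    (Env.cons n (Env.cons n' Env.nil)) (by
      intro j
      refine Fin.cases h (fun j => ?_) j
      refine Fin.cases h' (fun j => j.elim0) j)
  rwa [Formula.holds_firstEq, Formula.holds_firstEq] at this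

/-- Finitely many formulas in one variable, with parameters related by `G`, are together
equivalent to one such formula. -/
theorem exists_conj_of_finite (𝔐 : Str L M) (𝔑 : Str L N) (G : ∀ s, M s → N s → Prop) (s : S)
    (F : Set (Σ Γ : List S, Formula L (s :: Γ) × Env M Γ × Env N Γ)) (hF : F.Finite)
    (h : ∀ q ∈ F, ∀ j, G _ (q.2.2.1 j) (q.2.2.2 j)) :
    ∃ (Γ : List S) (ψ : Formula L (s :: Γ)) (v : Env M Γ) (w : Env N Γ),
      (∀ j, G _ (v j) (w j)) ∧
      (∀ x, ψ.Holds 𝔐 (Env.cons x v) ↔ ∀ q ∈ F, q.2.1.Holds 𝔐 (Env.cons x q.2.2.1)) ∧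
      (∀ y, ψ.Holds 𝔑 (Env.cons y w) ↔ ∀ q ∈ F, q.2.1.Holds 𝔑 (Env.cons y q.2.2.2)) := by
  induction F, hF using Set.Finite.induction_on with
  | empty =>
    exact ⟨[], Formula.falsum.neg, Env.nil, Env.nil, fun j => j.elim0,
      by simp [Formula.holds_neg, Formula.Holds], by simp [Formula.holds_neg, Formula.Holds]⟩
  | @insert q F _ _ ih =>
    obtain ⟨Γ, ψ, v, w, hvw, h₁, h₂⟩ := ih fun q hq => h q (Set.mem_insert_of_mem _ hq)
    obtain ⟨Δ, φ, v', w'⟩ := q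
    have hq := h ⟨Δ, φ, v', w'⟩ (Set.mem_insert _ _)
    refine ⟨Δ ++ Γ, (φ.subst (Term.lift (Term.inl Δ Γ) s)).conj
      (ψ.subst (Term.lift (Term.inr Δ Γ) s)), Env.append v' v, Env.append w' w,
      Env.forall_append hq hvw, fun x => ?_, fun y => ?_⟩
    · rw [Formula.holds_conj, Formula.holds_subst, Formula.holds_subst, Term.val_lift,
        Term.val_lift, Set.forall_mem_insert, ← h₁]
      simp only [Term.val_inl, Term.val_inr]
    · rw [Formula.holds_conj, Formula.holds_subst, Formula.holds_subst, Term.val_lift,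
        Term.val_lift, Set.forall_mem_insert, ← h₂]
      simp only [Term.val_inl, Term.val_inr]

/-- A finite set of formulas realised in `𝔐` has its image under a partial elementary map
realised in `𝔑`. -/
theorem IsPartialElem.exists_of_finite {𝔐 : Str L M} {𝔑 : Str L N} {G : ∀ s, M s → N s → Prop}
    (hG : IsPartialElem 𝔐 𝔑 G) {s : S}
    {F : Set (Σ Γ : List S, Formula L (s :: Γ) × Env M Γ × Env N Γ)} (hF : F.Finite)
    (h : ∀ q ∈ F, ∀ j, G _ (q.2.2.1 j) (q.2.2.2 j)) (x : M s)
    (hx : ∀ q ∈ F, q.2.1.Holds 𝔐 (Env.cons x q.2.2.1)) :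
    ∃ y, ∀ q ∈ F, q.2.1.Holds 𝔑 (Env.cons y q.2.2.2) := by
  obtain ⟨Γ, ψ, v, w, hvw, h₁, h₂⟩ := exists_conj_of_finite 𝔐 𝔑 G s F hF h
  obtain ⟨y, hy⟩ := Formula.holds_ex.1
    ((hG Γ ψ.ex v w hvw).1 (Formula.holds_ex.2 ⟨x, (h₁ x).2 hx⟩))
  exact ⟨y, (h₂ y).1 hy⟩

/-- A pair of tuples with entries related by `G` or equal to the pair `(a, b)` is obtained by
substituting `(a, b)` for one variable. -/
theorem exists_cons_of_related {G : ∀ s, M s → N s → Prop} {s : S} (a : M s) (b : N s) :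
    ∀ {Γ : List S} (v : Env M Γ) (w : Env N Γ),
      (∀ j, G _ (v j) (w j) ∨
        (⟨s, a, b⟩ : Σ s, M s × N s) = ⟨Γ.get j, v j, w j⟩) →
      ∃ (Δ : List S) (v' : Env M Δ) (w' : Env N Δ)
        (t : ∀ j : Fin Γ.length, Term L (s :: Δ) (Γ.get j)), (∀ j, G _ (v' j) (w' j)) ∧
        ∀ (𝔐 : Str L M) (𝔑 : Str L N), (fun j => (t j).val 𝔐 (Env.cons a v')) = v ∧
          (fun j => (t j).val 𝔑 (Env.cons b w')) = w
  | [], v, w, _ => ⟨[], Env.nil, Env.nil, fun j => j.elim0, fun j => j.elim0, fun _ _ =>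
      ⟨funext fun j => j.elim0, funext fun j => j.elim0⟩⟩
  | s' :: Γ, v, w, h => by
    obtain ⟨Δ, v', w', t, hG, ht⟩ := exists_cons_of_related (G := G) a b (Γ := Γ)
      (fun j => v j.succ) (fun j => w j.succ) (fun j => h j.succ)
    rcases h (0 : Fin (Γ.length + 1)) with h₀ | h₀
    · refine ⟨s' :: Δ, Env.cons (v (0 : Fin (Γ.length + 1))) v',
        Env.cons (w (0 : Fin (Γ.length + 1))) w',
        Fin.cons (α := fun j : Fin (Γ.length + 1) => Term L (s :: s' :: Δ) ((s' :: Γ).get j))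
          Term.first.shift
          (fun j => (t j).subst (Term.lift (fun k => .var (Γ := s' :: Δ) k.succ) s)), ?_, ?_⟩
      · intro j
        exact Fin.cases h₀ (fun k => hG k) j
      · intro 𝔐 𝔑
        constructor
        · funext j
          refine Fin.cases rfl (fun k => ?_) j
          refine (Term.val_subst 𝔐 _ _ _).trans ?_
          rw [Term.val_lift]
          exact congrFun (ht 𝔐 𝔑).1 k
        · funext j
          refine Fin.cases rfl (fun k => ?_) j
          refine (Term.val_subst 𝔑 _ _ _).trans ?_
          rw [Term.val_lift]
          exact congrFun (ht 𝔐 𝔑).2 k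
    · injection h₀ with h₀ h₁
      change s = s' at h₀
      subst h₀
      obtain ⟨ha, hb⟩ := Prod.mk.inj (eq_of_heq h₁)
      refine ⟨Δ, v', w', Fin.cons
        (α := fun j : Fin (Γ.length + 1) => Term L (s :: Δ) ((s :: Γ).get j))
          Term.first t, hG, fun 𝔐 𝔑 => ⟨?_, ?_⟩⟩
      · funext j
        refine Fin.cases ha (fun k => ?_) j
        exact congrFun (ht 𝔐 𝔑).1 k
      · funext j
        refine Fin.cases hb (fun k => ?_) j
        exact congrFun (ht 𝔐 𝔑).2 k

/-! ### Saturation and homogeneity -/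

/-- A partial elementary map with small range in a saturated structure extends to any further
element of its source. -/
theorem IsPartialElem.exists_extend {κ : Cardinal.{u}} {𝔐 : Str L M} {𝔑 : Str L N}
    {G : ∀ s, M s → N s → Prop} (hG : IsPartialElem 𝔐 𝔑 G) (hsat : IsSaturated κ 𝔑)
    (hsm : Small κ {b : El N | ∃ m, G b.1 m b.2}) {s : S} (a : M s) :
    ∃ b : N s, IsPartialElem 𝔐 𝔑
      (fun s' m n => G s' m n ∨ (⟨s, a, b⟩ : Σ s, M s × N s) = ⟨s', m, n⟩) := by
  set P : Set (Σ Γ : List S, Formula L (s :: Γ) × Env M Γ × Env N Γ) :=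
    {q | (∀ j, G _ (q.2.2.1 j) (q.2.2.2 j)) ∧ q.2.1.Holds 𝔐 (Env.cons a q.2.2.1)} with hP
  set f : (Σ Γ : List S, Formula L (s :: Γ) × Env M Γ × Env N Γ) →
    Σ Γ : List S, Formula L (s :: Γ) × Env N Γ := fun q => ⟨q.1, q.2.1, q.2.2.2⟩ with hf
  obtain ⟨b, hb⟩ := hsat _ hsm s (f '' P) (by
      rintro _ ⟨q, hq, rfl⟩ j
      exact ⟨_, hq.1 j⟩) (by
      intro F hF hfin
      obtain ⟨F', hF', hfin', rfl⟩ := hfin.exists_subset_finite_image_eq hF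
      obtain ⟨y, hy⟩ := hG.exists_of_finite hfin' (fun q hq => (hF' hq).1) a
        (fun q hq => (hF' hq).2)
      refine ⟨y, ?_⟩
      rintro _ ⟨q, hq, rfl⟩
      exact hy q hq)
  have key : ∀ (Γ : List S) (φ : Formula L (s :: Γ)) (v : Env M Γ) (w : Env N Γ),
      (∀ j, G _ (v j) (w j)) → φ.Holds 𝔐 (Env.cons a v) → φ.Holds 𝔑 (Env.cons b w) :=
    fun Γ φ v w hvw h => hb _ ⟨⟨Γ, φ, v, w⟩, ⟨hvw, h⟩, rfl⟩
  refine ⟨b, fun Γ φ v w hvw => ?_⟩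
  obtain ⟨Δ, v', w', t, hG', ht⟩ := exists_cons_of_related (L := L) a b v w hvw
  rw [← (ht 𝔐 𝔑).1, ← (ht 𝔐 𝔑).2, ← Formula.holds_subst, ← Formula.holds_subst]
  refine ⟨key _ _ _ _ hG', fun h => ?_⟩
  by_contra hn
  exact Formula.holds_neg.1 (key _ _ _ _ hG' (Formula.holds_neg.2 hn)) h

/-- If finitely many upward closed conditions are each satisfied by a member of a nonempty chain,
then they are all satisfied by a single member. -/
theorem exists_chain_forall {α : Type*} [Preorder α] {c : Set α} (hc : IsChain (· ≤ ·) c)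
    (hne : c.Nonempty) {P : α → Prop} {n : ℕ} {Q : Fin n → α → Prop}
    (hQ : ∀ j a b, a ≤ b → Q j a → Q j b) (h : ∀ j, ∃ a ∈ c, Q j a)
    (hP : ∀ a ∈ c, (∀ j, Q j a) → P a) : ∃ a ∈ c, P a := by
  suffices H : ∀ k : ℕ, ∃ a ∈ c, ∀ j : Fin n, j.1 < k → Q j a by
    obtain ⟨a, ha, hQa⟩ := H n
    exact ⟨a, ha, hP a ha fun j => hQa j j.2⟩
  intro k
  induction k with
  | zero => obtain ⟨a, ha⟩ := hne; exact ⟨a, ha, fun j hj => absurd hj (Nat.not_lt_zero _)⟩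
  | succ k ih =>
    obtain ⟨a, ha, hQa⟩ := ih
    by_cases hk : k < n
    · obtain ⟨b, hb, hQb⟩ := h ⟨k, hk⟩
      rcases hc.total ha hb with hab | hab
      · refine ⟨b, hb, fun j hj => ?_⟩
        rcases Nat.lt_succ_iff_lt_or_eq.1 hj with hj | hj
        · exact hQ j a b hab (hQa j hj)
        · obtain rfl : j = ⟨k, hk⟩ := Fin.ext hj
          exact hQb
      · refine ⟨a, ha, fun j hj => ?_⟩
        rcases Nat.lt_succ_iff_lt_or_eq.1 hj with hj | hj
        · exact hQa j hj
        · obtain rfl : j = ⟨k, hk⟩ := Fin.ext hj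
          exact hQ _ b a hab hQb
    · exact ⟨a, ha, fun j _ => hQa j (by omega)⟩

/-- A partial elementary map into a `κ`-saturated structure extends to every set of fewer than
`κ` elements that contains its domain. -/
theorem IsPartialElem.exists_extend_set {κ : Cardinal.{u}} {𝔐 : Str L M} {𝔑 : Str L N}
    {G : ∀ s, M s → N s → Prop} (hG : IsPartialElem 𝔐 𝔑 G) (hsat : IsSaturated κ 𝔑)
    {P : Set (El M)} (hP : Small κ P) (hGP : ∀ s m n, G s m n → (⟨s, m⟩ : El M) ∈ P) :
    ∃ H : ∀ s, M s → N s → Prop, IsPartialElem 𝔐 𝔑 H ∧ (∀ s m n, G s m n → H s m n) ∧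
      ∀ a ∈ P, ∃ b, H a.1 a.2 b := by
  obtain ⟨H, hGH, hmax⟩ := zorn_le_nonempty₀
    {H : ∀ s, M s → N s → Prop | IsPartialElem 𝔐 𝔑 H ∧ ∀ s m n, H s m n → (⟨s, m⟩ : El M) ∈ P}
    (by
      intro c hc hchain H₀ hH₀
      refine ⟨fun s m n => ∃ H ∈ c, H s m n, ⟨?_, ?_⟩, ?_⟩
      · intro Γ φ v w hvw
        obtain ⟨H, hH, h⟩ := exists_chain_forall hchain ⟨H₀, hH₀⟩
          (P := fun H => ∀ j, H _ (v j) (w j)) (Q := fun j H => H _ (v j) (w j))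
          (fun j a b hab h => hab _ _ _ h) hvw (fun _ _ h => h)
        exact (hc hH).1 Γ φ v w h
      · rintro s m n ⟨H, hH, h⟩
        exact (hc hH).2 s m n h
      · intro H hH s m n h
        exact ⟨H, hH, h⟩) G ⟨hG, hGP⟩
  refine ⟨H, hmax.prop.1, hGH, fun a ha => ?_⟩
  have hsm : Small κ {b : El N | ∃ m, H b.1 m b.2} := by
    refine lt_of_le_of_lt ?_ hP
    refine Cardinal.mk_le_of_injective
      (f := fun b => (⟨⟨b.1.1, b.2.choose⟩, hmax.prop.2 _ _ _ b.2.choose_spec⟩ : P)) ?_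
    rintro ⟨⟨s, b⟩, hb⟩ ⟨⟨s', b'⟩, hb'⟩ h
    have h := congrArg Subtype.val h
    obtain rfl : s = s' := congrArg Sigma.fst h
    have h := eq_of_heq (Sigma.mk.inj h).2
    have := (hmax.prop.1.eq_iff hb.choose_spec hb'.choose_spec).1 h
    simp only at this
    subst this
    rfl
  obtain ⟨b, hb⟩ := hmax.prop.1.exists_extend hsat hsm a.2
  refine ⟨b, hmax.le_of_ge ⟨hb, ?_⟩ (fun s m n h => Or.inl h) _ _ _ (Or.inr rfl)⟩
  rintro s m n (h | h)
  · exact hmax.prop.2 s m n h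
  · injection h with h₁ h₂
    subst h₁
    obtain ⟨rfl, rfl⟩ := Prod.mk.inj (eq_of_heq h₂)
    exact ha

/-- Strong homogeneity for partial maps given by their graphs. -/
theorem IsStronglyHomogeneous.exists_aut {κ : Cardinal.{u}} {𝔐 : Str L M}
    (h𝔐 : IsStronglyHomogeneous κ 𝔐) {G : ∀ s, M s → M s → Prop} (hG : IsPartialElem 𝔐 𝔐 G)
    {P : Set (El M)} (hP : Small κ P) (hGP : ∀ s m n, G s m n → (⟨s, m⟩ : El M) ∈ P) :
    ∃ σ : ∀ s, M s ≃ M s, IsAut 𝔐 σ ∧ ∀ s m n, G s m n → σ s m = n := by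
  classical
  set f : ∀ s, M s → M s := fun s m => if h : ∃ n, G s m n then h.choose else m with hf
  have hfG : ∀ s m, (∃ n, G s m n) → G s m (f s m) := by
    intro s m h
    simp only [hf, dif_pos h]
    exact h.choose_spec
  obtain ⟨σ, hσ, hσf⟩ := h𝔐 {a | ∃ n, G a.1 a.2 n}
    (lt_of_le_of_lt (Cardinal.mk_le_mk_of_subset fun a ⟨n, h⟩ => hGP _ _ _ h) hP) f
    (fun Γ φ v hv => hG Γ φ v _ fun j => hfG _ _ (hv j))
  refine ⟨σ, hσ, fun s m n h => ?_⟩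
  rw [hσf ⟨s, m⟩ ⟨n, h⟩]
  exact (hG.eq_iff (hfG s m ⟨n, h⟩) h).1 rfl

/-! ### Algebraic closure -/

theorem subset_acl (𝔐 : Str L M) (A : Set (El M)) : A ⊆ acl 𝔐 A := by
  rintro ⟨s, a⟩ ha
  refine ⟨[s], .firstEq s, Env.cons a Env.nil, ?_, Formula.holds_firstEq.2 rfl, ?_⟩
  · intro j
    exact Fin.cases ha (fun j => j.elim0) j
  · exact (Set.finite_singleton a).subset fun x hx => Formula.holds_firstEq.1 hx

theorem mem_acl {𝔐 : Str L M} {A : Set (El M)} {s : S} {a : M s} :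
    (⟨s, a⟩ : El M) ∈ acl 𝔐 A ↔ ∃ (Γ : List S) (φ : Formula L (s :: Γ)) (v : Env M Γ), v.In A ∧
      φ.Holds 𝔐 (Env.cons a v) ∧ {x : M s | φ.Holds 𝔐 (Env.cons x v)}.Finite := Iff.rfl

theorem Env.In.mono {Γ : List S} {v : Env M Γ} {A B : Set (El M)} (hv : v.In A) (h : A ⊆ B) :
    v.In B := fun j => h (hv j)

theorem acl_mono (𝔐 : Str L M) {A B : Set (El M)} (h : A ⊆ B) : acl 𝔐 A ⊆ acl 𝔐 B :=
  fun _ ⟨Γ, φ, v, hv, h₁, h₂⟩ => ⟨Γ, φ, v, hv.mono h, h₁, h₂⟩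

/-- Algebraic closure has finite character. -/
theorem exists_finite_of_mem_acl {𝔐 : Str L M} {A : Set (El M)} {a : El M} (ha : a ∈ acl 𝔐 A) :
    ∃ A₀ ⊆ A, A₀.Finite ∧ a ∈ acl 𝔐 A₀ := by
  obtain ⟨Γ, φ, v, hv, h⟩ := ha
  exact ⟨Set.range fun j => (⟨_, v j⟩ : El M), Set.range_subset_iff.2 hv, Set.finite_range _,
    Γ, φ, v, fun j => ⟨j, rfl⟩, h⟩

theorem mem_image {h : ∀ s, M s → N s} {A : Set (El M)} {s : S} {b : N s} :
    (⟨s, b⟩ : El N) ∈ image h A ↔ ∃ a : M s, (⟨s, a⟩ : El M) ∈ A ∧ h s a = b := by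
  constructor
  · rintro ⟨⟨s', a⟩, ha, h⟩
    cases h
    exact ⟨a, ha, rfl⟩
  · rintro ⟨a, ha, rfl⟩
    exact ⟨⟨s, a⟩, ha, rfl⟩

theorem mem_image_equiv {σ : ∀ s, M s ≃ N s} {A : Set (El M)} {s : S} {b : N s} :
    (⟨s, b⟩ : El N) ∈ image (fun s => σ s) A ↔ (⟨s, (σ s).symm b⟩ : El M) ∈ A := by
  rw [mem_image]
  constructor
  · rintro ⟨a, ha, h⟩
    rwa [← h, Equiv.symm_apply_apply]
  · exact fun h => ⟨_, h, Equiv.apply_symm_apply _ _⟩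

theorem image_image {M₁ M₂ M₃ : S → Type u} (g : ∀ s, M₂ s → M₃ s) (h : ∀ s, M₁ s → M₂ s)
    (A : Set (El M₁)) : image g (image h A) = image (fun s x => g s (h s x)) A := by
  rw [image, image, Set.image_image]
  rfl

theorem image_mono {h : ∀ s, M s → N s} {A B : Set (El M)} (hAB : A ⊆ B) :
    image h A ⊆ image h B := Set.image_mono hAB

theorem image_union (h : ∀ s, M s → N s) (A B : Set (El M)) :
    image h (A ∪ B) = image h A ∪ image h B := Set.image_union _ _ _

theorem image_congr {g h : ∀ s, M s → N s} {A : Set (El M)} (H : ∀ a ∈ A, g a.1 a.2 = h a.1 a.2) :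
    image g A = image h A := by
  refine Set.image_congr fun a ha => ?_
  rw [H a ha]

theorem image_eq_self {h : ∀ s, M s → M s} {A : Set (El M)} (H : ∀ a ∈ A, h a.1 a.2 = a.2) :
    image h A = A := by
  rw [image_congr (h := fun _ x => x) H]
  exact Set.image_id A

theorem Small.image {κ : Cardinal.{u}} {A : Set (El M)} (hA : Small κ A) (h : ∀ s, M s → N s) :
    Small κ (image h A) := lt_of_le_of_lt Cardinal.mk_image_le hA

theorem Small.mono {κ : Cardinal.{u}} {A B : Set (El M)} (hB : Small κ B) (h : A ⊆ B) :
    Small κ A := lt_of_le_of_lt (Cardinal.mk_le_mk_of_subset h) hB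

theorem image_acl_subset {𝔐 : Str L M} {σ : ∀ s, M s ≃ M s} (hσ : IsAut 𝔐 σ) (A : Set (El M)) :
    image (fun s => σ s) (acl 𝔐 A) ⊆ acl 𝔐 (image (fun s => σ s) A) := by
  rintro ⟨s, b⟩ hb
  obtain ⟨a, ha, rfl⟩ := mem_image.1 hb
  obtain ⟨Γ, φ, v, hv, h, hfin⟩ := mem_acl.1 ha
  refine ⟨Γ, φ, fun j => σ _ (v j), fun j => ⟨_, hv j, rfl⟩, (hσ.holds_cons φ a v).1 h, ?_⟩
  exact (hfin.image (σ s)).subset fun x hx =>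
    ⟨(σ s).symm x, (hσ.holds_cons_symm φ x v).2 hx, Equiv.apply_symm_apply _ _⟩

theorem image_symm_image (σ : ∀ s, M s ≃ N s) (A : Set (El M)) :
    image (fun s => (σ s).symm) (image (fun s => σ s) A) = A := by
  rw [image_image]
  exact image_eq_self fun a _ => Equiv.symm_apply_apply _ _

theorem image_image_symm (σ : ∀ s, M s ≃ N s) (A : Set (El N)) :
    image (fun s => σ s) (image (fun s => (σ s).symm) A) = A := by
  rw [image_image]
  exact image_eq_self fun a _ => Equiv.apply_symm_apply _ _

theorem image_acl {𝔐 : Str L M} {σ : ∀ s, M s ≃ M s} (hσ : IsAut 𝔐 σ) (A : Set (El M)) :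
    image (fun s => σ s) (acl 𝔐 A) = acl 𝔐 (image (fun s => σ s) A) := by
  refine (image_acl_subset hσ A).antisymm ?_
  have := image_mono (h := fun s => σ s) (image_acl_subset hσ.symm (image (fun s => σ s) A))
  rwa [image_image_symm, image_symm_image] at this

theorem acl_image_eq_of_fixed {𝔐 : Str L M} {σ : ∀ s, M s ≃ M s} (hσ : IsAut 𝔐 σ) {A : Set (El M)}
    (h : ∀ c ∈ A, σ c.1 c.2 = c.2) : image (fun s => σ s) (acl 𝔐 A) = acl 𝔐 A := by
  rw [image_acl hσ, image_eq_self h]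

/-- In a monster model, an element that is not algebraic over the small set `A` has a conjugate
over `A` outside any given finite set. -/
theorem exists_aut_notMem {κ : Cardinal.{u}} (hκ : Cardinal.aleph0 ≤ κ) {𝔐 : Str L M}
    (h𝔐 : IsMonster κ 𝔐) {A : Set (El M)} (hA : Small κ A) {s : S} {a : M s}
    (ha : (⟨s, a⟩ : El M) ∉ acl 𝔐 A) {F : Set (M s)} (hF : F.Finite) :
    ∃ σ : ∀ s, M s ≃ M s, IsAut 𝔐 σ ∧ (∀ c ∈ A, σ c.1 c.2 = c.2) ∧ σ s a ∉ F := by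
  -- the type of `a` over `A`, with the formulas `y ≠ x` for `x ∈ F`, is finitely satisfiable
  -- because every formula over `A` satisfied by `a` has infinitely many solutions
  set p₁ : Set (Σ Γ : List S, Formula L (s :: Γ) × Env M Γ) :=
    {q | q.2.2.In A ∧ q.2.1.Holds 𝔐 (Env.cons a q.2.2)} with hp₁
  set g : M s → Σ Γ : List S, Formula L (s :: Γ) × Env M Γ := fun x =>
    ⟨[s], (Formula.firstEq s).neg, Env.cons x Env.nil⟩ with hg
  have hgx : ∀ x y, (g x).2.1.Holds 𝔐 (Env.cons y (g x).2.2) ↔ y ≠ x :=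
    fun x y => Formula.holds_neg.trans (not_congr Formula.holds_firstEq)
  have hsm : Small κ (A ∪ (fun x : M s => (⟨s, x⟩ : El M)) '' F) := by
    refine lt_of_le_of_lt (Cardinal.mk_union_le _ _) (Cardinal.add_lt_of_lt hκ hA ?_)
    exact lt_of_lt_of_le (Cardinal.lt_aleph0_iff_set_finite.2 (hF.image _)) hκ
  obtain ⟨b, hb⟩ := h𝔐.1 _ hsm s (p₁ ∪ g '' F) (by
      rintro q (hq | ⟨x, hx, rfl⟩) j
      · exact Or.inl (hq.1 j)
      · exact Fin.cases (Or.inr ⟨x, hx, rfl⟩) (fun j => j.elim0) j) (by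
      intro F' hF' hfin
      obtain ⟨Γ, ψ, v, w, hvw, h₁, -⟩ := exists_conj_of_finite 𝔐 𝔐
        (fun s m n => m = n ∧ (⟨s, m⟩ : El M) ∈ A) s
        ((fun q : Σ Γ : List S, Formula L (s :: Γ) × Env M Γ =>
          (⟨q.1, q.2.1, q.2.2, q.2.2⟩ : Σ Γ : List S, Formula L (s :: Γ) × Env M Γ × Env M Γ))
          '' (F' ∩ p₁)) ((hfin.inter_of_left _).image _) (by
          rintro _ ⟨q, hq, rfl⟩ j
          exact ⟨rfl, hq.2.1 j⟩)
      have hinf : ¬ {x : M s | ψ.Holds 𝔐 (Env.cons x v)}.Finite := by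
        intro hfin
        refine ha ⟨Γ, ψ, v, fun j => (hvw j).2, (h₁ a).2 ?_, hfin⟩
        rintro _ ⟨q, hq, rfl⟩
        exact hq.2.2
      obtain ⟨y, hy, hyF⟩ := Set.Infinite.exists_notMem_finite hinf hF
      refine ⟨y, fun q hq => ?_⟩
      rcases hF' hq with hq' | ⟨x, hx, rfl⟩
      · exact (h₁ y).1 hy _ ⟨q, ⟨hq, hq'⟩, rfl⟩
      · rw [hgx]
        rintro rfl
        exact hyF hx)
  have hdiag : IsPartialElem 𝔐 𝔐 (fun s' m n => (m = n ∧ (⟨s', m⟩ : El M) ∈ A) ∨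
      (⟨s, a, b⟩ : Σ s, M s × M s) = ⟨s', m, n⟩) := by
    intro Γ φ v w hvw
    obtain ⟨Δ, v', w', t, hG', ht⟩ := exists_cons_of_related (L := L)
      (G := fun s' m n => m = n ∧ (⟨s', m⟩ : El M) ∈ A) a b v w hvw
    obtain rfl : v' = w' := funext fun j => (hG' j).1
    have hv' : v'.In A := fun j => (hG' j).2
    rw [← (ht 𝔐 𝔐).1, ← (ht 𝔐 𝔐).2, ← Formula.holds_subst, ← Formula.holds_subst]
    refine ⟨fun h => hb ⟨Δ, _, v'⟩ (Or.inl ⟨hv', h⟩), fun h => ?_⟩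
    by_contra hn
    exact Formula.holds_neg.1 (hb ⟨Δ, _, v'⟩ (Or.inl ⟨hv', Formula.holds_neg.2 hn⟩)) h
  obtain ⟨σ, hσ, hσG⟩ := h𝔐.2.exists_aut hdiag (P := insert ⟨s, a⟩ A) (by
      refine lt_of_le_of_lt Cardinal.mk_insert_le (Cardinal.add_lt_of_lt hκ hA ?_)
      exact lt_of_lt_of_le Cardinal.one_lt_aleph0 hκ) (by
      rintro s' m n (h | h)
      · exact Set.mem_insert_of_mem _ h.2
      · injection h with h₁ h₂
        subst h₁
        obtain ⟨rfl, rfl⟩ := Prod.mk.inj (eq_of_heq h₂)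
        exact Set.mem_insert _ _)
  refine ⟨σ, hσ, fun c hc => hσG _ _ _ (Or.inl ⟨rfl, hc⟩), fun hF' => ?_⟩
  rw [hσG s a b (Or.inr rfl)] at hF'
  exact (hgx b b).1 (hb _ (Or.inr ⟨b, hF', rfl⟩)) rfl

/-- Over a small set, `acl` is idempotent in a monster model: an element algebraic over algebraic
elements has only finitely many conjugates. -/
theorem acl_acl {κ : Cardinal.{u}} (hκ : Cardinal.aleph0 ≤ κ) {𝔐 : Str L M}
    (h𝔐 : IsMonster κ 𝔐) {A : Set (El M)} (hA : Small κ A) :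
    acl 𝔐 (acl 𝔐 A) = acl 𝔐 A := by
  refine Set.Subset.antisymm ?_ (subset_acl _ _)
  rintro ⟨s, a⟩ h
  obtain ⟨Γ, φ, v, hv, h, hfin⟩ := mem_acl.1 h
  by_contra ha
  -- the tuple `v` has finitely many conjugates over `A`
  have hv' : ∀ j, ∃ F : Set (M (Γ.get j)), F.Finite ∧ ∀ σ : ∀ s, M s ≃ M s, IsAut 𝔐 σ →
      (∀ c ∈ A, σ c.1 c.2 = c.2) → σ _ (v j) ∈ F := by
    intro j
    obtain ⟨Δ, ψ, w, hw, h, hfin⟩ := mem_acl.1 (hv j)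
    refine ⟨_, hfin, fun σ hσ hσA => ?_⟩
    have := (hσ.holds_cons ψ _ w).1 h
    rwa [show (fun j => σ _ (w j)) = w from funext fun j => hσA _ (hw j)] at this
  choose F hF hFσ using hv'
  have hpi : (Set.pi Set.univ F).Finite := Set.Finite.pi' hF |>.subset fun x hx j => hx j trivial
  have hX : (⋃ w ∈ {w ∈ Set.pi Set.univ F | {x | φ.Holds 𝔐 (Env.cons x w)}.Finite},
      {x : M s | φ.Holds 𝔐 (Env.cons x w)}).Finite :=
    (hpi.subset (Set.sep_subset _ _)).biUnion fun w hw => hw.2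
  obtain ⟨σ, hσ, hσA, hσF⟩ := exists_aut_notMem hκ h𝔐 hA ha hX
  refine hσF (Set.mem_biUnion (x := fun j => σ _ (v j))
    ⟨fun j _ => hFσ j σ hσ hσA, ?_⟩ ((hσ.holds_cons φ a v).1 h))
  exact (hfin.image (σ s)).subset fun x hx =>
    ⟨(σ s).symm x, (hσ.holds_cons_symm φ x v).2 hx, Equiv.apply_symm_apply _ _⟩

theorem acl_subset_acl {κ : Cardinal.{u}} (hκ : Cardinal.aleph0 ≤ κ) {𝔐 : Str L M}
    (h𝔐 : IsMonster κ 𝔐) {A B : Set (El M)} (hB : Small κ B) (h : A ⊆ acl 𝔐 B) :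
    acl 𝔐 A ⊆ acl 𝔐 B := (acl_mono _ h).trans (acl_acl hκ h𝔐 hB).subset

/-- The closure of a set under the function symbols lies in its algebraic closure. -/
theorem fn_mem_acl (𝔐 : Str L M) {A : Set (El M)} {Γ : List S} {s : S} (f : L.Fn Γ s)
    {v : Env M Γ} (hv : v.In A) : (⟨s, 𝔐.fn f v⟩ : El M) ∈ acl 𝔐 A := by
  have key : ∀ x, (Formula.eq Term.first (.app f fun j => .var (Γ := s :: Γ) j.succ)).Holds 𝔐
      (Env.cons x v) ↔ x = 𝔐.fn f v := fun x => Iff.rfl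
  refine ⟨Γ, _, v, hv, (key _).2 rfl, ?_⟩
  simp only [key]
  exact Set.finite_singleton _

/-- If `h` is an elementary embedding, then the finite solution set of a formula with parameters
does not grow: it is the image of the solution set in the source. -/
theorem IsElementary.image_solutions {𝔐 : Str L M} {𝔑 : Str L N} {h : ∀ s, M s → N s}
    (hh : IsElementary 𝔐 𝔑 h) {Γ : List S} {s : S} {φ : Formula L (s :: Γ)} {v : Env M Γ}
    (hfin : {x : M s | φ.Holds 𝔐 (Env.cons x v)}.Finite) :
    h s '' {x : M s | φ.Holds 𝔐 (Env.cons x v)}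
      = {y : N s | φ.Holds 𝔑 (Env.cons y (fun j => h _ (v j)))} := by
  refine Set.Subset.antisymm ?_ fun y hy => ?_
  · rintro _ ⟨x, hx, rfl⟩
    exact (hh.holds_cons φ x v).1 hx
  · by_contra hn
    -- a solution outside the image satisfies finitely many inequalities, and so has a copy in `𝔐`
    set g : M s → Σ Γ : List S, Formula L (s :: Γ) × Env N Γ × Env M Γ := fun x =>
      ⟨[s], (Formula.firstEq s).neg, Env.cons (h s x) Env.nil,
        Env.cons x Env.nil⟩ with hg
    obtain ⟨x, hx⟩ := hh.isPartialElem.symm.exists_of_finite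
      (F := insert ⟨Γ, φ, fun j => h _ (v j), v⟩ (g '' {x : M s | φ.Holds 𝔐 (Env.cons x v)}))
      ((hfin.image g).insert _) (by
        rintro q (rfl | ⟨x, -, rfl⟩) j
        · rfl
        · exact Fin.cases rfl (fun j => j.elim0) j) y (by
        rintro q (rfl | ⟨x, hx, rfl⟩)
        · exact hy
        · refine Formula.holds_neg.2 fun h => hn ⟨x, hx, (Formula.holds_firstEq.1 h).symm⟩)
    have h₁ := hx _ (Set.mem_insert _ _)
    have h₂ := hx _ (Set.mem_insert_of_mem _ ⟨x, h₁, rfl⟩)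
    exact Formula.holds_neg.1 h₂ (Formula.holds_firstEq.2 rfl)

/-- The algebraic closure of a subset of an elementary substructure does not grow in the larger
structure. -/
theorem IsElementary.acl_subset {𝔐 : Str L M} {𝔑 : Str L N} {h : ∀ s, M s → N s}
    (hh : IsElementary 𝔐 𝔑 h) (A : Set (El M)) : acl 𝔑 (image h A) ⊆ image h (acl 𝔐 A) := by
  rintro ⟨s, b⟩ hb
  obtain ⟨Γ, φ, v, hv, hb, hfin⟩ := mem_acl.1 hb
  choose w hw hwv using fun j => mem_image.1 (hv j)
  obtain rfl : (fun j => h _ (w j)) = v := funext hwv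
  have hinj : Function.Injective (h s) := fun x y hxy =>
    (hh.isPartialElem.eq_iff (n := h s x) (n' := h s y) rfl rfl).2 hxy
  have hfin' : {x : M s | φ.Holds 𝔐 (Env.cons x w)}.Finite := by
    refine Set.Finite.of_finite_image (f := h s) (hfin.subset ?_) hinj.injOn
    rintro _ ⟨x, hx, rfl⟩
    exact (hh.holds_cons φ x w).1 hx
  obtain ⟨x, hx, rfl⟩ := (hh.image_solutions hfin').superset hb
  exact ⟨⟨s, x⟩, ⟨Γ, φ, w, hw, hx, hfin'⟩, rfl⟩

/-! ### Cardinalities and elementary hulls -/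

/-- The labels of the syntax trees of terms and formulas. -/
inductive Code (L : Lang S) : Type u
  | var (n : ℕ) : Code L
  | fn (Γ : List S) (s : S) (f : L.Fn Γ s) : Code L
  | falsum : Code L
  | eq (s : S) : Code L
  | rel (Γ : List S) (r : L.Rel Γ) : Code L
  | imp : Code L
  | all (s : S) : Code L

/-- The index set of the successors of a node of a syntax tree. -/
def Code.Arity : Code L → Type
  | .var _ => Fin 0
  | .fn Γ _ _ => Fin Γ.length
  | .falsum => Fin 0
  | .eq _ => Fin 2
  | .rel Γ _ => Fin Γ.length
  | .imp => Fin 2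
  | .all _ => Fin 1

instance (c : Code L) : Finite c.Arity := by
  cases c <;> (unfold Code.Arity; infer_instance)

/-- The syntax tree of a term. -/
def Term.tree {Γ : List S} : ∀ {s : S}, Term L Γ s → WType (Code.Arity (L := L))
  | _, .var j => ⟨.var j.1, fun k : Fin 0 => k.elim0⟩
  | _, .app (Δ := Δ) (s := s) f t => ⟨.fn Δ s f, fun j : Fin Δ.length => (t j).tree⟩

/-- The syntax tree of a formula. -/
def Formula.tree : ∀ {Γ : List S}, Formula L Γ → WType (Code.Arity (L := L))
  | _, .falsum => ⟨.falsum, fun k : Fin 0 => k.elim0⟩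
  | _, .eq (s := s) t₁ t₂ => ⟨.eq s, fun k : Fin 2 => if k = 0 then t₁.tree else t₂.tree⟩
  | _, .rel (Δ := Δ) r t => ⟨.rel Δ r, fun j : Fin Δ.length => (t j).tree⟩
  | _, .imp φ ψ => ⟨.imp, fun k : Fin 2 => if k = 0 then φ.tree else ψ.tree⟩
  | _, .all (s := s) φ => ⟨.all s, fun _ : Fin 1 => φ.tree⟩

theorem Term.tree_injective {Γ : List S} {s : S} (t : Term L Γ s) :
    ∀ {s' : S} (t' : Term L Γ s'), t.tree = t'.tree →
      (⟨s, t⟩ : Σ s, Term L Γ s) = ⟨s', t'⟩ := by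
  induction t with
  | var j =>
    intro s' t' h
    cases t' <;> rw [Term.tree, Term.tree] at h <;> injection h with h₁ h₂
    · injection h₁ with h₁
      obtain rfl := Fin.ext h₁
      rfl
    · cases h₁
  | app f u ih =>
    intro s' t' h
    cases t' with
    | var j' =>
      rw [Term.tree, Term.tree] at h
      injection h with h₁ h₂
      cases h₁
    | app f' u' =>
      rw [Term.tree, Term.tree] at h
      injection h with h₁ h₂
      cases h₁
      have hu := eq_of_heq h₂
      have : u = u' := funext fun j =>
        eq_of_heq (Sigma.mk.inj (ih j (u' j) (congrFun hu j))).2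
      rw [this]

theorem Term.tree_inj {Γ : List S} {s : S} {t t' : Term L Γ s} (h : t.tree = t'.tree) : t = t' :=
  eq_of_heq (Sigma.mk.inj (t.tree_injective t' h)).2

theorem Formula.tree_injective {Γ : List S} (φ : Formula L Γ) :
    ∀ φ' : Formula L Γ, φ.tree = φ'.tree → φ = φ' := by
  induction φ with
  | falsum =>
    intro φ' h
    cases φ' with
    | falsum => rfl
    | _ => rw [Formula.tree, Formula.tree] at h; injection h with h₁ h₂; cases h₁
  | eq t₁ t₂ =>
    intro φ' h
    cases φ' <;> rw [Formula.tree, Formula.tree] at h <;> injection h with h₁ h₂ <;> cases h₁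
    rw [Term.tree_inj (congrFun h₂ (0 : Fin 2)), Term.tree_inj (congrFun h₂ (1 : Fin 2))]
  | rel r t =>
    intro φ' h
    cases φ' <;> rw [Formula.tree, Formula.tree] at h <;> injection h with h₁ h₂ <;> cases h₁
    have h := eq_of_heq h₂
    congr 1
    exact funext fun j => Term.tree_inj (congrFun h j)
  | imp φ ψ ih₁ ih₂ =>
    intro φ' h
    cases φ' <;> rw [Formula.tree, Formula.tree] at h <;> injection h with h₁ h₂ <;> cases h₁
    rw [ih₁ _ (congrFun h₂ (0 : Fin 2)), ih₂ _ (congrFun h₂ (1 : Fin 2))]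
  | all φ ih =>
    intro φ' h
    cases φ' <;> rw [Formula.tree, Formula.tree] at h <;> injection h with h₁ h₂ <;> cases h₁
    rw [ih _ (congrFun h₂ (0 : Fin 1))]

open Cardinal in
theorem Lang.aleph0_le_card (L : Lang S) : ℵ₀ ≤ L.card := le_max_left _ _

open Cardinal in
theorem mk_code_le (L : Lang S) : #(Code L) ≤ L.card := by
  set X := S ⊕ (Σ p : List S × S, L.Fn p.1 p.2) ⊕ (Σ Γ : List S, L.Rel Γ) with hX
  set f : Code L → ULift.{u} ℕ × (ULift.{u} ℕ ⊕ X) := fun c =>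
    match c with
    | .var n => (⟨0⟩, .inl ⟨n⟩)
    | .fn Γ s f => (⟨0⟩, .inr (.inr (.inl ⟨(Γ, s), f⟩)))
    | .falsum => (⟨1⟩, .inl ⟨0⟩)
    | .eq s => (⟨1⟩, .inr (.inl s))
    | .rel Γ r => (⟨0⟩, .inr (.inr (.inr ⟨Γ, r⟩)))
    | .imp => (⟨2⟩, .inl ⟨0⟩)
    | .all s => (⟨2⟩, .inr (.inl s)) with hf
  have hinj : Function.Injective f := by
    intro c c' h
    cases c <;> cases c' <;> cases h <;> rfl
  refine (mk_le_of_injective hinj).trans ?_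
  have h₁ : #(ULift.{u} ℕ) ≤ L.card := by simpa using L.aleph0_le_card
  rw [← mul_def, ← add_def]
  refine mul_le_of_le L.aleph0_le_card h₁ (add_le_of_le L.aleph0_le_card h₁ (le_max_right _ _))

open Cardinal in
theorem mk_sorts_le (L : Lang S) : #S ≤ L.card :=
  le_trans (mk_le_of_injective (f := Sum.inl) Sum.inl_injective) (le_max_right _ _)

open Cardinal in
theorem mk_contexts_le (L : Lang S) : #(List S) ≤ L.card :=
  (mk_list_le_max S).trans (max_le L.aleph0_le_card (mk_sorts_le L))

open Cardinal in
/-- The number of formulas is at most the cardinality of the language. -/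
theorem mk_formula_le (L : Lang S) : #(Σ Γ : List S, Formula L Γ) ≤ L.card := by
  have hinj : Function.Injective (fun q : Σ Γ : List S, Formula L Γ => (q.1, q.2.tree)) := by
    rintro ⟨Γ, φ⟩ ⟨Γ', φ'⟩ h
    simp only [Prod.mk.injEq] at h
    obtain ⟨rfl, h⟩ := h
    rw [φ.tree_injective φ' h]
  refine (mk_le_of_injective hinj).trans ?_
  rw [← mul_def]
  refine mul_le_of_le L.aleph0_le_card (mk_contexts_le L) ?_
  exact (WType.cardinalMk_le_max_aleph0_of_finite').trans
    (by simpa using ⟨mk_code_le L, L.aleph0_le_card⟩)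

open Cardinal in
theorem Incl.card_le (i : Incl L₀ L) : L₀.card ≤ L.card := by
  refine max_le_max le_rfl (mk_le_of_injective
    (f := Sum.map id (Sum.map (fun q => ⟨q.1, i.onFn q.2⟩) (fun q => ⟨q.1, i.onRel q.2⟩))) ?_)
  refine Sum.map_injective.2 ⟨Function.injective_id, Sum.map_injective.2 ⟨?_, ?_⟩⟩
  · rintro ⟨⟨Γ, s⟩, f⟩ ⟨⟨Γ', s'⟩, f'⟩ h
    cases congrArg Sigma.fst h
    obtain rfl := i.onFn_injective _ _ (eq_of_heq (Sigma.mk.inj h).2)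
    rfl
  · rintro ⟨Γ, r⟩ ⟨Γ', r'⟩ h
    cases congrArg Sigma.fst h
    obtain rfl := i.onRel_injective _ (eq_of_heq (Sigma.mk.inj h).2)
    rfl

/-- The formulas in one variable with parameters from `A`. -/
abbrev ParamFormula (L : Lang S) (A : Set (El M)) : Type u :=
  Σ s : S, Σ Γ : List S, Formula L (s :: Γ) × {v : Env M Γ // v.In A}

open Cardinal in
theorem mk_paramFormula_le (L : Lang S) (A : Set (El M)) :
    #(ParamFormula L A) ≤ max L.card #A := by
  set f : ParamFormula L A → (Σ Γ : List S, Formula L Γ) × List A := fun q =>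
    (⟨q.1 :: q.2.1, q.2.2.1⟩, List.ofFn fun j => ⟨⟨_, q.2.2.2.1 j⟩, q.2.2.2.2 j⟩) with hf
  have hinj : Function.Injective f := by
    rintro ⟨s, Γ, φ, v⟩ ⟨s', Γ', φ', v'⟩ h
    simp only [hf, Prod.mk.injEq, Sigma.mk.injEq, List.cons.injEq] at h
    obtain ⟨⟨⟨rfl, rfl⟩, hφ⟩, hv⟩ := h
    obtain rfl := eq_of_heq hφ
    have hv := List.ofFn_injective hv
    have : v = v' := by
      refine Subtype.ext (funext fun j => ?_)
      have := congrArg Subtype.val (congrFun hv j)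
      exact eq_of_heq (Sigma.mk.inj this).2
    rw [this]
  refine (mk_le_of_injective hinj).trans ?_
  have h₀ : ℵ₀ ≤ max L.card #A := L.aleph0_le_card.trans (le_max_left _ _)
  rw [← mul_def]
  exact mul_le_of_le h₀ ((mk_formula_le L).trans (le_max_left _ _))
    ((mk_list_le_max _).trans (max_le h₀ (le_max_right _ _)))

open Cardinal in
theorem mk_acl_le (𝔐 : Str L M) (A : Set (El M)) : #(acl 𝔐 A) ≤ max L.card #A := by
  set f : ParamFormula L A → Set (El M) := fun q =>
    {a | ∃ x : M q.1, a = ⟨q.1, x⟩ ∧ q.2.2.1.Holds 𝔐 (Env.cons x q.2.2.2.1) ∧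
      {x : M q.1 | q.2.2.1.Holds 𝔐 (Env.cons x q.2.2.2.1)}.Finite} with hf
  have hsub : acl 𝔐 A ⊆ ⋃ q, f q := by
    rintro ⟨s, a⟩ ⟨Γ, φ, v, hv, h, hfin⟩
    exact Set.mem_iUnion.2 ⟨⟨s, Γ, φ, v, hv⟩, a, rfl, h, hfin⟩
  have h₀ : ℵ₀ ≤ max L.card #A := L.aleph0_le_card.trans (le_max_left _ _)
  have hfin : ∀ q, #(f q) ≤ ℵ₀ := by
    intro q
    refine le_of_lt (lt_aleph0_iff_set_finite.2 ?_)
    by_cases hq : {x : M q.1 | q.2.2.1.Holds 𝔐 (Env.cons x q.2.2.2.1)}.Finite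
    · refine (hq.image (fun x => (⟨q.1, x⟩ : El M))).subset ?_
      rintro _ ⟨x, rfl, h, -⟩
      exact ⟨x, h, rfl⟩
    · refine Set.finite_empty.subset ?_
      rintro _ ⟨x, rfl, -, h⟩
      exact hq h
  refine (mk_le_mk_of_subset hsub).trans ((mk_iUnion_le_sum_mk).trans ?_)
  refine (sum_le_sum _ _ hfin).trans ?_
  rw [sum_const']
  exact mul_le_of_le h₀ (mk_paramFormula_le L A) h₀

open Cardinal in
theorem mk_iUnion_nat_le {α : Type u} {X : ℕ → Set α} {c : Cardinal.{u}} (hc : ℵ₀ ≤ c)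
    (h : ∀ n, #(X n) ≤ c) : #(⋃ n, X n) ≤ c := by
  have : (⋃ n, X n) = ⋃ n : ULift.{u} ℕ, X n.down := by
    ext a
    simp
  rw [this]
  refine mk_iUnion_le_sum_mk.trans ?_
  refine (sum_le_sum _ (fun _ => c) fun n : ULift.{u} ℕ => h n.down).trans ?_
  rw [sum_const']
  exact mul_le_of_le hc (by simpa using hc) le_rfl

theorem Small.acl {κ : Cardinal.{u}} (hκ : L.card < κ) (𝔐 : Str L M) {A : Set (El M)}
    (hA : Small κ A) : Small κ (acl 𝔐 A) :=
  lt_of_le_of_lt (mk_acl_le 𝔐 A) (max_lt hκ hA)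

theorem Small.union {κ : Cardinal.{u}} (hκ : Cardinal.aleph0 ≤ κ) {A B : Set (El M)}
    (hA : Small κ A) (hB : Small κ B) : Small κ (A ∪ B) :=
  lt_of_le_of_lt (Cardinal.mk_union_le _ _) (Cardinal.add_lt_of_lt hκ hA hB)

/-- The Tarski–Vaught criterion for the set `Y` to be the universe of an elementary
substructure. -/
def IsTarskiVaught (𝔐 : Str L M) (Y : Set (El M)) : Prop :=
  ∀ (s : S) (Γ : List S) (φ : Formula L (s :: Γ)) (v : Env M Γ), v.In Y →
    (∃ x, φ.Holds 𝔐 (Env.cons x v)) → ∃ x, (⟨s, x⟩ : El M) ∈ Y ∧ φ.Holds 𝔐 (Env.cons x v)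

open Cardinal in
/-- The downward Löwenheim–Skolem theorem. -/
theorem exists_isTarskiVaught (𝔐 : Str L M) (X : Set (El M)) :
    ∃ Y, X ⊆ Y ∧ #Y ≤ max L.card #X ∧ IsTarskiVaught 𝔐 Y := by
  classical
  set c := max L.card #X with hc
  have hc₀ : ℵ₀ ≤ c := L.aleph0_le_card.trans (le_max_left _ _)
  set step : Set (El M) → Set (El M) := fun Z => Z ∪ Set.range
    (fun q : {q : ParamFormula L Z // ∃ x, q.2.2.1.Holds 𝔐 (Env.cons x q.2.2.2.1)} =>
      (⟨q.1.1, q.2.choose⟩ : El M)) with hstep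
  have hcard : ∀ Z : Set (El M), #Z ≤ c → #(step Z) ≤ c := by
    intro Z hZ
    refine (mk_union_le _ _).trans (add_le_of_le hc₀ hZ (mk_range_le.trans ?_))
    exact (mk_subtype_le _).trans ((mk_paramFormula_le L Z).trans
      (max_le (le_max_left _ _) hZ))
  set Y : ℕ → Set (El M) := fun n => step^[n] X with hY
  have hsucc : ∀ n, Y (n + 1) = step (Y n) := fun n => Function.iterate_succ_apply' _ _ _
  have hmono : Monotone Y := monotone_nat_of_le_succ fun n => by
    rw [hsucc]
    exact Set.subset_union_left
  refine ⟨⋃ n, Y n, Set.subset_iUnion Y 0, mk_iUnion_nat_le hc₀ fun n => ?_, ?_⟩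
  · induction n with
    | zero => exact le_max_right _ _
    | succ n ih => rw [hsucc]; exact hcard _ ih
  · intro s Γ φ v hv hx
    obtain ⟨n, hn⟩ : ∃ n, v.In (Y n) := by
      choose m hm using fun j => Set.mem_iUnion.1 (hv j)
      exact ⟨Finset.univ.sup m, fun j => hmono (Finset.le_sup (Finset.mem_univ j)) (hm j)⟩
    refine ⟨hx.choose, Set.mem_iUnion.2 ⟨n + 1, ?_⟩, hx.choose_spec⟩
    rw [hsucc]
    exact Or.inr ⟨⟨⟨s, Γ, φ, v, hn⟩, hx⟩, rfl⟩

theorem IsTarskiVaught.isClosed {𝔐 : Str L M} {Y : Set (El M)} (hY : IsTarskiVaught 𝔐 Y) :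
    IsClosed 𝔐 Y := by
  intro Γ s f v hv
  obtain ⟨x, hx, h⟩ := hY s Γ (Formula.eq Term.first (.app f fun j => .var (Γ := s :: Γ) j.succ))
    v hv ⟨𝔐.fn f v, rfl⟩
  have : x = 𝔐.fn f v := h
  rwa [← this]

/-- An embedding whose image satisfies the Tarski–Vaught criterion is elementary. -/
theorem IsTarskiVaught.isElementary {𝔐 : Str L M} {𝔑 : Str L N} {h : ∀ s, M s → N s}
    (hh : IsEmb 𝔐 𝔑 h) {Y : Set (El N)} (hY : IsTarskiVaught 𝔑 Y)
    (hYh : ∀ s y, (⟨s, y⟩ : El N) ∈ Y ↔ ∃ x, h s x = y) : IsElementary 𝔐 𝔑 h := by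
  intro Γ φ
  induction φ with
  | falsum => intro; rfl
  | eq t₁ t₂ => intro v; exact hh.holds_of_isQF (.eq t₁ t₂) v
  | rel r t => intro v; exact hh.holds_of_isQF (.rel r t) v
  | imp φ ψ ih₁ ih₂ => intro v; simp only [Formula.Holds, ih₁, ih₂]
  | all φ ih =>
    intro v
    simp only [Formula.Holds]
    constructor
    · intro H y
      by_contra hy
      obtain ⟨y', hy'Y, hy'⟩ := hY _ _ φ.neg _ (fun j => (hYh _ _).2 ⟨v j, rfl⟩)
        ⟨y, Formula.holds_neg.2 hy⟩
      obtain ⟨x, rfl⟩ := (hYh _ _).1 hy'Y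
      refine Formula.holds_neg.1 hy' ?_
      rw [← Env.map_cons, ← ih]
      exact H x
    · intro H x
      rw [ih, Env.map_cons]
      exact H _

/-! ### Structures inside the monster model -/

theorem Str.Models.of_contained {𝔐 : Str L M} {T T' : Theory L} (h : T.Contained T')
    (h𝔐 : 𝔐.Models T') : 𝔐.Models T := fun φ hφ => h φ hφ M 𝔐 h𝔐

/-- A structure that embeds in a model of `T` is a model of `T^∀`. -/
theorem IsEmb.models_universal {𝔐 : Str L M} {𝔑 : Str L N} {h : ∀ s, M s → N s}
    (hh : IsEmb 𝔐 𝔑 h) {T : Theory L} (h𝔑 : 𝔑.Models T) : 𝔐.Models T.universal := by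
  intro φ hφ
  refine hh.holds_of_isUniversal hφ.1 _ ?_
  rw [Env.eq_nil fun j => h _ _]
  exact hφ.2 N 𝔑 h𝔑

theorem IsElementary.models_iff {𝔐 : Str L M} {𝔑 : Str L N} {h : ∀ s, M s → N s}
    (hh : IsElementary 𝔐 𝔑 h) {T : Theory L} : 𝔐.Models T ↔ 𝔑.Models T := by
  refine forall₂_congr fun φ _ => ?_
  rw [hh, Env.eq_nil fun j => h _ _]

/-- The substructure of `𝔐` with universe `X`. -/
def Str.restrict (𝔐 : Str L M) (X : Set (El M)) (hX : IsClosed 𝔐 X) : Str L (Fam X) where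
  fn f v := ⟨𝔐.fn f (fun j => (v j).1), hX _ _ f _ fun j => (v j).2⟩
  rel r v := 𝔐.rel r (fun j => (v j).1)

theorem Str.isEmb_restrict (𝔐 : Str L M) (X : Set (El M)) (hX : IsClosed 𝔐 X) :
    IsEmb (𝔐.restrict X hX) 𝔐 (Fam.incl X) :=
  ⟨fun _ _ _ h => Subtype.ext h, fun _ _ => rfl, fun _ _ => Iff.rfl⟩

theorem Str.isEmb_restrict_mono (𝔐 : Str L M) {X Y : Set (El M)} (hX : IsClosed 𝔐 X)
    (hY : IsClosed 𝔐 Y) (h : X ⊆ Y) :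
    IsEmb (𝔐.restrict X hX) (𝔐.restrict Y hY) (fun _ x => ⟨x.1, h x.2⟩) :=
  ⟨fun _ _ _ h => Subtype.ext (Subtype.mk.inj h), fun _ _ => rfl, fun _ _ => Iff.rfl⟩

theorem mem_image_incl {X : Set (El U)} {E : Set (El (Fam X))} {s : S} {b : U s} :
    (⟨s, b⟩ : El U) ∈ image (Fam.incl X) E ↔ ∃ h : (⟨s, b⟩ : El U) ∈ X,
      (⟨s, ⟨b, h⟩⟩ : El (Fam X)) ∈ E := by
  rw [mem_image]
  constructor
  · rintro ⟨a, ha, rfl⟩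
    exact ⟨a.2, ha⟩
  · rintro ⟨h, ha⟩
    exact ⟨_, ha, rfl⟩

theorem image_incl_subset {X : Set (El U)} (E : Set (El (Fam X))) :
    image (Fam.incl X) E ⊆ X := by
  rintro ⟨s, b⟩ hb
  exact (mem_image_incl.1 hb).1

theorem image_incl_subset_iff {X : Set (El U)} {E F : Set (El (Fam X))} :
    image (Fam.incl X) E ⊆ image (Fam.incl X) F ↔ E ⊆ F := by
  refine ⟨fun h => ?_, image_mono⟩
  rintro ⟨s, a⟩ ha
  obtain ⟨_, h⟩ := mem_image_incl.1 (h ⟨_, ha, rfl⟩)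
  exact h

namespace Sub

variable {i : Incl L₀ L} {𝔘 : Str L₀ U}

section OfEmb

variable {A B : S → Type u} (𝔄 : Str L A) (h : ∀ s, A s → U s) (hh : IsEmb (𝔄.reduct i) 𝔘 h)

/-- The copy of the structure `𝔄` along an `L₀`-embedding in `𝔘`. -/
noncomputable def ofEmb : Sub i 𝔘 where
  carrier := {b | ∃ a, h b.1 a = b.2}
  str :=
    { fn := fun f v => ⟨h _ (𝔄.fn f fun j => (v j).2.choose), ⟨_, rfl⟩⟩
      rel := fun r v => 𝔄.rel r fun j => (v j).2.choose }
  isEmb :=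
    { injective := fun _ _ _ h => Subtype.ext h
      map_fn := fun f v => (hh.map_fn f _).trans
        (congrArg (𝔘.fn f) (funext fun j => (v j).2.choose_spec))
      map_rel := fun r v => by
        refine (hh.map_rel r _).trans (iff_of_eq ?_)
        exact congrArg (𝔘.rel r) (funext fun j => (v j).2.choose_spec) }

/-- The inverse of the isomorphism from `𝔄` to its copy. -/
noncomputable def ofEmbInv (s : S) (x : Fam (ofEmb 𝔄 h hh).carrier s) : A s := x.2.choose

theorem apply_ofEmbInv (s : S) (x : Fam (ofEmb 𝔄 h hh).carrier s) :
    h s (ofEmbInv 𝔄 h hh s x) = x.1 := x.2.choose_spec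

theorem isEmb_ofEmbInv : IsEmb (ofEmb 𝔄 h hh).str 𝔄 (ofEmbInv 𝔄 h hh) where
  injective s x y hxy := Subtype.ext <| (apply_ofEmbInv 𝔄 h hh s x).symm.trans <|
    (congrArg (h s) hxy).trans (apply_ofEmbInv 𝔄 h hh s y)
  map_fn _ _ := hh.injective _ (apply_ofEmbInv 𝔄 h hh _ _)
  map_rel _ _ := Iff.rfl

theorem isEmb_toOfEmb : IsEmb 𝔄 (ofEmb 𝔄 h hh).str (fun _ a => ⟨h _ a, ⟨a, rfl⟩⟩) := by
  refine IsEmb.of_comp (isEmb_ofEmbInv 𝔄 h hh) ?_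
  have : (fun s (a : A s) => ofEmbInv 𝔄 h hh s ⟨h s a, ⟨a, rfl⟩⟩) = fun s a => a := by
    funext s a
    exact hh.injective _ (apply_ofEmbInv 𝔄 h hh s _)
  rw [this]
  exact IsEmb.id 𝔄

variable {𝔄 h hh}

theorem ofEmb_le {V : Sub i 𝔘} {g : ∀ s, A s → Fam V.carrier s} (hg : IsEmb 𝔄 V.str g)
    (hgh : ∀ s a, (g s a).1 = h s a) : (ofEmb 𝔄 h hh).LE V := by
  have key : ∀ s (x : Fam (ofEmb 𝔄 h hh).carrier s), (g s (ofEmbInv 𝔄 h hh s x)).1 = x.1 :=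
    fun s x => (hgh s _).trans (apply_ofEmbInv 𝔄 h hh s x)
  have hsub : (ofEmb 𝔄 h hh).carrier ⊆ V.carrier := by
    rintro ⟨s, b⟩ hb
    have := (g s (ofEmbInv 𝔄 h hh s ⟨b, hb⟩)).2
    have hkey : (g s (ofEmbInv 𝔄 h hh s ⟨b, hb⟩)).1 = b := key s ⟨b, hb⟩
    rwa [hkey] at this
  refine ⟨hsub, ?_⟩
  have := hg.comp (isEmb_ofEmbInv 𝔄 h hh)
  have heq : (fun s x => g s (ofEmbInv 𝔄 h hh s x)) = fun s x => ⟨x.1, hsub x.2⟩ := by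
    funext s x
    exact Subtype.ext (key s x)
  rwa [heq] at this

theorem ofEmb_le_ofEmb {𝔅 : Str L B} {k : ∀ s, B s → U s} {hk : IsEmb (𝔅.reduct i) 𝔘 k}
    {g : ∀ s, A s → B s} (hg : IsEmb 𝔄 𝔅 g) (hgh : ∀ s a, k s (g s a) = h s a) :
    (ofEmb 𝔄 h hh).LE (ofEmb 𝔅 k hk) :=
  ofEmb_le ((isEmb_toOfEmb 𝔅 k hk).comp hg) hgh

theorem exists_of_ofEmb_le {V : Sub i 𝔘} (hV : (ofEmb 𝔄 h hh).LE V) :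
    ∃ g : ∀ s, A s → Fam V.carrier s, IsEmb 𝔄 V.str g ∧ ∀ s a, (g s a).1 = h s a := by
  obtain ⟨hsub, hV⟩ := hV
  exact ⟨_, hV.comp (isEmb_toOfEmb 𝔄 h hh), fun _ _ => rfl⟩

end OfEmb

/-- The copy, under the automorphism `σ` of `𝔘`, of the substructure of `V` with universe `E`. -/
noncomputable def copy (V : Sub i 𝔘) (E : Set (El (Fam V.carrier))) (hE : IsClosed V.str E)
    (σ : ∀ s, U s ≃ U s) (hσ : IsAut 𝔘 σ) : Sub i 𝔘 :=
  ofEmb (V.str.restrict E hE) (fun s x => σ s x.1.1)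
    (IsEmb.comp (g := fun s => σ s) hσ (V.isEmb.comp ((V.str.isEmb_restrict E hE).reduct i)))

theorem carrier_copy (V : Sub i 𝔘) (E : Set (El (Fam V.carrier))) (hE : IsClosed V.str E)
    (σ : ∀ s, U s ≃ U s) (hσ : IsAut 𝔘 σ) :
    (V.copy E hE σ hσ).carrier = image (fun s => σ s) (image (Fam.incl V.carrier) E) := by
  ext ⟨s, b⟩
  rw [image_image, mem_image]
  exact ⟨fun ⟨a, ha⟩ => ⟨a.1, a.2, ha⟩, fun ⟨a, ha, hb⟩ => ⟨⟨a, ha⟩, hb⟩⟩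

theorem models_copy (V : Sub i 𝔘) {E : Set (El (Fam V.carrier))} {hE : IsClosed V.str E}
    {σ : ∀ s, U s ≃ U s} {hσ : IsAut 𝔘 σ} {T : Theory L} (hV : V.str.Models T) :
    (V.copy E hE σ hσ).str.Models T.universal :=
  ((V.str.isEmb_restrict E hE).comp (isEmb_ofEmbInv _ _ _)).models_universal hV

theorem copy_le_copy (V : Sub i 𝔘) {E F : Set (El (Fam V.carrier))} {hE : IsClosed V.str E}
    {hF : IsClosed V.str F} (h : E ⊆ F) {σ τ : ∀ s, U s ≃ U s} {hσ : IsAut 𝔘 σ}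
    {hτ : IsAut 𝔘 τ}
    (hστ : ∀ c ∈ image (Fam.incl V.carrier) E, σ c.1 c.2 = τ c.1 c.2) :
    (V.copy E hE σ hσ).LE (V.copy F hF τ hτ) :=
  ofEmb_le_ofEmb (V.str.isEmb_restrict_mono hE hF h)
    fun _ a => (hστ _ ⟨⟨_, a.1⟩, a.2, rfl⟩).symm

end Sub

theorem isClosed_acl {κ : Cardinal.{u}} (hκ : Cardinal.aleph0 ≤ κ) {𝔐 : Str L M}
    (h𝔐 : IsMonster κ 𝔐) {A : Set (El M)} (hA : Small κ A) : IsClosed 𝔐 (acl 𝔐 A) := by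
  intro Γ s f v hv
  have := fn_mem_acl 𝔐 f hv
  rwa [acl_acl hκ h𝔐 hA] at this

/-! ### The setting -/

/-- The standing assumptions: `𝔘₀` is a monster model of the model complete theory `T₀`, `T` is
derivation-like with respect to `T₀` and the invariant relation `R₀`, and `V ≤ 𝔘₀` is a monster
model of the model companion `Tp` of `T`. -/
structure Setting (i : Incl L₀ L) (κ : Cardinal.{u}) (T₀ : Theory L₀) (𝔘₀ : Str L₀ U)
    (R₀ : IndRel U) (T Tp : Theory L) (V : Sub i 𝔘₀) : Prop where
  aleph0_le : Cardinal.aleph0 ≤ κ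
  card_lt : L.card < κ
  mc₀ : T₀.IsModelComplete
  models₀ : 𝔘₀.Models T₀
  monster₀ : IsMonster κ 𝔘₀
  inv : Invariance κ 𝔘₀ R₀
  der : DerivationLike i κ 𝔘₀ R₀ T
  mc : Tp.IsModelComplete
  embeds : T.EmbedsIn Tp
  contained : T.Contained Tp
  models : V.str.Models Tp
  monster : IsMonster κ V.str
  qe : T₀.ContainedVia i Tp ∨ T₀.HasQE

/-- The truth of an `L₀`-formula in `𝔘₀` can be read off in the models `M ≤ 𝔘₀` of a theory `T'`:
by model completeness, if `T₀ ⊆ T'`, and from an equivalent quantifier-free formula otherwise. -/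
theorem exists_absolute {i : Incl L₀ L} {T₀ : Theory L₀} {𝔘₀ : Str L₀ U}
    (hmc : T₀.IsModelComplete) (h𝔘 : 𝔘₀.Models T₀) {T' : Theory L}
    (hT' : T₀.ContainedVia i T' ∨ T₀.HasQE) {Γ : List S} (φ : Formula L₀ Γ) :
    ∃ ψ : Formula L Γ,
      (∀ V : Sub i 𝔘₀, V.str.Models T' → ∀ v : Env (Fam V.carrier) Γ,
        φ.Holds 𝔘₀ (fun j => (v j).1) ↔ ψ.Holds V.str v) ∧
      (∀ (M N : S → Type u) (𝔐 : Str L M) (𝔑 : Str L N) (e : ∀ s, M s → N s),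
        𝔐.Models T' → 𝔑.Models T' → IsEmb 𝔐 𝔑 e → ∀ v : Env M Γ,
          ψ.Holds 𝔐 v ↔ ψ.Holds 𝔑 (fun j => e _ (v j))) := by
  rcases hT' with hT' | hqe
  · refine ⟨φ.map i, fun V hV v => ?_, fun M N 𝔐 𝔑 e h𝔐 h𝔑 he v => ?_⟩
    · rw [Formula.holds_map]
      exact (hmc _ _ _ _ _ (hT' _ _ hV) h𝔘 V.isEmb Γ φ v).symm
    · rw [Formula.holds_map, Formula.holds_map]
      exact hmc _ _ _ _ _ (hT' _ _ h𝔐) (hT' _ _ h𝔑) (he.reduct i) Γ φ v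
  · obtain ⟨ψ, hψ, h⟩ := hqe Γ φ
    refine ⟨ψ.map i, fun V hV v => ?_, fun M N 𝔐 𝔑 e h𝔐 h𝔑 he v => ?_⟩
    · rw [Formula.holds_map, h _ _ h𝔘]
      exact (V.isEmb.holds_of_isQF hψ v).symm
    · rw [Formula.holds_map, Formula.holds_map]
      exact (he.reduct i).holds_of_isQF hψ v

namespace Setting

variable {i : Incl L₀ L} {κ : Cardinal.{u}} {T₀ : Theory L₀} {𝔘₀ : Str L₀ U} {R₀ : IndRel U}
  {T Tp : Theory L} {V : Sub i 𝔘₀}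

/-- Let `W ≤ 𝔘₀` and let `e` embed `W` in `𝔑`. A partial elementary `L`-map from `𝔑` to `V`
induces, along `e`, a partial elementary `L₀`-map of `𝔘₀`. -/
theorem isPartialElem_base (hS : Setting i κ T₀ 𝔘₀ R₀ T Tp V) {T' : Theory L}
    (hT' : T₀.ContainedVia i T' ∨ T₀.HasQE) (hV : V.str.Models T') {W : Sub i 𝔘₀}
    (hW : W.str.Models T') {𝔑 : Str L N} (h𝔑 : 𝔑.Models T')
    {e : ∀ s, Fam W.carrier s → N s} (he : IsEmb W.str 𝔑 e)
    {G : ∀ s, N s → Fam V.carrier s → Prop} (hG : IsPartialElem 𝔑 V.str G) :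
    IsPartialElem 𝔘₀ 𝔘₀ (fun s a b => ∃ (x : Fam W.carrier s) (y : Fam V.carrier s),
      x.1 = a ∧ y.1 = b ∧ G s (e s x) y) := by
  intro Γ φ v w hvw
  choose x y hx hy hxy using hvw
  obtain rfl : (fun j => (x j).1) = v := funext hx
  obtain rfl : (fun j => (y j).1) = w := funext hy
  obtain ⟨ψ, h₁, h₂⟩ := exists_absolute hS.mc₀ hS.models₀ hT' φ
  rw [h₁ W hW, h₁ V hV, h₂ _ _ _ _ _ hW h𝔑 he]
  exact hG Γ ψ _ _ hxy

/-- Relative algebraic closure in `𝔘₀` is contained in algebraic closure in `V`. -/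
theorem acl_base_inter_subset (hS : Setting i κ T₀ 𝔘₀ R₀ T Tp V) (A : Set (El (Fam V.carrier))) :
    acl 𝔘₀ (image (Fam.incl V.carrier) A) ∩ V.carrier
      ⊆ image (Fam.incl V.carrier) (acl V.str A) := by
  rintro ⟨s, a⟩ ⟨ha, haV⟩
  obtain ⟨Γ, φ, v, hv, h, hfin⟩ := mem_acl.1 ha
  choose hvV hvA using fun j => mem_image_incl.1 (hv j)
  obtain ⟨ψ, h₁, -⟩ := exists_absolute hS.mc₀ hS.models₀ hS.qe φ
  have key : ∀ x : Fam V.carrier s, φ.Holds 𝔘₀ (Env.cons x.1 v) ↔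
      ψ.Holds V.str (Env.cons x (fun j => ⟨v j, hvV j⟩)) := by
    intro x
    rw [← h₁ V hS.models]
    exact iff_of_eq (congrArg _
      (Env.map_cons (Fam.incl V.carrier) x (fun j => ⟨v j, hvV j⟩)).symm)
  refine mem_image_incl.2 ⟨haV, Γ, ψ, fun j => ⟨v j, hvV j⟩, hvA, (key _).1 h, ?_⟩
  refine Set.Finite.of_finite_image (f := Subtype.val) (hfin.subset ?_)
    Subtype.val_injective.injOn
  rintro _ ⟨x, hx, rfl⟩
  exact (key x).2 hx

/-- An automorphism of `V` agrees on any given small set with an automorphism of `𝔘₀`. The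
conclusion is stated for the images of its subsets. -/
theorem exists_aut_base (hS : Setting i κ T₀ 𝔘₀ R₀ T Tp V)
    {σ : ∀ s, Fam V.carrier s ≃ Fam V.carrier s} (hσ : IsAut V.str σ)
    {P : Set (El (Fam V.carrier))} (hP : Small κ P) :
    ∃ ρ : ∀ s, U s ≃ U s, IsAut 𝔘₀ ρ ∧ ∀ X ⊆ P,
      image (fun s => ρ s) (image (Fam.incl V.carrier) X)
        = image (Fam.incl V.carrier) (image (fun s => σ s) X) := by
  have hG := hS.isPartialElem_base hS.qe hS.models hS.models hS.models (IsEmb.id V.str)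
    ((hσ.isElementary.isPartialElem).mono
      (H := fun s x y => (⟨s, x⟩ : El (Fam V.carrier)) ∈ P ∧ σ s x = y) fun _ _ _ h => h.2)
  obtain ⟨ρ, hρ, h⟩ := hS.monster₀.2.exists_aut hG (hP.image (Fam.incl V.carrier)) (by
    rintro s _ _ ⟨x, y, rfl, rfl, hx, -⟩
    exact ⟨_, hx, rfl⟩)
  refine ⟨ρ, hρ, fun X hX => ?_⟩
  rw [image_image, image_image]
  refine image_congr fun a ha => ?_
  exact h _ _ _ ⟨a.2, σ a.1 a.2, rfl, rfl, hX ha, rfl⟩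

theorem small_acl (hS : Setting i κ T₀ 𝔘₀ R₀ T Tp V) {A : Set (El (Fam V.carrier))}
    (hA : Small κ A) : Small κ (acl V.str A) := hA.acl hS.card_lt _

theorem small_image_acl (hS : Setting i κ T₀ 𝔘₀ R₀ T Tp V) {A : Set (El (Fam V.carrier))}
    (hA : Small κ A) : Small κ (image (Fam.incl V.carrier) (acl V.str A)) :=
  (hS.small_acl hA).image _

theorem small_union (hS : Setting i κ T₀ 𝔘₀ R₀ T Tp V) {M : S → Type u} {A B : Set (El M)}
    (hA : Small κ A) (hB : Small κ B) : Small κ (A ∪ B) := hA.union hS.aleph0_le hB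

theorem acl_acl (hS : Setting i κ T₀ 𝔘₀ R₀ T Tp V) {A : Set (El (Fam V.carrier))}
    (hA : Small κ A) : acl V.str (acl V.str A) = acl V.str A :=
  MultiSorted.acl_acl hS.aleph0_le hS.monster hA

/-! ### Properties that pass directly to the derived relation -/

theorem invariance (hS : Setting i κ T₀ 𝔘₀ R₀ T Tp V) :
    Invariance κ V.str (indPlus V R₀) := by
  intro σ hσ A B C hA hB hC h
  have hAC := hS.small_acl (hS.small_union hA hC)
  have hBC := hS.small_acl (hS.small_union hB hC)
  obtain ⟨ρ, hρ, hρX⟩ := hS.exists_aut_base hσ (hS.small_union hAC hBC)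
  have := hS.inv ρ hρ _ _ _ (hAC.image _) (hBC.image _) (hS.small_image_acl hC) h
  rw [hρX _ Set.subset_union_left, hρX _ Set.subset_union_right, hρX _
    ((acl_mono _ Set.subset_union_right).trans Set.subset_union_left), image_acl hσ,
    image_acl hσ, image_acl hσ, image_union, image_union] at this
  exact this

theorem normality : Normality κ (indPlus V R₀) := by
  intro A B C _ _ _ h
  unfold indPlus at h ⊢
  rwa [Set.union_assoc, Set.union_self]

theorem image_acl_union_eq {A B : Set (El (Fam V.carrier))} (h : A ⊆ B) :
    image (Fam.incl V.carrier) (acl V.str A) ∪ image (Fam.incl V.carrier) (acl V.str B)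
      = image (Fam.incl V.carrier) (acl V.str B) :=
  Set.union_eq_right.2 (image_mono (acl_mono _ h))

section Base

variable {base₀ : Set (El U) → Prop} {base : Set (El (Fam V.carrier)) → Prop}

theorem monotonicity (hS : Setting i κ T₀ 𝔘₀ R₀ T Tp V)
    (hb : ∀ C, base C → base₀ (image (Fam.incl V.carrier) (acl V.str C)))
    (h : Monotonicity κ base₀ R₀) : Monotonicity κ base (indPlus V R₀) := by
  intro A B C D hA hB hC hD hbase hR
  refine h _ _ _ _ (hS.small_image_acl (hS.small_union hA hC))
    (hS.small_image_acl (hS.small_union hB hC)) (hS.small_image_acl hC)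
    (hS.small_image_acl (hS.small_union (hS.small_union hB hD) hC)) (hb C hbase) ?_
  rw [image_acl_union_eq (Set.union_subset_union_left _ Set.subset_union_left)]
  exact hR

theorem leftMonotonicity (hS : Setting i κ T₀ 𝔘₀ R₀ T Tp V)
    (hb : ∀ C, base C → base₀ (image (Fam.incl V.carrier) (acl V.str C)))
    (h : LeftMonotonicity κ base₀ R₀) : LeftMonotonicity κ base (indPlus V R₀) := by
  intro A B C D hA hB hC hD hbase hR
  refine h _ _ _ _ (hS.small_image_acl (hS.small_union hA hC))
    (hS.small_image_acl (hS.small_union hB hC)) (hS.small_image_acl hC)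
    (hS.small_image_acl (hS.small_union (hS.small_union hA hD) hC)) (hb C hbase) ?_
  rw [image_acl_union_eq (Set.union_subset_union_left _ Set.subset_union_left)]
  exact hR

theorem symmetry (hS : Setting i κ T₀ 𝔘₀ R₀ T Tp V)
    (hb : ∀ C, base C → base₀ (image (Fam.incl V.carrier) (acl V.str C)))
    (h : Symmetry κ base₀ R₀) : Symmetry κ base (indPlus V R₀) :=
  fun _ _ _ hA hB hC hbase hR => h _ _ _ (hS.small_image_acl (hS.small_union hA hC))
    (hS.small_image_acl (hS.small_union hB hC)) (hS.small_image_acl hC) (hb _ hbase) hR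

/-- A finite set of elements algebraic over `A ∪ C` is algebraic over `A₀ ∪ C` for a finite
`A₀ ⊆ A`. -/
theorem exists_finite_subset_acl {𝔐 : Str L M} {A C F : Set (El M)} (hF : F.Finite)
    (hFA : F ⊆ acl 𝔐 (A ∪ C)) : ∃ A₀ ⊆ A, A₀.Finite ∧ F ⊆ acl 𝔐 (A₀ ∪ C) := by
  induction F, hF using Set.Finite.induction_on with
  | empty => exact ⟨∅, Set.empty_subset _, Set.finite_empty, Set.empty_subset _⟩
  | @insert a F _ _ ih =>
    obtain ⟨A₁, hA₁, hfin₁, h₁⟩ := ih ((Set.subset_insert _ _).trans hFA)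
    obtain ⟨A₂, hA₂, hfin₂, h₂⟩ := exists_finite_of_mem_acl (hFA (Set.mem_insert _ _))
    refine ⟨A₁ ∪ A₂ ∩ A, Set.union_subset hA₁ Set.inter_subset_right,
      hfin₁.union (hfin₂.inter_of_left _), Set.insert_subset ?_ ?_⟩
    · refine acl_mono _ ?_ h₂
      intro x hx
      rcases hA₂ hx with h | h
      · exact Or.inl (Or.inr ⟨hx, h⟩)
      · exact Or.inr h
    · exact h₁.trans (acl_mono _ (Set.union_subset_union_left _ Set.subset_union_left))

/-- A finite subset of `acl (A ∪ C)` lies in `acl (A₀ ∪ C)` for a finite `A₀ ⊆ A`, so that left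
monotonicity of `R₀` applies. -/
theorem finiteCharacter (hS : Setting i κ T₀ 𝔘₀ R₀ T Tp V)
    (hb : ∀ C, base C → base₀ (image (Fam.incl V.carrier) (acl V.str C)))
    (hfc : FiniteCharacter κ base₀ R₀) (hlm : LeftMonotonicity κ base₀ R₀) :
    FiniteCharacter κ base (indPlus V R₀) := by
  intro A B C hA hB hC hbase hR
  have hsB := hS.small_image_acl (hS.small_union hB hC)
  have hsC := hS.small_image_acl hC
  refine hfc _ _ _ (hS.small_image_acl (hS.small_union hA hC)) hsB hsC (hb C hbase) ?_
  intro F hF hfin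
  obtain ⟨F', hF', hfin', rfl⟩ := hfin.exists_subset_finite_image_eq hF
  obtain ⟨A₀, hA₀, hfin₀, hFA₀⟩ := exists_finite_subset_acl hfin' hF'
  have hsA₀ := hS.small_image_acl (hS.small_union (hA.mono hA₀) hC)
  refine hlm (image (Fam.incl V.carrier) F') _ _ _ (hsA₀.mono (image_mono hFA₀)) hsB hsC hsA₀
    (hb C hbase) ?_
  rw [Set.union_eq_right.2 (image_mono hFA₀)]
  exact hR A₀ hA₀ hfin₀

theorem transitivity (hS : Setting i κ T₀ 𝔘₀ R₀ T Tp V)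
    (hb : ∀ C, base C → base₀ (image (Fam.incl V.carrier) (acl V.str C)))
    (ht : Transitivity κ base₀ R₀) (hlm : LeftMonotonicity κ base₀ R₀) :
    Transitivity κ base (indPlus V R₀) := by
  intro A B C D hA hB hC hD hbC hbB hCB hBD h₁ h₂
  unfold indPlus at h₁ h₂ ⊢
  rw [Set.union_eq_left.2 hCB] at h₁
  rw [Set.union_eq_left.2 hBD] at h₂
  rw [Set.union_eq_left.2 (hCB.trans hBD)]
  have hsA := hS.small_image_acl (hS.small_union hA hC)
  refine ht _ _ _ _ hsA (hS.small_image_acl hB) (hS.small_image_acl hC) (hS.small_image_acl hD)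
    (hb C hbC) (hb B hbB) (image_mono (acl_mono _ hCB)) (image_mono (acl_mono _ hBD)) h₁ ?_
  refine hlm _ _ _ _ hsA (hS.small_image_acl hD) (hS.small_image_acl hB)
    (hS.small_image_acl (hS.small_union hA hB)) (hb B hbB) ?_
  rwa [image_acl_union_eq (Set.union_subset_union_right _ hCB)]

end Base

/-- The closure of a model of `Tp` in `V` is a model of `T₀` in `𝔘₀`. -/
theorem isModelIn_base (hS : Setting i κ T₀ 𝔘₀ R₀ T Tp V) (hT₀ : T₀.ContainedVia i Tp)
    {C : Set (El (Fam V.carrier))} (hC : IsModelIn V.str Tp C) :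
    IsModelIn 𝔘₀ T₀ (image (Fam.incl V.carrier) (acl V.str C)) := by
  obtain ⟨𝔛, hemb, hmod⟩ := hC
  have hel := hS.mc _ _ _ _ _ hmod hS.models hemb
  have hacl : acl V.str C = C := by
    refine Set.Subset.antisymm ?_ (subset_acl _ _)
    have : image (Fam.incl C) Set.univ = C := by
      ext ⟨s, b⟩
      rw [mem_image_incl]
      exact ⟨fun h => h.1, fun h => ⟨h, trivial⟩⟩
    have h := hel.acl_subset Set.univ
    rw [this] at h
    exact h.trans (image_incl_subset _)
  have hh : IsEmb (𝔛.reduct i) 𝔘₀ (fun s x => x.1.1) := V.isEmb.comp (hemb.reduct i)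
  have hcar : (Sub.ofEmb 𝔛 _ hh).carrier = image (Fam.incl V.carrier) (acl V.str C) := by
    rw [hacl]
    ext ⟨s, b⟩
    rw [mem_image]
    exact ⟨fun ⟨a, ha⟩ => ⟨a.1, a.2, ha⟩, fun ⟨a, ha, hb⟩ => ⟨⟨a, ha⟩, hb⟩⟩
  rw [← hcar]
  refine ⟨_, (Sub.ofEmb 𝔛 _ hh).isEmb, hT₀ _ _ ?_⟩
  refine (IsElementary.models_iff ((Sub.isEmb_toOfEmb 𝔛 _ hh).isElementary_of_surjective ?_)).1
    hmod
  rintro s ⟨b, a, ha⟩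
  exact ⟨a, Subtype.ext ha⟩

/-! ### Amalgamation of conjugates -/

/-- The assumption that `T` is derivation-like, for the copies under automorphisms `σ` and `τ` of
`𝔘₀` over `C` of two substructures `E` and `F` of `V` that extend `C`. -/
theorem amalgamation (hS : Setting i κ T₀ 𝔘₀ R₀ T Tp V) {C E F : Set (El (Fam V.carrier))}
    (hC : IsClosed V.str C) (hE : IsClosed V.str E) (hF : IsClosed V.str F) (hCE : C ⊆ E)
    (hCF : C ⊆ F) (hsE : Small κ E) (hsF : Small κ F)
    (hacl : acl 𝔘₀ (image (Fam.incl V.carrier) C) ∩ V.carrier ⊆ image (Fam.incl V.carrier) C)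
    {σ τ : ∀ s, U s ≃ U s} (hσ : IsAut 𝔘₀ σ) (hτ : IsAut 𝔘₀ τ)
    (hσC : ∀ c ∈ image (Fam.incl V.carrier) C, σ c.1 c.2 = c.2)
    (hτC : ∀ c ∈ image (Fam.incl V.carrier) C, τ c.1 c.2 = c.2)
    (hR : R₀ (image (fun s => σ s) (image (Fam.incl V.carrier) E)) (image (Fam.incl V.carrier) C)
      (image (fun s => τ s) (image (Fam.incl V.carrier) F))) :
    (∃ W : Sub i 𝔘₀, W.str.Models T ∧ (V.copy E hE σ hσ).LE W ∧ (V.copy F hF τ hτ).LE W) ∧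
    (∀ W : Sub i 𝔘₀, W.str.Models T → (V.copy E hE σ hσ).LE W → (V.copy F hF τ hτ).LE W →
      ∀ X : Set (El U), IsClosed 𝔘₀ X →
        image (fun s => σ s) (image (Fam.incl V.carrier) E) ∪
          image (fun s => τ s) (image (Fam.incl V.carrier) F) ⊆ X →
        X ⊆ acl 𝔘₀ (image (fun s => σ s) (image (Fam.incl V.carrier) E) ∪
          image (fun s => τ s) (image (Fam.incl V.carrier) F)) ∩ W.carrier →
        ∃ D : Sub i 𝔘₀, D.carrier = X ∧ D.LE W ∧
          ∀ D' : Sub i 𝔘₀, D'.carrier = X → D'.str.Models T.universal →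
            (V.copy E hE σ hσ).LE D' → (V.copy F hF τ hτ).LE D' → D' = D) := by
  have hVT : V.str.Models T := Str.Models.of_contained hS.contained hS.models
  have hcarC : (V.copy C hC _ (IsAut.refl 𝔘₀)).carrier = image (Fam.incl V.carrier) C := by
    rw [Sub.carrier_copy]
    exact image_eq_self fun _ _ => rfl
  have hinter : ∀ {G : Set (El (Fam V.carrier))} {ρ : ∀ s, U s ≃ U s}, IsAut 𝔘₀ ρ → C ⊆ G →
      (∀ c ∈ image (Fam.incl V.carrier) C, ρ c.1 c.2 = c.2) →
      acl 𝔘₀ (image (Fam.incl V.carrier) C) ∩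
        image (fun s => ρ s) (image (Fam.incl V.carrier) G) = image (Fam.incl V.carrier) C := by
    intro G ρ hρ hCG hρC
    refine Set.Subset.antisymm ?_ ?_
    · rintro ⟨s, b⟩ ⟨hb, hbG⟩
      obtain ⟨a, ha, rfl⟩ := mem_image.1 hbG
      have haC : (⟨s, a⟩ : El U) ∈ image (Fam.incl V.carrier) C := by
        refine hacl ⟨?_, image_incl_subset _ ha⟩
        rw [← acl_image_eq_of_fixed hρ hρC, mem_image_equiv, Equiv.symm_apply_apply] at hb
        exact hb
      have := hρC _ haC
      simp only at this
      rwa [this]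
    · refine fun c hc => ⟨subset_acl _ _ hc, ?_⟩
      have := image_mono (h := fun s => ρ s) (image_mono (h := Fam.incl V.carrier) hCG)
      rw [image_eq_self hρC] at this
      exact this hc
  have h := hS.der (V.copy E hE σ hσ) (V.copy F hF τ hτ) (V.copy C hC _ (IsAut.refl 𝔘₀))
    (by rw [Sub.carrier_copy]; exact (hsE.image _).image _)
    (by rw [Sub.carrier_copy]; exact (hsF.image _).image _)
    (V.models_copy hVT) (V.models_copy hVT) (V.models_copy hVT)
    (V.copy_le_copy hCE fun c hc => (hσC c hc).symm)
    (V.copy_le_copy hCF fun c hc => (hτC c hc).symm)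
    (by rw [hcarC, Sub.carrier_copy]; exact hinter hσ hCE hσC)
    (by rw [hcarC, Sub.carrier_copy]; exact hinter hτ hCF hτC)
    (by rw [hcarC, Sub.carrier_copy, Sub.carrier_copy]; exact hR)
  simpa only [Sub.carrier_copy] using h

theorem copy_refl_le (V : Sub i 𝔘₀) {E : Set (El (Fam V.carrier))} (hE : IsClosed V.str E) :
    (V.copy E hE _ (IsAut.refl 𝔘₀)).LE V :=
  Sub.ofEmb_le (V.str.isEmb_restrict E hE) fun _ _ => rfl

theorem isClosed_acl (hS : Setting i κ T₀ 𝔘₀ R₀ T Tp V) {A : Set (El (Fam V.carrier))}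
    (hA : Small κ A) : IsClosed V.str (acl V.str A) :=
  MultiSorted.isClosed_acl hS.aleph0_le hS.monster hA

/-- An algebraically closed set in `V` is relatively algebraically closed in `𝔘₀`. -/
theorem acl_base_inter_acl_subset (hS : Setting i κ T₀ 𝔘₀ R₀ T Tp V)
    {A : Set (El (Fam V.carrier))} (hA : Small κ A) :
    acl 𝔘₀ (image (Fam.incl V.carrier) (acl V.str A)) ∩ V.carrier
      ⊆ image (Fam.incl V.carrier) (acl V.str A) := by
  have := hS.acl_base_inter_subset (acl V.str A)
  rwa [hS.acl_acl hA] at this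

/-- Every small subset of `V` is contained in a small elementary substructure of `V`. -/
theorem exists_small_model (hS : Setting i κ T₀ 𝔘₀ R₀ T Tp V) {A : Set (El (Fam V.carrier))}
    (hA : Small κ A) : ∃ (Y : Set (El (Fam V.carrier))) (hY : IsClosed V.str Y), A ⊆ Y ∧
      Small κ Y ∧ (V.str.restrict Y hY).Models Tp ∧
      IsElementary (V.str.restrict Y hY) V.str (Fam.incl Y) := by
  obtain ⟨Y, hAY, hcard, hY⟩ := exists_isTarskiVaught V.str A
  have hel := hY.isElementary (V.str.isEmb_restrict Y hY.isClosed)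
    (fun s y => ⟨fun h => ⟨⟨y, h⟩, rfl⟩, by rintro ⟨x, rfl⟩; exact x.2⟩)
  exact ⟨Y, hY.isClosed, hAY, lt_of_le_of_lt hcard (max_lt hS.card_lt hA),
    hel.models_iff.2 hS.models, hel⟩

/-! ### Relatively algebraically closed substructures -/

/-- Let `Y` be a model of `Tp` and let two copies of `Y`, under automorphisms of `𝔘₀` over the
parameters `v`, be contained in a model of `T`. Then a finite set definable over `v` has the same
image under both automorphisms, since it is computed in an extension that is a model of `Tp`. -/
theorem exists_apply_eq_of_copy_le (hS : Setting i κ T₀ 𝔘₀ R₀ T Tp V)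
    {Y : Set (El (Fam V.carrier))} {hY : IsClosed V.str Y}
    (hYm : (V.str.restrict Y hY).Models Tp) {σ τ : ∀ s, U s ≃ U s} {hσ : IsAut 𝔘₀ σ}
    {hτ : IsAut 𝔘₀ τ} {W : Sub i 𝔘₀} (hW : W.str.Models T) (hσW : (V.copy Y hY σ hσ).LE W)
    (hτW : (V.copy Y hY τ hτ).LE W) {Γ : List S} {s : S} {φ : Formula L (s :: Γ)}
    {v : Env (Fam Y) Γ} (hv : ∀ j, σ _ (v j).1.1 = τ _ (v j).1.1)
    (hfin : {x | φ.Holds (V.str.restrict Y hY) (Env.cons x v)}.Finite) {x : Fam Y s}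
    (hx : φ.Holds (V.str.restrict Y hY) (Env.cons x v)) :
    ∃ y, φ.Holds (V.str.restrict Y hY) (Env.cons y v) ∧ τ s y.1.1 = σ s x.1.1 := by
  obtain ⟨N, 𝔑, e, h𝔑, he⟩ := hS.embeds _ _ hW
  obtain ⟨f, hf, hfσ⟩ := Sub.exists_of_ofEmb_le hσW
  obtain ⟨g, hg, hgτ⟩ := Sub.exists_of_ofEmb_le hτW
  have hfe := hS.mc _ _ _ _ _ hYm h𝔑 (he.comp hf)
  have hge := hS.mc _ _ _ _ _ hYm h𝔑 (he.comp hg)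
  have hfg : (fun j => e _ (f _ (v j))) = fun j => e _ (g _ (v j)) := by
    funext j
    congr 1
    exact Subtype.ext ((hfσ _ _).trans ((hv j).trans (hgτ _ _).symm))
  have h₁ : e s (f s x) ∈ {y | φ.Holds 𝔑 (Env.cons y (fun j => e _ (f _ (v j))))} := by
    rw [← hfe.image_solutions hfin]
    exact ⟨x, hx, rfl⟩
  rw [hfg, ← hge.image_solutions hfin] at h₁
  obtain ⟨y, hy, hyx⟩ := h₁
  refine ⟨y, hy, ?_⟩
  rw [← hgτ, ← hfσ, he.injective s hyx]

/-- A small substructure `E` of `V` that is relatively algebraically closed in `𝔘₀` is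
algebraically closed in `V`. Otherwise take a finite set definable over `E`, with an element outside
`E`, and a small model `Y` that contains the element. By a copy of `Y` that is independent over `E`
from `Y` and from `σ Y`, every automorphism `σ` of `𝔘₀` over `E` takes the finite set to itself; but
a suitable `σ` moves the given element outside the set. -/
theorem acl_eq_of_isClosed (hS : Setting i κ T₀ 𝔘₀ R₀ T Tp V) (hmon : Monotonicity κ anyBase R₀)
    (hfe : FullExistence κ 𝔘₀ R₀) {E : Set (El (Fam V.carrier))} (hE : IsClosed V.str E)
    (hsE : Small κ E)
    (hacl : acl 𝔘₀ (image (Fam.incl V.carrier) E) ∩ V.carrier ⊆ image (Fam.incl V.carrier) E) :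
    acl V.str E = E := by
  refine Set.Subset.antisymm ?_ (subset_acl _ _)
  rintro ⟨s, a⟩ ha
  by_contra haE
  obtain ⟨Γ, φ, v, hv, hφ, hfin⟩ := mem_acl.1 ha
  obtain ⟨Y, hY, hEY, hsY, hYm, hYel⟩ := hS.exists_small_model (A := insert ⟨s, a⟩ E) (by
    refine lt_of_le_of_lt Cardinal.mk_insert_le (Cardinal.add_lt_of_lt hS.aleph0_le hsE ?_)
    exact lt_of_lt_of_le Cardinal.one_lt_aleph0 hS.aleph0_le)
  have hEY' : E ⊆ Y := (Set.subset_insert _ _).trans hEY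
  have haY : (⟨s, a⟩ : El (Fam V.carrier)) ∈ Y := hEY (Set.mem_insert _ _)
  set v' : Env (Fam Y) Γ := fun j => ⟨v j, hEY' (hv j)⟩ with hv'
  have hφ' : φ.Holds (V.str.restrict Y hY) (Env.cons ⟨a, haY⟩ v') :=
    (hYel.holds_cons φ ⟨a, haY⟩ v').2 hφ
  have hfin' : {x | φ.Holds (V.str.restrict Y hY) (Env.cons x v')}.Finite := by
    refine Set.Finite.of_finite_image (f := Subtype.val) (hfin.subset ?_)
      Subtype.val_injective.injOn
    rintro _ ⟨x, hx, rfl⟩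
    exact (hYel.holds_cons φ x v').1 hx
  have hna : (⟨s, a.1⟩ : El U) ∉ acl 𝔘₀ (image (Fam.incl V.carrier) E) := by
    intro h
    obtain ⟨_, h⟩ := mem_image_incl.1 (hacl ⟨h, a.2⟩)
    exact haE h
  obtain ⟨σ, hσ, hσE, hσa⟩ := exists_aut_notMem hS.aleph0_le hS.monster₀ (hsE.image _) hna
    (hfin'.image fun x => x.1.1)
  have hsιY := hsY.image (Fam.incl V.carrier)
  obtain ⟨_, ⟨τ, hτ, hτE, rfl⟩, hR⟩ := hfe (image (Fam.incl V.carrier) Y)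
    (image (Fam.incl V.carrier) Y ∪ image (fun s => σ s) (image (Fam.incl V.carrier) Y))
    (image (Fam.incl V.carrier) E) hsιY (hS.small_union hsιY (hsιY.image _)) (hsE.image _)
  have hR₁ := hmon _ _ _ _ (hsιY.image _) hsιY (hsE.image _) (hsιY.image _) trivial hR
  rw [Set.union_comm] at hR
  have hR₂ := hmon _ _ _ _ (hsιY.image _) (hsιY.image _) (hsE.image _) hsιY trivial hR
  have hvE : ∀ j, (⟨_, (v' j).1.1⟩ : El U) ∈ image (Fam.incl V.carrier) E :=
    fun j => ⟨_, hv j, rfl⟩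
  obtain ⟨⟨W₁, hW₁, h₁, h₁'⟩, -⟩ := hS.amalgamation hE hY hY hEY' hEY' hsY hsY hacl hτ
    (IsAut.refl 𝔘₀) hτE (fun _ _ => rfl) (by
      rwa [image_eq_self (h := fun s => Equiv.refl (U s)) fun _ _ => rfl])
  obtain ⟨⟨W₂, hW₂, h₂, h₂'⟩, -⟩ := hS.amalgamation hE hY hY hEY' hEY' hsY hsY hacl hτ
    hσ hτE hσE hR₂
  -- `σ a` lies in the image under `τ` of the solution set, which is the solution set itself
  obtain ⟨y, hy, hya⟩ := hS.exists_apply_eq_of_copy_le hYm hW₂ h₂' h₂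
    (fun j => (hσE _ (hvE j)).trans (hτE _ (hvE j)).symm) hfin' hφ'
  obtain ⟨z, hz, hzy⟩ := hS.exists_apply_eq_of_copy_le hYm hW₁ h₁ h₁'
    (fun j => hτE _ (hvE j)) hfin' hy
  exact hσa ⟨z, hz, hzy.trans hya⟩

/-- If the algebraic closures of `A` and `D` in `V` are independent over that of `C`, then the
algebraic closure of their union in `V` is contained in its algebraic closure in `𝔘₀`. By
`acl_eq_of_isClosed` it suffices that the relative closure of the union in `𝔘₀` is an
`L`-substructure of `V`, which is the first half of (ii) in `DerivationLike`. -/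
theorem acl_union_subset (hS : Setting i κ T₀ 𝔘₀ R₀ T Tp V) (hmon : Monotonicity κ anyBase R₀)
    (hfe : FullExistence κ 𝔘₀ R₀) {A C D : Set (El (Fam V.carrier))} (hsA : Small κ A)
    (hsC : Small κ C) (hsD : Small κ D) (hCA : C ⊆ acl V.str A) (hCD : C ⊆ acl V.str D)
    (hR : R₀ (image (Fam.incl V.carrier) (acl V.str A)) (image (Fam.incl V.carrier) (acl V.str C))
      (image (Fam.incl V.carrier) (acl V.str D))) :
    image (Fam.incl V.carrier) (acl V.str (acl V.str A ∪ acl V.str D)) ⊆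
      acl 𝔘₀ (image (Fam.incl V.carrier) (acl V.str A) ∪
        image (Fam.incl V.carrier) (acl V.str D)) := by
  set P := image (Fam.incl V.carrier) (acl V.str A) ∪ image (Fam.incl V.carrier) (acl V.str D)
    with hP
  have hsP : Small κ P := hS.small_union (hS.small_image_acl hsA) (hS.small_image_acl hsD)
  have hrefl : ∀ B : Set (El U), image (fun s => Equiv.refl (U s)) B = B :=
    fun B => image_eq_self fun _ _ => rfl
  have haclC {B : Set (El (Fam V.carrier))} (hB : Small κ B) (h : C ⊆ acl V.str B) :
      acl V.str C ⊆ acl V.str B := acl_subset_acl hS.aleph0_le hS.monster hB h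
  -- the relative closure `X` of the union is the universe of an `L`-substructure `D'` of `V`
  set X := acl 𝔘₀ P ∩ V.carrier with hX
  have hXcl : IsClosed 𝔘₀ X := by
    intro Γ s f w hw
    refine ⟨MultiSorted.isClosed_acl hS.aleph0_le hS.monster₀ hsP Γ s f w fun j => (hw j).1, ?_⟩
    have := V.isEmb.map_fn f (fun j => ⟨w j, (hw j).2⟩)
    change _ = 𝔘₀.fn f w at this
    rw [← this]
    exact (V.str.fn (i.onFn f) fun j => ⟨w j, (hw j).2⟩).2
  have hPV : P ⊆ V.carrier := Set.union_subset (image_incl_subset _) (image_incl_subset _)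
  obtain ⟨D', hD'X, ⟨hsub, hD'V⟩, -⟩ := (hS.amalgamation (hS.isClosed_acl hsC)
    (hS.isClosed_acl hsA) (hS.isClosed_acl hsD) (haclC hsA hCA) (haclC hsD hCD)
    (hS.small_acl hsA) (hS.small_acl hsD) (hS.acl_base_inter_acl_subset hsC) (IsAut.refl 𝔘₀)
    (IsAut.refl 𝔘₀) (fun _ _ => rfl) (fun _ _ => rfl) (by rwa [hrefl, hrefl])).2 V
    (Str.Models.of_contained hS.contained hS.models) (copy_refl_le V _) (copy_refl_le V _) X hXcl
    (by rw [hrefl, hrefl]; exact fun x hx => ⟨subset_acl _ _ hx, hPV hx⟩)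
    (by rw [hrefl, hrefl])
  set E : Set (El (Fam V.carrier)) := {x | (⟨x.1, x.2.1⟩ : El U) ∈ X} with hE
  have hιE : image (Fam.incl V.carrier) E = X := by
    ext ⟨s, b⟩
    rw [mem_image_incl]
    exact ⟨fun h => h.2, fun h => ⟨h.2, h⟩⟩
  have hEcl : IsClosed V.str E := by
    intro Γ s f w hw
    have hw' : ∀ j, (⟨_, (w j).1⟩ : El U) ∈ D'.carrier := fun j => hD'X.superset (hw j)
    have h := hD'V.map_fn f (fun j => ⟨(w j).1, hw' j⟩)
    refine hD'X.subset ?_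
    change (⟨s, (V.str.fn f w).1⟩ : El U) ∈ D'.carrier
    have h' : (D'.str.fn f fun j => ⟨(w j).1, hw' j⟩).1 = (V.str.fn f w).1 :=
      congrArg Subtype.val h
    rw [← h']
    exact (D'.str.fn f fun j => ⟨(w j).1, hw' j⟩).2
  have hsE : Small κ E := by
    refine lt_of_le_of_lt (Cardinal.mk_le_of_injective
      (f := fun x : E => (⟨⟨x.1.1, x.1.2.1⟩, x.2⟩ : X)) ?_)
      (Small.mono (hsP.acl (lt_of_le_of_lt i.card_le hS.card_lt) 𝔘₀) Set.inter_subset_left)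
    rintro ⟨⟨s, x⟩, hx⟩ ⟨⟨s', x'⟩, hx'⟩ h
    have h := congrArg Subtype.val h
    obtain rfl : s = s' := congrArg Sigma.fst h
    obtain rfl : x = x' := Subtype.ext (eq_of_heq (Sigma.mk.inj h).2)
    rfl
  have hEacl : acl V.str E = E := by
    refine hS.acl_eq_of_isClosed hmon hfe hEcl hsE ?_
    rw [hιE]
    refine fun x hx => ⟨?_, hx.2⟩
    exact acl_subset_acl hS.aleph0_le hS.monster₀ hsP Set.inter_subset_left hx.1
  have hsubE : acl V.str A ∪ acl V.str D ⊆ E := by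
    rw [← image_incl_subset_iff, hιE, image_union]
    exact fun x hx => ⟨subset_acl _ _ hx, hPV hx⟩
  have := image_mono (h := Fam.incl V.carrier) (acl_mono V.str hsubE)
  rw [hEacl, hιE] at this
  exact this.trans Set.inter_subset_left

/-- Independence passes to the algebraic closure on the right: by full existence and invariance of
`acl 𝔘₀ B` under automorphisms over `B`, the set `acl 𝔘₀ B` is independent from `A` over `B`. -/
theorem independent_acl_right (hS : Setting i κ T₀ 𝔘₀ R₀ T Tp V)
    (htr : Transitivity κ anyBase R₀) (hsym : Symmetry κ anyBase R₀)
    (hfe : FullExistence κ 𝔘₀ R₀) {A B C : Set (El U)} (hA : Small κ A) (hB : Small κ B)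
    (hC : Small κ C) (hCB : C ⊆ B) (hR : R₀ A C B) : R₀ A C (acl 𝔘₀ B) := by
  have hsB : Small κ (acl 𝔘₀ B) := hB.acl (lt_of_le_of_lt i.card_le hS.card_lt) 𝔘₀
  obtain ⟨_, ⟨σ, hσ, hσB, rfl⟩, h⟩ := hfe (acl 𝔘₀ B) A B hsB hA hB
  rw [acl_image_eq_of_fixed hσ hσB] at h
  exact htr A B C _ hA hB hC hsB trivial trivial hCB (subset_acl _ _) hR
    (hsym _ _ _ hsB hA hB trivial h)

/-- By base monotonicity, symmetry and normality of `R₀`, the set `acl (B ∪ D ∪ C)` is independent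
from `acl (A ∪ C) ∪ acl (C ∪ D)` over `acl (C ∪ D)`. By `independent_acl_right` it is independent
from the algebraic closure of that union in `𝔘₀`, which contains `acl (A ∪ C ∪ D)` by
`acl_union_subset`. -/
theorem baseMonotonicity (hS : Setting i κ T₀ 𝔘₀ R₀ T Tp V) (hnorm : Normality κ R₀)
    (hmon : Monotonicity κ anyBase R₀) (hbm : BaseMonotonicity κ R₀)
    (htr : Transitivity κ anyBase R₀) (hsym : Symmetry κ anyBase R₀)
    (hfe : FullExistence κ 𝔘₀ R₀) : BaseMonotonicity κ (indPlus V R₀) := by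
  intro A B C D hA hB hC hD hR
  have hAC := hS.small_union hA hC
  have hCD := hS.small_union hC hD
  have hACD := hS.small_union hA hCD
  have hBDC := hS.small_union (hS.small_union hB hD) hC
  have hsa := hS.small_image_acl hAC
  have hsb := hS.small_image_acl hBDC
  have hsc := hS.small_image_acl hC
  have hsd := hS.small_image_acl hCD
  have hCDsub : C ∪ D ⊆ B ∪ D ∪ C :=
    Set.union_subset Set.subset_union_right (Set.subset_union_right.trans Set.subset_union_left)
  have hR₁ := hmon _ (image (Fam.incl V.carrier) (acl V.str (C ∪ D))) _
    (image (Fam.incl V.carrier) (acl V.str (B ∪ D ∪ C))) hsa hsd hsc hsb trivial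
    (by rw [image_acl_union_eq hCDsub]; exact hR)
  have hR₂ := hbm _ (image (Fam.incl V.carrier) (acl V.str (B ∪ D ∪ C))) _
    (image (Fam.incl V.carrier) (acl V.str (C ∪ D))) hsa hsb hsc hsd
    (by rw [Set.union_comm (image _ _), image_acl_union_eq hCDsub]; exact hR)
  rw [image_acl_union_eq Set.subset_union_left] at hR₂
  have hR₃ := hnorm _ _ _ hsb hsa hsd (hsym _ _ _ hsa hsb hsd trivial hR₂)
  have hsad := hS.small_union hsa hsd
  have hR₄ := hS.independent_acl_right htr hsym hfe hsb hsad hsd Set.subset_union_right hR₃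
  have hsub : image (Fam.incl V.carrier) (acl V.str (A ∪ (C ∪ D))) ⊆
      acl 𝔘₀ (image (Fam.incl V.carrier) (acl V.str (A ∪ C)) ∪
        image (Fam.incl V.carrier) (acl V.str (C ∪ D))) := by
    refine Set.Subset.trans ?_ (hS.acl_union_subset hmon hfe hAC hC hCD
      (Set.subset_union_right.trans (subset_acl _ _))
      (Set.subset_union_left.trans (subset_acl _ _)) hR₁)
    refine image_mono (acl_mono _ (Set.union_subset ?_ ?_))
    · exact Set.subset_union_left.trans ((subset_acl _ _).trans Set.subset_union_left)
    · exact (subset_acl _ _).trans Set.subset_union_right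
  have hsacd := hS.small_image_acl hACD
  have hR₅ := hmon _ (image (Fam.incl V.carrier) (acl V.str (A ∪ (C ∪ D)))) _ _ hsb hsacd hsd
    (hsad.acl (lt_of_le_of_lt i.card_le hS.card_lt) 𝔘₀) trivial
    (by rw [Set.union_eq_right.2 hsub]; exact hR₄)
  have := hsym _ _ _ hsb hsacd hsd trivial hR₅
  rwa [Set.union_assoc, Set.union_comm D C] at this

/-! ### Realising independent conjugates in `V` -/

/-- Let `W ≤ 𝔘₀` be a model of `T` that contains `σ A` and `D`, and embed `W` by `e` in a model
`𝔑` of `Tp`, in such a way that `A ∪ B` has the same type in `V` as `σ (A ∪ B)` in `𝔑`, and `D` has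
the same type in `V` and in `𝔑`. Saturation of `V` gives a copy of `σ A` over `D` in `V`; it is
conjugate to `A` over `B` in `V`, and to `σ A` over `D` in `𝔘₀`. -/
theorem exists_realization (hS : Setting i κ T₀ 𝔘₀ R₀ T Tp V)
    (hT : T₀.ContainedVia i T ∨ T₀.HasQE) {W : Sub i 𝔘₀} (hW : W.str.Models T)
    {𝔑 : Str L N} (h𝔑 : 𝔑.Models Tp) {e : ∀ s, Fam W.carrier s → N s} (he : IsEmb W.str 𝔑 e)
    {A B D : Set (El (Fam V.carrier))} (hsA : Small κ A) (hsD : Small κ D) (hBD : B ⊆ D)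
    {σ : ∀ s, U s ≃ U s} (hσB : ∀ b ∈ image (Fam.incl V.carrier) B, σ b.1 b.2 = b.2)
    (hAW : image (fun s => σ s) (image (Fam.incl V.carrier) A) ⊆ W.carrier)
    (hDW : image (Fam.incl V.carrier) D ⊆ W.carrier)
    (h₁ : IsPartialElem V.str 𝔑 (fun s a n => (⟨s, a⟩ : El (Fam V.carrier)) ∈ A ∪ B ∧
      ∃ x : Fam W.carrier s, x.1 = σ s a.1 ∧ e s x = n))
    (h₂ : IsPartialElem V.str 𝔑 (fun s d n => (⟨s, d⟩ : El (Fam V.carrier)) ∈ D ∧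
      ∃ x : Fam W.carrier s, x.1 = d.1 ∧ e s x = n)) :
    ∃ τ : ∀ s, Fam V.carrier s ≃ Fam V.carrier s, IsAut V.str τ ∧
      (∀ b ∈ B, τ b.1 b.2 = b.2) ∧ ∃ ρ : ∀ s, U s ≃ U s, IsAut 𝔘₀ ρ ∧
        (∀ d ∈ image (Fam.incl V.carrier) D, ρ d.1 d.2 = d.2) ∧
        ∀ a ∈ A, ρ a.1 (σ a.1 a.2.1) = (τ a.1 a.2).1 := by
  set Q := image (fun s => σ s) (image (Fam.incl V.carrier) A) ∪ image (Fam.incl V.carrier) D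
    with hQ
  have hsQ : Small κ Q := hS.small_union ((hsA.image _).image _) (hsD.image _)
  set Q' : Set (El (Fam W.carrier)) := {x | (⟨x.1, x.2.1⟩ : El U) ∈ Q} with hQ'
  have hsQ' : Small κ Q' := by
    refine lt_of_le_of_lt (Cardinal.mk_le_of_injective
      (f := fun x : Q' => (⟨⟨x.1.1, x.1.2.1⟩, x.2⟩ : Q)) ?_) hsQ
    rintro ⟨⟨s, x⟩, hx⟩ ⟨⟨s', x'⟩, hx'⟩ h
    have h := congrArg Subtype.val h
    obtain rfl : s = s' := congrArg Sigma.fst h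
    obtain rfl : x = x' := Subtype.ext (eq_of_heq (Sigma.mk.inj h).2)
    rfl
  -- `H` takes the image of `σ A ∪ D` in `𝔑` back to `V` and is the identity on `D`
  obtain ⟨H, hH, hH₂, hHdom⟩ := h₂.symm.exists_extend_set hS.monster.1 (hsQ'.image e) (by
    rintro s _ d ⟨hd, x, hx, rfl⟩
    refine ⟨⟨s, x⟩, Or.inr ?_, rfl⟩
    change (⟨s, x.1⟩ : El U) ∈ _
    rw [hx]
    exact ⟨_, hd, rfl⟩)
  have hHD : ∀ s (x : Fam W.carrier s) (d : Fam V.carrier s),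
      (⟨s, d⟩ : El (Fam V.carrier)) ∈ D → x.1 = d.1 → H s (e s x) d :=
    fun s x d hd hx => hH₂ _ _ _ ⟨hd, x, hx, rfl⟩
  obtain ⟨τ, hτ, hτK⟩ := hS.monster.2.exists_aut (h₁.comp hH)
    (hS.small_union hsA (hsD.mono hBD)) (fun s a a' ⟨n, h, _⟩ => h.1)
  have hmem : ∀ b ∈ B, (⟨b.1, b.2.1⟩ : El U) ∈ image (Fam.incl V.carrier) B :=
    fun b hb => ⟨b, hb, rfl⟩
  refine ⟨τ, hτ, fun b hb => ?_, ?_⟩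
  · have hbW : (⟨b.1, b.2.1⟩ : El U) ∈ W.carrier := hDW (image_mono hBD (hmem b hb))
    exact hτK _ _ _ ⟨_, ⟨Or.inr hb, ⟨b.2.1, hbW⟩, (hσB _ (hmem b hb)).symm, rfl⟩,
      hHD _ _ _ (hBD hb) rfl⟩
  · obtain ⟨ρ, hρ, hρK⟩ := hS.monster₀.2.exists_aut
      (((hS.isPartialElem_base hT (Str.Models.of_contained hS.contained hS.models) hW
        (Str.Models.of_contained hS.contained h𝔑) he hH)).mono
          (H := fun s a b => (⟨s, a⟩ : El U) ∈ Q ∧ ∃ (x : Fam W.carrier s) (y : Fam V.carrier s),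
            x.1 = a ∧ y.1 = b ∧ H s (e s x) y) fun _ _ _ h => h.2) hsQ (fun _ _ _ h => h.1)
    refine ⟨ρ, hρ, ?_, ?_⟩
    · rintro ⟨s, d⟩ hd
      obtain ⟨hdV, hdD⟩ := mem_image_incl.1 hd
      exact hρK _ _ _ ⟨Or.inr hd, ⟨d, hDW hd⟩, ⟨d, hdV⟩, rfl, rfl, hHD _ _ _ hdD rfl⟩
    · rintro ⟨s, a⟩ ha
      have haQ : (⟨s, σ s a.1⟩ : El U) ∈ image (fun s => σ s) (image (Fam.incl V.carrier) A) :=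
        ⟨⟨s, a.1⟩, ⟨_, ha, rfl⟩, rfl⟩
      obtain ⟨y, hy⟩ := hHdom ⟨s, e s ⟨σ s a.1, hAW haQ⟩⟩
        ⟨⟨s, ⟨σ s a.1, hAW haQ⟩⟩, Or.inl haQ, rfl⟩
      have hτy : τ s a = y := hτK _ _ _ ⟨_, ⟨Or.inl ha, _, rfl, rfl⟩, hy⟩
      exact hρK _ _ _ ⟨Or.inl haQ, ⟨σ s a.1, hAW haQ⟩, y, rfl, by rw [hτy], hy⟩

/-- In the situation of `exists_realization`, for `acl (A ∪ C)` and `acl (D ∪ C)`: if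
`σ (acl (A ∪ C))` and `acl (D ∪ C)` are independent over `acl C`, then the conjugate of `A` found in
`V` is independent from `D` over `C`. -/
theorem exists_conj_indPlus (hS : Setting i κ T₀ 𝔘₀ R₀ T Tp V)
    (hT : T₀.ContainedVia i T ∨ T₀.HasQE) {W : Sub i 𝔘₀} (hW : W.str.Models T)
    {𝔑 : Str L N} (h𝔑 : 𝔑.Models Tp) {e : ∀ s, Fam W.carrier s → N s} (he : IsEmb W.str 𝔑 e)
    {A B C D : Set (El (Fam V.carrier))} (hsA : Small κ A) (hsC : Small κ C) (hsD : Small κ D)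
    (hCB : C ⊆ B) (hBD : B ⊆ D ∪ C)
    {σ : ∀ s, U s ≃ U s}
    (hσB : ∀ b ∈ image (Fam.incl V.carrier) B, σ b.1 b.2 = b.2)
    (hAW : image (fun s => σ s) (image (Fam.incl V.carrier) (acl V.str (A ∪ C))) ⊆ W.carrier)
    (hDW : image (Fam.incl V.carrier) (acl V.str (D ∪ C)) ⊆ W.carrier)
    (h₁ : IsPartialElem V.str 𝔑 (fun s a n =>
      (⟨s, a⟩ : El (Fam V.carrier)) ∈ acl V.str (A ∪ C) ∪ B ∧
        ∃ x : Fam W.carrier s, x.1 = σ s a.1 ∧ e s x = n))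
    (h₂ : IsPartialElem V.str 𝔑 (fun s d n =>
      (⟨s, d⟩ : El (Fam V.carrier)) ∈ acl V.str (D ∪ C) ∧
        ∃ x : Fam W.carrier s, x.1 = d.1 ∧ e s x = n))
    (hR : R₀ (image (fun s => σ s) (image (Fam.incl V.carrier) (acl V.str (A ∪ C))))
      (image (Fam.incl V.carrier) (acl V.str C))
      (image (Fam.incl V.carrier) (acl V.str (D ∪ C)))) :
    ∃ A', Conj V.str B A A' ∧ indPlus V R₀ A' C D := by
  have hsAC := hS.small_acl (hS.small_union hsA hsC)
  have hsDC := hS.small_acl (hS.small_union hsD hsC)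
  obtain ⟨τ, hτ, hτB, ρ, hρ, hρD, hρσ⟩ := hS.exists_realization hT hW h𝔑 he hsAC hsDC
    (hBD.trans (subset_acl _ _)) hσB hAW hDW h₁ h₂
  refine ⟨_, ⟨τ, hτ, hτB, rfl⟩, ?_⟩
  have h := hS.inv ρ hρ _ _ _ ((hsAC.image _).image _) (hsDC.image _) (hS.small_image_acl hsC) hR
  have hC : image (fun s => ρ s) (image (Fam.incl V.carrier) (acl V.str C))
      = image (Fam.incl V.carrier) (acl V.str C) :=
    image_eq_self fun c hc => hρD c (image_mono (acl_mono _ Set.subset_union_right) hc)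
  have hA : image (fun s => ρ s) (image (fun s => σ s)
      (image (Fam.incl V.carrier) (acl V.str (A ∪ C))))
      = image (Fam.incl V.carrier) (acl V.str (image (fun s => τ s) A ∪ C)) := by
    have hτC : image (fun s => τ s) C = C := image_eq_self fun c hc => hτB c (hCB hc)
    rw [← hτC, ← image_union, ← image_acl hτ, image_image, image_image, image_image, hτC]
    exact image_congr fun a ha => hρσ a ha
  rw [hA, hC, image_eq_self (h := fun s => ρ s) hρD] at h
  exact h

/-- The two sets are enlarged to small elementary substructures of `V`; by model completeness of
`Tp` both are elementary in any model of `Tp` that contains an amalgam of their copies. -/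
theorem fullExistence (hS : Setting i κ T₀ 𝔘₀ R₀ T Tp V)
    (hT : T₀.ContainedVia i T ∨ T₀.HasQE) (hmon : Monotonicity κ anyBase R₀)
    (hsym : Symmetry κ anyBase R₀) (hfe : FullExistence κ 𝔘₀ R₀) :
    FullExistence κ V.str (indPlus V R₀) := by
  intro A B C hA hB hC
  have hsAC := hS.small_acl (hS.small_union hA hC)
  have hsBC := hS.small_acl (hS.small_union hB hC)
  have hsC := hS.small_acl hC
  obtain ⟨Y, hY, hAY, hsY, hYm, hYel⟩ := hS.exists_small_model hsAC
  obtain ⟨Z, hZ, hBZ, hsZ, hZm, hZel⟩ := hS.exists_small_model hsBC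
  have hCY := (acl_mono V.str (Set.subset_union_right (s := A))).trans hAY
  have hCZ := (acl_mono V.str (Set.subset_union_right (s := B))).trans hBZ
  obtain ⟨_, ⟨σ, hσ, hσC, rfl⟩, hR⟩ := hfe (image (Fam.incl V.carrier) Y)
    (image (Fam.incl V.carrier) Z) (image (Fam.incl V.carrier) (acl V.str C))
    (hsY.image _) (hsZ.image _) (hsC.image _)
  obtain ⟨⟨W, hW, hYW, hZW⟩, -⟩ := hS.amalgamation (hS.isClosed_acl hC) hY hZ hCY hCZ hsY hsZ
    (hS.acl_base_inter_acl_subset hC) hσ (IsAut.refl 𝔘₀) hσC (fun _ _ => rfl) (by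
      rwa [image_eq_self (h := fun s => Equiv.refl (U s)) fun _ _ => rfl])
  obtain ⟨N, 𝔑, e, h𝔑, he⟩ := hS.embeds _ _ hW
  obtain ⟨f, hf, hfσ⟩ := Sub.exists_of_ofEmb_le hYW
  obtain ⟨g, hg, hgr⟩ := Sub.exists_of_ofEmb_le hZW
  have hfe := hS.mc _ _ _ _ _ hYm h𝔑 (he.comp hf)
  have hge := hS.mc _ _ _ _ _ hZm h𝔑 (he.comp hg)
  refine hS.exists_conj_indPlus hT hW h𝔑 he hA hC hB subset_rfl Set.subset_union_right
    (fun b hb => hσC b (image_mono (subset_acl _ _) hb)) ?_ ?_ ?_ ?_ ?_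
  · rintro ⟨s, b⟩ hb
    obtain ⟨a, ha, rfl⟩ := mem_image.1 hb
    obtain ⟨haV, ha⟩ := mem_image_incl.1 ha
    have hmem := (f s ⟨⟨a, haV⟩, hAY ha⟩).2
    have heq : (f s ⟨⟨a, haV⟩, hAY ha⟩).1 = σ s a := hfσ _ _
    rwa [heq] at hmem
  · rintro ⟨s, b⟩ hb
    obtain ⟨hbV, hb⟩ := mem_image_incl.1 hb
    have hmem := (g s ⟨⟨b, hbV⟩, hBZ hb⟩).2
    have heq : (g s ⟨⟨b, hbV⟩, hBZ hb⟩).1 = b := hgr _ _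
    rwa [heq] at hmem
  · refine (hYel.isPartialElem.symm.comp hfe.isPartialElem).mono ?_
    rintro s a n ⟨ha, x, hx, rfl⟩
    have haY : (⟨s, a⟩ : El (Fam V.carrier)) ∈ Y :=
      ha.elim (fun h => hAY h) fun h => hCY (subset_acl _ _ h)
    refine ⟨⟨a, haY⟩, rfl, ?_⟩
    congr 1
    exact Subtype.ext ((hfσ _ _).trans hx.symm)
  · refine (hZel.isPartialElem.symm.comp hge.isPartialElem).mono ?_
    rintro s d n ⟨hd, x, hx, rfl⟩
    refine ⟨⟨d, hBZ hd⟩, rfl, ?_⟩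
    congr 1
    exact Subtype.ext ((hgr _ _).trans hx.symm)
  · have hsσY := (hsY.image (Fam.incl V.carrier)).image (fun s => σ s)
    have hsσA := (hsAC.image (Fam.incl V.carrier)).image (fun s => σ s)
    have h₁ := hmon _ (image (Fam.incl V.carrier) (acl V.str (B ∪ C))) _ _ hsσY
      (hsBC.image _) (hsC.image _) (hsZ.image _) trivial
      (by rw [Set.union_eq_right.2 (image_mono hBZ)]; exact hR)
    have h₂ := hsym _ _ _ hsσY (hsBC.image _) (hsC.image _) trivial h₁
    have h₃ := hmon _ (image (fun s => σ s) (image (Fam.incl V.carrier) (acl V.str (A ∪ C)))) _ _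
      (hsBC.image _) hsσA (hsC.image _) hsσY trivial
      (by rw [Set.union_eq_right.2 (image_mono (image_mono hAY))]; exact h₂)
    exact hsym _ _ _ (hsBC.image _) hsσA (hsC.image _) trivial h₃

/-! ### Extension -/

/-- Under quantifier elimination, the type of the universe of a substructure `D` of `V` is
preserved by an embedding of `D` in a model of `T` that is induced by an automorphism of `𝔘₀`; the
automorphism matters only for quantifier elimination after Morleyisation, where the embedding has to
preserve the truth of `L₀`-formulas as well. -/
theorem isPartialElem_of_qe (hS : Setting i κ T₀ 𝔘₀ R₀ T Tp V)
    (hqe : Tp.HasQE ∨ T₀.ContainedVia i T ∧ Tp.HasQEOver i) {D W : Sub i 𝔘₀} (hDV : D.LE V)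
    (hW : W.str.Models T) {σ : ∀ s, U s ≃ U s} (hσ : IsAut 𝔘₀ σ)
    {k : ∀ s, Fam D.carrier s → Fam W.carrier s} (hk : IsEmb D.str W.str k)
    (hkσ : ∀ s x, (k s x).1 = σ s x.1) {𝔑 : Str L N} (h𝔑 : 𝔑.Models Tp)
    {e : ∀ s, Fam W.carrier s → N s} (he : IsEmb W.str 𝔑 e) :
    IsPartialElem V.str 𝔑 (fun s a n => ∃ x : Fam D.carrier s, x.1 = a.1 ∧ e s (k s x) = n) := by
  obtain ⟨hsub, hDV⟩ := hDV
  intro Γ φ v w hvw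
  choose x hx hxw using hvw
  obtain rfl : (fun j => ⟨(x j).1, hsub (x j).2⟩) = v := funext fun j => Subtype.ext (hx j)
  obtain rfl : (fun j => e _ (k _ (x j))) = w := funext hxw
  rcases hqe with hqe | ⟨hT, hqe⟩
  · obtain ⟨ψ, hψ, h⟩ := hqe Γ φ
    refine (h _ _ hS.models _).trans (Iff.trans ?_ (h _ _ h𝔑 _).symm)
    exact (hDV.holds_of_isQF hψ x).symm.trans ((he.comp hk).holds_of_isQF hψ x)
  · obtain ⟨ψ, hψ, h⟩ := hqe Γ φ
    refine (h _ _ hS.models _).trans (Iff.trans ?_ (h _ _ h𝔑 _).symm)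
    -- the Morleyisation of `D` takes the truth of `L₀`-formulas from `𝔘₀`
    let 𝔇 : Str (Lang.morley L₀ L) (Fam D.carrier) :=
      { fn := fun {Γ s} f v => D.str.fn (Γ := Γ) (s := s) f v
        rel := fun r v => Sum.elim (fun r' => D.str.rel r' v)
          (fun φ => φ.Holds 𝔘₀ (fun j => (v j).1)) r }
    have hVT : V.str.Models T := Str.Models.of_contained hS.contained hS.models
    have hV₀ := hS.mc₀ _ _ _ _ _ (hT _ _ hVT) hS.models₀ V.isEmb
    have hW₀ := hS.mc₀ _ _ _ _ _ (hT _ _ hW) hS.models₀ W.isEmb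
    have hN₀ := hS.mc₀ _ _ _ _ _ (hT _ _ hW)
      (hT _ _ (Str.Models.of_contained hS.contained h𝔑)) (he.reduct i)
    have hV : IsEmb 𝔇 (V.str.morley i) (fun _ x => ⟨x.1, hsub x.2⟩) :=
      { injective := hDV.injective
        map_fn := fun {Γ s} f v => hDV.map_fn (Γ := Γ) (s := s) f v
        map_rel := fun {Γ} r v => by
          rcases r with r | φ
          · exact hDV.map_rel r v
          · exact (hV₀ Γ φ (fun j => ⟨(v j).1, hsub (v j).2⟩)).symm }
    have hN : IsEmb 𝔇 (𝔑.morley i) (fun s x => e s (k s x)) :=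
      { injective := (he.comp hk).injective
        map_fn := fun {Γ s} f v => (he.comp hk).map_fn (Γ := Γ) (s := s) f v
        map_rel := fun {Γ} r v => by
          rcases r with r | φ
          · exact (he.comp hk).map_rel r v
          · refine Iff.trans ?_ ((hW₀ Γ φ (fun j => k _ (v j))).symm.trans (hN₀ Γ φ _))
            refine (hσ.isElementary Γ φ _).trans (iff_of_eq (congrArg _ ?_))
            exact funext fun j => (hkσ _ _).symm }
    exact (hV.holds_of_isQF hψ x).symm.trans (hN.holds_of_isQF hψ x)

/-- Let `A` and `B` be independent over `C`, and let `σ` be an automorphism of `𝔘₀` over `B`. Then,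
for every model `W` of `T` that contains `σ A` and `B`, the restriction of `σ` to some substructure
of `V` that contains `A` and `B` is an `L`-embedding in `W`. This is the uniqueness of the
`L`-structure in (ii) of `DerivationLike`, for `σ A` and `B`. -/
theorem exists_sub_embedding (hS : Setting i κ T₀ 𝔘₀ R₀ T Tp V)
    {A B C : Set (El (Fam V.carrier))} (hC : IsClosed V.str C) (hA : IsClosed V.str A)
    (hB : IsClosed V.str B) (hCA : C ⊆ A) (hCB : C ⊆ B) (hsA : Small κ A) (hsB : Small κ B)
    (hacl : acl 𝔘₀ (image (Fam.incl V.carrier) C) ∩ V.carrier ⊆ image (Fam.incl V.carrier) C)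
    {σ : ∀ s, U s ≃ U s} (hσ : IsAut 𝔘₀ σ)
    (hσB : ∀ c ∈ image (Fam.incl V.carrier) B, σ c.1 c.2 = c.2)
    (hR : R₀ (image (Fam.incl V.carrier) A) (image (Fam.incl V.carrier) C)
      (image (Fam.incl V.carrier) B)) {W : Sub i 𝔘₀} (hW : W.str.Models T)
    (hAW : (V.copy A hA σ hσ).LE W) (hBW : (V.copy B hB _ (IsAut.refl 𝔘₀)).LE W) :
    ∃ D : Sub i 𝔘₀, D.LE V ∧ image (Fam.incl V.carrier) (A ∪ B) ⊆ D.carrier ∧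
      ∃ k : ∀ s, Fam D.carrier s → Fam W.carrier s, IsEmb D.str W.str k ∧
        ∀ s x, (k s x).1 = σ s x.1 := by
  have hrefl : ∀ B : Set (El U), image (fun s => Equiv.refl (U s)) B = B :=
    fun B => image_eq_self fun _ _ => rfl
  have hVT : V.str.Models T := Str.Models.of_contained hS.contained hS.models
  have hsP := hS.small_union (hsA.image (Fam.incl V.carrier)) (hsB.image (Fam.incl V.carrier))
  have hσιB : image (fun s => σ s) (image (Fam.incl V.carrier) B) = image (Fam.incl V.carrier) B :=
    image_eq_self hσB
  have hσC : ∀ c ∈ image (Fam.incl V.carrier) C, σ c.1 c.2 = c.2 :=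
    fun c hc => hσB c (image_mono hCB hc)
  have hAW' : image (fun s => σ s) (image (Fam.incl V.carrier) A) ⊆ W.carrier := by
    rw [← Sub.carrier_copy V A hA σ hσ]
    exact hAW.1
  have hBW' : image (Fam.incl V.carrier) B ⊆ W.carrier := by
    rw [← hrefl (image (Fam.incl V.carrier) B), ← Sub.carrier_copy V B hB _ (IsAut.refl 𝔘₀)]
    exact hBW.1
  set P := image (Fam.incl V.carrier) A ∪ image (Fam.incl V.carrier) B with hP
  -- a closed set that contains `A` and `B`, lies in `V` and is taken to a subset of `W` by `σ`
  set X : Set (El U) := (acl 𝔘₀ P ∩ V.carrier) ∩ {x | (⟨x.1, σ x.1 x.2⟩ : El U) ∈ W.carrier}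
    with hX
  have hclosed : ∀ (W : Sub i 𝔘₀) {Γ : List S} {s : S} (f : L₀.Fn Γ s) {w : Env U Γ},
      w.In W.carrier → (⟨s, 𝔘₀.fn f w⟩ : El U) ∈ W.carrier := by
    intro W Γ s f w hw
    have := W.isEmb.map_fn f (fun j => ⟨w j, hw j⟩)
    change _ = 𝔘₀.fn f w at this
    rw [← this]
    exact (W.str.fn (i.onFn f) fun j => ⟨w j, hw j⟩).2
  have hXcl : IsClosed 𝔘₀ X := by
    intro Γ s f w hw
    refine ⟨⟨MultiSorted.isClosed_acl hS.aleph0_le hS.monster₀ hsP Γ s f w fun j => (hw j).1.1,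
      hclosed V f fun j => (hw j).1.2⟩, ?_⟩
    have := hσ.map_fn f w
    change (⟨s, σ s (𝔘₀.fn f w)⟩ : El U) ∈ W.carrier
    rw [this]
    exact hclosed W f fun j => (hw j).2
  have hPX : P ⊆ X := by
    rintro x (hx | hx)
    · exact ⟨⟨subset_acl _ _ (Or.inl hx), image_incl_subset _ hx⟩, hAW' ⟨x, hx, rfl⟩⟩
    · refine ⟨⟨subset_acl _ _ (Or.inr hx), image_incl_subset _ hx⟩, ?_⟩
      refine hBW' ?_
      rw [← hσιB]
      exact ⟨x, hx, rfl⟩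
  obtain ⟨D, hDX, hDV, -⟩ := (hS.amalgamation hC hA hB hCA hCB hsA hsB hacl (IsAut.refl 𝔘₀)
    (IsAut.refl 𝔘₀) (fun _ _ => rfl) (fun _ _ => rfl) (by rwa [hrefl, hrefl])).2 V hVT
    (copy_refl_le V _) (copy_refl_le V _) X hXcl (by rw [hrefl, hrefl]; exact hPX)
    (by rw [hrefl, hrefl]; exact Set.inter_subset_left)
  have hPD : P ⊆ D.carrier := hPX.trans hDX.superset
  have hRσ : R₀ (image (fun s => σ s) (image (Fam.incl V.carrier) A)) (image (Fam.incl V.carrier) C)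
      (image (Fam.incl V.carrier) B) := by
    have := hS.inv σ hσ _ _ _ (hsA.image _) (hsB.image _) ((hsA.mono hCA).image _) hR
    rwa [image_eq_self (h := fun s => σ s) hσC, hσιB] at this
  have hσXcl : IsClosed 𝔘₀ (image (fun s => σ s) X) := by
    intro Γ s f w hw
    have := hXcl Γ s f (fun j => (σ _).symm (w j)) fun j => mem_image_equiv.1 (hw j)
    rw [mem_image_equiv]
    have h := hσ.symm.map_fn f w
    simp only at h
    rw [h]
    exact this
  obtain ⟨D₂, -, hD₂W, huniq⟩ := (hS.amalgamation hC hA hB hCA hCB hsA hsB hacl hσ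
    (IsAut.refl 𝔘₀) hσC (fun _ _ => rfl) (by rwa [hrefl])).2 W hW hAW hBW
    (image (fun s => σ s) X) hσXcl
    (by rw [hrefl, ← hσιB, ← image_union]; exact image_mono hPX)
    (by
      rw [hrefl, ← hσιB, ← image_union, ← image_acl hσ]
      rintro ⟨s, b⟩ hb
      refine ⟨image_mono (fun x hx => hx.1.1) hb, ?_⟩
      obtain ⟨a, ha, rfl⟩ := mem_image.1 hb
      exact ha.2)
  -- the conjugate of `D` under `σ` is the substructure of `W` with the same universe
  have hh : IsEmb (D.str.reduct i) 𝔘₀ (fun s x => σ s x.1) :=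
    IsEmb.comp (g := fun s => σ s) hσ D.isEmb
  have hg : ∀ {E : Set (El (Fam V.carrier))} (hE : IsClosed V.str E)
      (hED : image (Fam.incl V.carrier) E ⊆ D.carrier),
      IsEmb (V.str.restrict E hE) D.str (fun s x => ⟨x.1.1, hED ⟨⟨s, x.1⟩, x.2, rfl⟩⟩) :=
    fun hE _ => IsEmb.of_comp hDV.2 (V.str.isEmb_restrict _ hE)
  have hD₂ : Sub.ofEmb D.str _ hh = D₂ := by
    refine huniq _ ?_ ((hDV.2.comp (Sub.isEmb_ofEmbInv _ _ hh)).models_universal hVT)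
      (Sub.ofEmb_le_ofEmb (hg hA (Set.subset_union_left.trans hPD)) fun _ _ => rfl)
      (Sub.ofEmb_le_ofEmb (hg hB (Set.subset_union_right.trans hPD)) fun s x =>
        hσB _ ⟨⟨s, x.1⟩, x.2, rfl⟩)
    ext ⟨s, b⟩
    rw [mem_image, ← hDX]
    exact ⟨fun ⟨a, ha⟩ => ⟨a.1, a.2, ha⟩, fun ⟨a, ha, hb⟩ => ⟨⟨a, ha⟩, hb⟩⟩
  obtain ⟨k, hk, hkσ⟩ := Sub.exists_of_ofEmb_le (hD₂ ▸ hD₂W)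
  exact ⟨D, hDV, by rwa [image_union], k, hk, hkσ⟩

/-- The conjugate `σ A` given by extension for `R₀` is amalgamated with the closure of `B ∪ D ∪ C`
in a model `W` of `T`; `exists_sub_embedding` and quantifier elimination show that `A ∪ B` and
`σ A ∪ B` have the same type. -/
theorem extension (hS : Setting i κ T₀ 𝔘₀ R₀ T Tp V) {base₀ : Set (El U) → Prop}
    {base : Set (El (Fam V.carrier)) → Prop}
    (hb : ∀ C, base C → base₀ (image (Fam.incl V.carrier) (acl V.str C)))
    (hT : T₀.ContainedVia i T ∨ T₀.HasQE)
    (hqe : Tp.HasQE ∨ T₀.ContainedVia i T ∧ Tp.HasQEOver i) (hext : Extension κ 𝔘₀ base₀ R₀) :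
    Extension κ V.str base (indPlus V R₀) := by
  intro A B C hA hB hC hbase hR D hD
  have hAC := hS.small_union hA hC
  have hBC := hS.small_union hB hC
  have hBDC := hS.small_union (hS.small_union hB hD) hC
  have hBCsub : B ∪ C ⊆ B ∪ D ∪ C := Set.union_subset_union_left _ Set.subset_union_left
  obtain ⟨_, ⟨σ, hσ, hσB, rfl⟩, h⟩ := hext _ _ _ (hS.small_image_acl hAC) (hS.small_image_acl hBC)
    (hS.small_image_acl hC) (hb C hbase) hR _ (hS.small_image_acl hBDC)
  rw [image_acl_union_eq hBCsub] at h
  have hσB' : ∀ c ∈ image (Fam.incl V.carrier) (acl V.str (B ∪ C)), σ c.1 c.2 = c.2 :=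
    fun c hc => hσB c (Or.inl hc)
  have hcA := hS.isClosed_acl hAC
  have hcB := hS.isClosed_acl hBC
  have hcD := hS.isClosed_acl hBDC
  have hcC := hS.isClosed_acl hC
  have hCA := acl_mono V.str (Set.subset_union_right (s := A) (t := C))
  have hCB := acl_mono V.str (Set.subset_union_right (s := B) (t := C))
  have hBD := acl_mono V.str hBCsub
  obtain ⟨⟨W, hW, hAW, hDW⟩, -⟩ := hS.amalgamation hcC hcA hcD hCA (hCB.trans hBD)
    (hS.small_acl hAC) (hS.small_acl hBDC) (hS.acl_base_inter_acl_subset hC) hσ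
    (IsAut.refl 𝔘₀) (fun c hc => hσB' c (image_mono hCB hc)) (fun _ _ => rfl) (by
      rwa [image_eq_self (h := fun s => Equiv.refl (U s)) fun _ _ => rfl])
  obtain ⟨N, 𝔑, e, h𝔑, he⟩ := hS.embeds _ _ hW
  obtain ⟨g, hg, hgr⟩ := Sub.exists_of_ofEmb_le hDW
  have hBW : (V.copy _ hcB _ (IsAut.refl 𝔘₀)).LE W :=
    Sub.ofEmb_le (hg.comp (V.str.isEmb_restrict_mono hcB hcD hBD)) fun _ _ => hgr _ _
  obtain ⟨E, hEV, hABE, k, hk, hkσ⟩ := hS.exists_sub_embedding hcC hcA hcB hCA hCB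
    (hS.small_acl hAC) (hS.small_acl hBC) (hS.acl_base_inter_acl_subset hC) hσ hσB' hR hW hAW hBW
  have hDcar : (V.copy _ hcD _ (IsAut.refl 𝔘₀)).carrier
      = image (Fam.incl V.carrier) (acl V.str (B ∪ D ∪ C)) := by
    rw [Sub.carrier_copy]
    exact image_eq_self fun _ _ => rfl
  rw [Set.union_comm B C]
  refine hS.exists_conj_indPlus (B := C ∪ B) hT hW h𝔑 he hA hC (hS.small_union hB hD)
    Set.subset_union_left ?_ ?_ ?_ ?_ ?_ ?_ h
  · exact Set.union_subset Set.subset_union_right (Set.subset_union_left.trans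
      Set.subset_union_left)
  · intro b hb
    refine hσB' b (image_mono ?_ hb)
    rw [Set.union_comm C B]
    exact subset_acl _ _
  · rw [← Sub.carrier_copy V _ hcA σ hσ]
    exact hAW.1
  · rw [← hDcar]
    exact hDW.1
  · refine (hS.isPartialElem_of_qe hqe hEV hW hσ hk hkσ h𝔑 he).mono ?_
    rintro s a n ⟨ha, x, hx, rfl⟩
    have haE : (⟨s, a.1⟩ : El U) ∈ E.carrier := by
      refine hABE ⟨⟨s, a⟩, ?_, rfl⟩
      rw [Set.union_comm C B] at ha
      exact ha.imp id fun h => subset_acl _ _ h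
    refine ⟨⟨a.1, haE⟩, rfl, ?_⟩
    congr 1
    exact Subtype.ext ((hkσ _ _).trans hx.symm)
  · refine (hS.isPartialElem_of_qe hqe (copy_refl_le V hcD) hW (IsAut.refl 𝔘₀) hDW.2
      (fun _ _ => rfl) h𝔑 he).mono ?_
    rintro s d n ⟨hd, x, hx, rfl⟩
    refine ⟨⟨d.1, hDcar.superset ⟨_, hd, rfl⟩⟩, rfl, ?_⟩
    congr 1
    exact Subtype.ext hx.symm

end Setting

/-! ### Local character -/

/-- Every finite set of elements is the range of a tuple. -/
theorem exists_env_range {F : Set (El M)} (hF : F.Finite) :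
    ∃ (Γ : List S) (v : Env M Γ), (Set.range fun j => (⟨_, v j⟩ : El M)) = F := by
  induction F, hF using Set.Finite.induction_on with
  | empty => exact ⟨[], Env.nil, Set.eq_empty_of_forall_notMem fun x ⟨j, _⟩ => j.elim0⟩
  | @insert a F _ _ ih =>
    obtain ⟨Γ, v, rfl⟩ := ih
    refine ⟨a.1 :: Γ, Env.cons a.2 v, ?_⟩
    ext x
    constructor
    · rintro ⟨j, rfl⟩
      refine Fin.cases ?_ (fun k => ?_) j
      · exact Set.mem_insert _ _
      · exact Set.mem_insert_of_mem _ ⟨k, rfl⟩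
    · rintro (rfl | ⟨k, rfl⟩)
      · exact ⟨(0 : Fin (Γ.length + 1)), rfl⟩
      · exact ⟨k.succ, rfl⟩

/-- The complete type of a tuple over the empty set. -/
def Str.typeOf (𝔐 : Str L M) {Γ : List S} (v : Env M Γ) : Set (Σ Γ : List S, Formula L Γ) :=
  {q | ∃ φ : Formula L Γ, q = ⟨Γ, φ⟩ ∧ φ.Holds 𝔐 v}

theorem mem_typeOf {𝔐 : Str L M} {Γ : List S} {v : Env M Γ} {φ : Formula L Γ} :
    ⟨Γ, φ⟩ ∈ 𝔐.typeOf v ↔ φ.Holds 𝔐 v := by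
  constructor
  · rintro ⟨ψ, h, hψ⟩
    obtain rfl := eq_of_heq (Sigma.mk.inj h).2
    exact hψ
  · exact fun h => ⟨φ, rfl, h⟩

/-- In a strongly homogeneous structure, tuples of the same type are conjugate. -/
theorem exists_aut_of_typeOf_eq {κ : Cardinal.{u}} (hκ : Cardinal.aleph0 ≤ κ) {𝔐 : Str L M}
    (h𝔐 : IsStronglyHomogeneous κ 𝔐) {Γ : List S} {v w : Env M Γ}
    (h : 𝔐.typeOf v = 𝔐.typeOf w) :
    ∃ σ : ∀ s, M s ≃ M s, IsAut 𝔐 σ ∧ ∀ j, σ _ (v j) = w j := by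
  have hG : IsPartialElem 𝔐 𝔐 (fun s a b => ∃ j : Fin Γ.length,
      (⟨s, a, b⟩ : Σ s, M s × M s) = ⟨_, v j, w j⟩) := by
    intro Δ φ a b hab
    choose f hf using hab
    have key : ∀ (s : S) (x y : M s) (j : Fin Γ.length),
        (⟨s, x, y⟩ : Σ s, M s × M s) = ⟨_, v j, w j⟩ →
        ∃ t : Term L Γ s, t.val 𝔐 v = x ∧ t.val 𝔐 w = y := by
      intro s x y j hj
      injection hj with h₁ h₂
      subst h₁
      obtain ⟨rfl, rfl⟩ := Prod.mk.inj (eq_of_heq h₂)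
      exact ⟨.var j, rfl, rfl⟩
    choose t ht using fun j => key _ _ _ _ (hf j)
    have h₁ : (fun j => (t j).val 𝔐 v) = a := funext fun j => (ht j).1
    have h₂ : (fun j => (t j).val 𝔐 w) = b := funext fun j => (ht j).2
    rw [← h₁, ← h₂, ← Formula.holds_subst, ← Formula.holds_subst, ← mem_typeOf, h, mem_typeOf]
  obtain ⟨σ, hσ, hσG⟩ := h𝔐.exists_aut hG (P := Set.range fun j => (⟨_, v j⟩ : El M))
    (lt_of_lt_of_le (Cardinal.lt_aleph0_iff_set_finite.2 (Set.finite_range _)) hκ) (by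
      rintro s a b ⟨j, hj⟩
      injection hj with h₁ h₂
      subst h₁
      obtain ⟨rfl, rfl⟩ := Prod.mk.inj (eq_of_heq h₂)
      exact ⟨j, rfl⟩)
  exact ⟨σ, hσ, fun j => hσG _ _ _ ⟨j, rfl⟩⟩

namespace Setting

variable {i : Incl L₀ L} {κ : Cardinal.{u}} {T₀ : Theory L₀} {𝔘₀ : Str L₀ U} {R₀ : IndRel U}
  {T Tp : Theory L} {V : Sub i 𝔘₀}

open Cardinal in
/-- There are at most `2 ^ |L|` conjugacy classes of finite sets, so that local character holds
for all finite sets with a common bound. -/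
theorem exists_localCharacter_finite (hS : Setting i κ T₀ 𝔘₀ R₀ T Tp V)
    (hcof : 2 ^ L.card < κ.ord.cof) (hlc : LocalCharacter κ R₀) :
    ∃ μ < κ, ∀ F : Set (El U), F.Finite → ∀ B : Set (El U), Small κ B →
      ∃ D ⊆ B, #D ≤ μ ∧ R₀ F D B := by
  classical
  have hfinS : ∀ {F : Set (El U)}, F.Finite → Small κ F := fun hF =>
    lt_of_lt_of_le (lt_aleph0_iff_set_finite.2 hF) hS.aleph0_le
  have hrange : ∀ {Γ : List S} (v : Env U Γ), Small κ (Set.range fun j => (⟨_, v j⟩ : El U)) :=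
    fun v => hfinS (Set.finite_range _)
  set ι := List S × Set (Σ Γ : List S, Formula L₀ Γ) with hι
  set f : ι → Cardinal.{u} := fun p =>
    if h : ∃ v : Env U p.1, 𝔘₀.typeOf v = p.2 then (hlc _ (hrange h.choose)).choose else 0 with hf
  have hικ : #ι < κ.ord.cof := by
    refine lt_of_le_of_lt ?_ hcof
    have h₂ : ℵ₀ ≤ (2 : Cardinal.{u}) ^ L.card := L.aleph0_le_card.trans (cantor _).le
    rw [hι, ← mul_def]
    refine mul_le_of_le h₂ ((mk_contexts_le L).trans (cantor _).le) ?_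
    rw [mk_set]
    exact power_le_power_left two_ne_zero ((mk_formula_le L₀).trans i.card_le)
  have hfκ : ∀ p, f p < κ := by
    intro p
    simp only [hf]
    split_ifs with h
    · exact (hlc _ (hrange h.choose)).choose_spec.1
    · exact lt_of_lt_of_le aleph0_pos hS.aleph0_le
  refine ⟨⨆ p, f p, iSup_lt_of_lt_cof_ord hικ hfκ, fun F hF B hB => ?_⟩
  obtain ⟨Γ, w, rfl⟩ := exists_env_range hF
  have h : ∃ v : Env U Γ, 𝔘₀.typeOf v = 𝔘₀.typeOf w := ⟨w, rfl⟩
  obtain ⟨σ, hσ, hσv⟩ := exists_aut_of_typeOf_eq hS.aleph0_le hS.monster₀.2 h.choose_spec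
  obtain ⟨D, hDB, hD, hR⟩ := (hlc _ (hrange h.choose)).choose_spec.2
    (image (fun s => (σ s).symm) B) (hB.image _)
  have hfp : f (Γ, 𝔘₀.typeOf w) = (hlc _ (hrange h.choose)).choose := by
    simp only [hf]
    exact dif_pos h
  rw [← hfp] at hD
  have hR' := hS.inv σ hσ _ _ _ (hrange _) (hB.image _) ((hB.image _).mono hDB) hR
  refine ⟨image (fun s => σ s) D, ?_, ?_, ?_⟩
  · have := image_mono (h := fun s => σ s) hDB
    rwa [image_image_symm] at this
  · exact mk_image_le.trans (hD.le.trans (le_ciSup bddAbove_of_small _))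
  · rw [image_image_symm] at hR'
    have : image (fun s => σ s) (Set.range fun j => (⟨_, h.choose j⟩ : El U))
        = Set.range fun j => (⟨_, w j⟩ : El U) := by
      rw [image, ← Set.range_comp]
      exact congrArg Set.range (funext fun j =>
        congrArg (Sigma.mk (Γ.get j)) (hσv j))
    rwa [this] at hR'

open Cardinal in
/-- Local character. The base is built in countably many steps: each step adds, for every finite
subset of the closure of `A` and the base so far, a base for that subset. -/
theorem localCharacter (hS : Setting i κ T₀ 𝔘₀ R₀ T Tp V) (hlim : Order.IsSuccLimit κ)
    (hcof : 2 ^ L.card < κ.ord.cof) (hbm : BaseMonotonicity κ R₀)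
    (hfc : FiniteCharacter κ anyBase R₀) (hlc : LocalCharacter κ R₀) :
    LocalCharacter κ (indPlus V R₀) := by
  classical
  obtain ⟨μ, hμ, hfin⟩ := hS.exists_localCharacter_finite hcof hlc
  intro A hA
  set c := max (max L.card #A) μ with hc
  have hcκ : c < κ := max_lt (max_lt hS.card_lt hA) hμ
  have hLc : L.card ≤ c := (le_max_left _ _).trans (le_max_left _ _)
  have hc₀ : ℵ₀ ≤ c := L.aleph0_le_card.trans hLc
  refine ⟨Order.succ c, hlim.succ_lt hcκ, fun B hB => ?_⟩
  have hsb := hS.small_image_acl hB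
  choose D hDb hDμ hDR using fun (F : {F : Set (El U) // F.Finite}) =>
    hfin F.1 F.2 (image (Fam.incl V.carrier) (acl V.str B)) hsb
  have hsupp : ∀ d : image (Fam.incl V.carrier) (acl V.str B), ∃ B₀ ⊆ B, B₀.Finite ∧
      d.1 ∈ image (Fam.incl V.carrier) (acl V.str B₀) := by
    rintro ⟨_, a, ha, rfl⟩
    obtain ⟨B₀, hB₀, hfin₀, h⟩ := exists_finite_of_mem_acl ha
    exact ⟨B₀, hB₀, hfin₀, a, h, rfl⟩
  choose g hgB hgfin hg using hsupp
  set ιacl : Set (El (Fam V.carrier)) → Set (El U) := fun C =>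
    image (Fam.incl V.carrier) (acl V.str (A ∪ C)) with hιacl
  -- finite subsets are listed, so that they can be counted
  set lset : ∀ X : Set (El U), List X → {F : Set (El U) // F.Finite} := fun X l =>
    ⟨(fun x : X => x.1) '' {x | x ∈ l}, (List.finite_toSet l).image _⟩ with hlset
  set step : Set (El (Fam V.carrier)) → Set (El (Fam V.carrier)) := fun C =>
    C ∪ ⋃ l : List (ιacl C), ⋃ d : D (lset _ l), g ⟨d.1, hDb _ d.2⟩ with hstep
  set C : ℕ → Set (El (Fam V.carrier)) := fun n => step^[n] ∅ with hC
  have hsucc : ∀ n, C (n + 1) = step (C n) := fun n => Function.iterate_succ_apply' _ _ _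
  have hmono : Monotone C := monotone_nat_of_le_succ fun n => by
    rw [hsucc]
    exact Set.subset_union_left
  have hCB : ∀ n, C n ⊆ B := by
    intro n
    induction n with
    | zero => exact Set.empty_subset _
    | succ n ih =>
      rw [hsucc]
      exact Set.union_subset ih (Set.iUnion_subset fun l => Set.iUnion_subset fun d => hgB _)
  have hstepc : ∀ X : Set (El (Fam V.carrier)), #X ≤ c → #(step X) ≤ c := by
    intro X hX
    refine (mk_union_le _ _).trans (add_le_of_le hc₀ hX ?_)
    have hιX : #(ιacl X) ≤ c := by
      refine mk_image_le.trans ((mk_acl_le _ _).trans (max_le hLc ((mk_union_le _ _).trans ?_)))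
      exact add_le_of_le hc₀ ((le_max_right _ _).trans (le_max_left _ _)) hX
    refine mk_iUnion_le_sum_mk.trans ((sum_le_sum _ (fun _ => c) fun l => ?_).trans ?_)
    · refine mk_iUnion_le_sum_mk.trans ((sum_le_sum _ (fun _ => ℵ₀) fun d =>
        (lt_aleph0_iff_set_finite.2 (hgfin _)).le).trans ?_)
      rw [sum_const']
      exact mul_le_of_le hc₀ ((hDμ _).trans (le_max_right _ _)) hc₀
    · rw [sum_const']
      exact mul_le_of_le hc₀ ((mk_list_le_max _).trans (max_le hc₀ hιX)) le_rfl
  have hCc : ∀ n, #(C n) ≤ c := by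
    intro n
    induction n with
    | zero => simp [hC]
    | succ n ih => rw [hsucc]; exact hstepc _ ih
  have hCωB : ⋃ n, C n ⊆ B := Set.iUnion_subset hCB
  have hsC : Small κ (⋃ n, C n) := hB.mono hCωB
  refine ⟨⋃ n, C n, hCωB, Order.lt_succ_of_le (mk_iUnion_nat_le hc₀ hCc), ?_⟩
  unfold indPlus
  rw [Set.union_eq_left.2 hCωB]
  refine hfc _ _ _ (hS.small_image_acl (hS.small_union hA hsC)) hsb (hS.small_image_acl hsC)
    trivial fun F hF hFfin => ?_
  -- the finite set `F` already appears at a finite stage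
  obtain ⟨n, hn⟩ : ∃ n, F ⊆ ιacl (C n) := by
    obtain ⟨F', hF', hfin', rfl⟩ := hFfin.exists_subset_finite_image_eq hF
    rw [Set.union_comm] at hF'
    obtain ⟨C₀, hC₀, hfin₀, h₀⟩ := exists_finite_subset_acl hfin' hF'
    obtain ⟨n, hn⟩ : ∃ n, C₀ ⊆ C n := by
      choose! m hm using fun x (hx : x ∈ C₀) => Set.mem_iUnion.1 (hC₀ hx)
      refine ⟨hfin₀.toFinset.sup m, fun x hx => ?_⟩
      exact hmono (Finset.le_sup (hfin₀.mem_toFinset.2 hx)) (hm x hx)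
    refine ⟨n, image_mono (h₀.trans (acl_mono _ ?_))⟩
    rw [Set.union_comm]
    exact Set.union_subset_union_right _ hn
  obtain ⟨l, hl⟩ : ∃ l : List (ιacl (C n)), (lset _ l).1 = F := by
    have hF' : {x : ιacl (C n) | x.1 ∈ F}.Finite :=
      Set.Finite.preimage Subtype.val_injective.injOn hFfin
    refine ⟨hF'.toFinset.toList, ?_⟩
    ext x
    simp only [hlset, Set.mem_image]
    constructor
    · rintro ⟨y, hy, rfl⟩
      simpa using hy
    · exact fun hx => ⟨⟨x, hn hx⟩, by simpa using hx, rfl⟩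
  have hDC : D (lset _ l) ⊆ image (Fam.incl V.carrier) (acl V.str (⋃ n, C n)) := by
    intro d hd
    refine image_mono (acl_mono _ ?_) (hg ⟨d, hDb _ hd⟩)
    refine Set.Subset.trans ?_ (Set.subset_iUnion C (n + 1))
    rw [hsucc]
    refine Set.Subset.trans ?_ Set.subset_union_right
    refine Set.Subset.trans ?_ (Set.subset_iUnion _ l)
    exact Set.subset_iUnion (fun d : D (lset _ l) => g ⟨d.1, hDb _ d.2⟩) ⟨d, hd⟩
  have hR := hDR (lset _ l)
  rw [hl] at hR
  have hsF : Small κ F := lt_of_lt_of_le (lt_aleph0_iff_set_finite.2 hFfin) hS.aleph0_le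
  have hb := hbm F _ _ (image (Fam.incl V.carrier) (acl V.str (⋃ n, C n))) hsF hsb
    (hsb.mono (hDb _)) (hS.small_image_acl hsC)
    (by rw [Set.union_comm (image _ _), image_acl_union_eq hCωB]; exact hR)
  rwa [Set.union_eq_right.2 hDC] at hb

end Setting

end MultiSorted

theorem mainTheorem4 {S : Type u} {L₀ L : Lang S} (i : Incl L₀ L)
    -- the size of the monster models
    (κ : Cardinal.{u}) (hκ_limit : Order.IsSuccLimit κ) (hκ_cof : 2 ^ L.card < κ.ord.cof)
    -- `T₀`, its monster model and `⫝⁰`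
    (T₀ : Theory L₀) (hT₀_complete : T₀.IsComplete) (hT₀_mc : T₀.IsModelComplete)
    {U₀ : S → Type u} (𝔘₀ : Str L₀ U₀) (hU₀ : 𝔘₀.Models T₀) (hU₀_monster : IsMonster κ 𝔘₀)
    (R₀ : IndRel U₀) (hR₀ : Invariance κ 𝔘₀ R₀)
    -- `T`
    (T : Theory L) (hT : T₀.universal.ContainedVia i T) (hT_der : DerivationLike i κ 𝔘₀ R₀ T)
    -- the model companion of `T` and a monster model of one of its completions
    (Tp : Theory L) (hTp : Tp.IsModelCompanion T) (hTTp : T.Contained Tp)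
    (Up : Sub i 𝔘₀) (hUp : Up.str.Models Tp) (hUp_monster : IsMonster κ Up.str)
    (hQE : T₀.ContainedVia i Tp ∨ T₀.HasQE) :
    -- (1)
    (Invariance κ Up.str (indPlus Up R₀) ∧ Normality κ (indPlus Up R₀)) ∧
    -- (2)
    ((Monotonicity κ anyBase R₀ → Monotonicity κ anyBase (indPlus Up R₀)) ∧
      (LeftMonotonicity κ anyBase R₀ → LeftMonotonicity κ anyBase (indPlus Up R₀)) ∧
      (Symmetry κ anyBase R₀ → Symmetry κ anyBase (indPlus Up R₀)) ∧
      (FiniteCharacter κ anyBase R₀ → LeftMonotonicity κ anyBase R₀ →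
        FiniteCharacter κ anyBase (indPlus Up R₀))) ∧
    -- (3)
    (Transitivity κ anyBase R₀ → LeftMonotonicity κ anyBase R₀ →
      Transitivity κ anyBase (indPlus Up R₀)) ∧
    -- (4)
    (BaseMonotonicity κ R₀ → FiniteCharacter κ anyBase R₀ → LocalCharacter κ R₀ →
      LocalCharacter κ (indPlus Up R₀)) ∧
    -- (5)
    (Normality κ R₀ → Monotonicity κ anyBase R₀ → BaseMonotonicity κ R₀ →
      Transitivity κ anyBase R₀ → Symmetry κ anyBase R₀ → FullExistence κ 𝔘₀ R₀ →
      BaseMonotonicity κ (indPlus Up R₀)) ∧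
    -- (6)
    ((T₀.ContainedVia i T ∨ T₀.HasQE) →
      Monotonicity κ anyBase R₀ → Symmetry κ anyBase R₀ → FullExistence κ 𝔘₀ R₀ →
      FullExistence κ Up.str (indPlus Up R₀)) ∧
    -- (7)
    ((T₀.ContainedVia i T ∨ T₀.HasQE) → (Tp.HasQE ∨ T₀.ContainedVia i T ∧ Tp.HasQEOver i) →
      Monotonicity κ anyBase R₀ → Extension κ 𝔘₀ anyBase R₀ →
      Extension κ Up.str anyBase (indPlus Up R₀)) ∧
    -- (2), (3) and (7) over models
    (T₀.ContainedVia i Tp →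
      (Monotonicity κ (IsModelIn 𝔘₀ T₀) R₀ →
        Monotonicity κ (IsModelIn Up.str Tp) (indPlus Up R₀)) ∧
      (LeftMonotonicity κ (IsModelIn 𝔘₀ T₀) R₀ →
        LeftMonotonicity κ (IsModelIn Up.str Tp) (indPlus Up R₀)) ∧
      (Symmetry κ (IsModelIn 𝔘₀ T₀) R₀ →
        Symmetry κ (IsModelIn Up.str Tp) (indPlus Up R₀)) ∧
      (FiniteCharacter κ (IsModelIn 𝔘₀ T₀) R₀ → LeftMonotonicity κ (IsModelIn 𝔘₀ T₀) R₀ →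
        FiniteCharacter κ (IsModelIn Up.str Tp) (indPlus Up R₀)) ∧
      (Transitivity κ (IsModelIn 𝔘₀ T₀) R₀ → LeftMonotonicity κ (IsModelIn 𝔘₀ T₀) R₀ →
        Transitivity κ (IsModelIn Up.str Tp) (indPlus Up R₀)) ∧
      ((T₀.ContainedVia i T ∨ T₀.HasQE) →
        (Tp.HasQE ∨ T₀.ContainedVia i T ∧ Tp.HasQEOver i) →
        Monotonicity κ (IsModelIn 𝔘₀ T₀) R₀ → Extension κ 𝔘₀ (IsModelIn 𝔘₀ T₀) R₀ →
        Extension κ Up.str (IsModelIn Up.str Tp) (indPlus Up R₀))) := by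
  have hcard : L.card < κ :=
    (Cardinal.cantor _).trans (hκ_cof.trans_le (Ordinal.cof_ord_le κ))
  have hS : Setting i κ T₀ 𝔘₀ R₀ T Tp Up :=
    { aleph0_le := L.aleph0_le_card.trans hcard.le
      card_lt := hcard
      mc₀ := hT₀_mc
      models₀ := hU₀
      monster₀ := hU₀_monster
      inv := hR₀
      der := hT_der
      mc := hTp.1
      embeds := hTp.2.1
      contained := hTTp
      models := hUp
      monster := hUp_monster
      qe := hQE }
  have hany : ∀ C : Set (El (Fam Up.carrier)), anyBase C →
      anyBase (image (Fam.incl Up.carrier) (acl Up.str C)) := fun _ _ => trivial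
  refine ⟨⟨hS.invariance, Setting.normality⟩,
    ⟨hS.monotonicity hany, hS.leftMonotonicity hany, hS.symmetry hany, hS.finiteCharacter hany⟩,
    hS.transitivity hany, hS.localCharacter hκ_limit hκ_cof, hS.baseMonotonicity,
    hS.fullExistence, fun hT' hqe _ => hS.extension hany hT' hqe, fun hT₀ => ?_⟩
  have hmod : ∀ C, IsModelIn Up.str Tp C →
      IsModelIn 𝔘₀ T₀ (image (Fam.incl Up.carrier) (acl Up.str C)) :=
    fun _ => hS.isModelIn_base hT₀
  exact ⟨hS.monotonicity hmod, hS.leftMonotonicity hmod, hS.symmetry hmod,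
    hS.finiteCharacter hmod, hS.transitivity hmod, fun hT' hqe _ => hS.extension hmod hT' hqe⟩
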